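/- For every $n\ge 1$ let $\mathfrak g$ be a complex simple Lie algebra of type $B_n$ (where $B_1=A_1$), let $\mathfrak h$ be a Cartan subalgebra, let $\Delta^+$ be a positive system of roots, and let $\mathfrak b=\mathfrak h\oplus\bigoplus_{\alpha\in\Delta^+}\mathfrak g_\alpha$ be the corresponding Borel subalgebra. An ad-nilpotent ideal of $\mathfrak b$ is an ideal of $\mathfrak b$ all of whose elements are ad-nilpotent. The class of nilpotence of such an ideal $\mathfrak i$ is the smallest $m\ge 0$ such that $m$-fold bracketing of $\mathfrak i$ with itself gives the zero ideal (so the zero ideal has class $0$, and $\mathfrak i$ is Abelian if and only if its class is at most $1$). For $h\ge 0$ let $\beta^{\le}_n(h)$ denote the number of ad-nilpotent ideals of $\mathfrak b$ with class of nilpotence at most $h$. Let $U_k$ denote the $k$-th Chebyshev polynomial of the second kind, $U_k(\cos t)=\sin((k+1)t)/\sin t$, and write $\tilde U_k=U_k\bigl(1/(2\sqrt x)\bigr)$. Then, for every integer $h\ge 0$, the generating function $\sum_{n\ge 1}\beta^{\le}_n(h)\,x^n$, as a formal power series in $x$ (in a field of formal series containing $\sqrt x$, in which $\tilde U_{h+1}\tilde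 U_{h+2}\neq 0$), is given by $$\sum_{n\ge 1}\beta^{\le}_n(h)\,x^n=\begin{cases} \dfrac{\sum_{i=1}^{h/2}(2i+1)\,\tilde U_{2i-1}+(h+1)\,\tilde U_{h+1}+\sum_{i=1}^{h/2}2i\,\tilde U_{2h+3-2i}}{\tilde U_{h+1}\,\tilde U_{h+2}} & \text{if } h \text{ is even},\\[3ex] \dfrac{\sum_{i=1}^{(h-1)/2}(2i+1)\,\tilde U_{2i-1}+(h+1)\,\tilde U_{h}+\sum_{i=1}^{(h+1)/2}2i\,\tilde U_{2h+3-2i}}{\tilde U_{h+1}\,\tilde U_{h+2}} & \text{if } h \text{ is odd}. \end{cases}$$ -/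

import Mathlib

noncomputable section

namespace TypeBIdeals

section LieAlgebra

open LieAlgebra LieAlgebra.IsKilling LieModule Module

variable {g : Type*} [LieRing g] [LieAlgebra ℂ g] [FiniteDimensional ℂ g] [IsKilling ℂ g]
  {H : LieSubalgebra ℂ g} [H.IsCartanSubalgebra]

/-- The simple roots of the base `b` of the root system of `(g, H)` can be numbered
`α₁, …, αₙ` such that the Cartan matrix, with entries `αᵢ(αⱼ^∨)`, is the Cartan matrix of
type `Bₙ`. -/
def IsTypeB (n : ℕ) (b : (rootSystem H).Base) : Prop :=
  ∃ e : Fin n ≃ b.support, ∀ i j, b.cartanMatrix (e i) (e j) = CartanMatrix.B n i j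

/-- The nilradical `⨁ 𝔤_α`, the sum being over the roots `α` that are positive for `b`. -/
def positivePart (b : (rootSystem H).Base) : Submodule ℂ g :=
  ⨆ α : {α : H.root // b.IsPos α}, (rootSpace H (α.1.1 : H → ℂ)).toSubmodule

lemma lie_mem_positivePart_of_isPos (b : (rootSystem H).Base) {α β : H.root}
    (hα : b.IsPos α) (hβ : b.IsPos β) {x y : g}
    (hx : x ∈ rootSpace H (α.1 : H → ℂ)) (hy : y ∈ rootSpace H (β.1 : H → ℂ)) :
    ⁅x, y⁆ ∈ positivePart b := by
  have hxy := lie_mem_genWeightSpace_of_mem_genWeightSpace hx hy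
  by_cases h0 : genWeightSpace g ((α.1 : H → ℂ) + (β.1 : H → ℂ)) = ⊥
  · rw [h0, LieSubmodule.mem_bot] at hxy
    rw [hxy]
    exact zero_mem _
  let γ : Weight ℂ H g := ⟨(α.1 : H → ℂ) + (β.1 : H → ℂ), h0⟩
  by_cases hγ : γ.IsZero
  · exfalso
    have hneg : (rootSystem H).root β = - (rootSystem H).root α := by
      ext h
      have := congr_fun hγ h
      simp only [rootSystem_root_apply, Weight.toLinear_apply, LinearMap.neg_apply]
      have h2 : α.1 h + β.1 h = 0 := this
      linear_combination h2
    have h1 : b.height α = b.height β + (-2 : ℤ) • b.height β := by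
      refine b.height_add_zsmul ?_
      rw [hneg]
      module
    have h2 : 0 < b.height α := hα
    have h3 : 0 < b.height β := hβ
    simp only [smul_eq_mul] at h1
    linarith
  · let δ : H.root := ⟨γ, by simpa using hγ⟩
    have hadd : (rootSystem H).root δ = (rootSystem H).root α + (rootSystem H).root β := by
      ext h
      rfl
    have hδ : b.IsPos δ := by
      have h1 := b.height_add hadd
      have h2 : 0 < b.height α := hα
      have h3 : 0 < b.height β := hβ
      change 0 < b.height δ
      linarith
    exact Submodule.mem_iSup_of_mem (p := fun α : {α : H.root // b.IsPos α} ↦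
      (rootSpace H (α.1.1 : H → ℂ)).toSubmodule) ⟨δ, hδ⟩ hxy

lemma lie_mem_positivePart (b : (rootSystem H).Base) {x y : g}
    (hx : x ∈ positivePart b) (hy : y ∈ positivePart b) : ⁅x, y⁆ ∈ positivePart b := by
  refine Submodule.iSup_induction _ (motive := fun x ↦ ⁅x, y⁆ ∈ positivePart b) hx
    (fun α x hx ↦ ?_) (by simp) (fun x x' h h' ↦ by rw [add_lie]; exact add_mem h h')
  refine Submodule.iSup_induction _ (motive := fun y ↦ ⁅x, y⁆ ∈ positivePart b) hy
    (fun β y hy ↦ ?_) (by simp) (fun y y' h h' ↦ by rw [lie_add]; exact add_mem h h')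
  exact lie_mem_positivePart_of_isPos b α.2 β.2 hx hy

lemma lie_cartan_mem_positivePart (b : (rootSystem H).Base) {h x : g}
    (hh : h ∈ H) (hx : x ∈ positivePart b) : ⁅h, x⁆ ∈ positivePart b := by
  refine Submodule.iSup_induction _ (motive := fun x ↦ ⁅h, x⁆ ∈ positivePart b) hx
    (fun α x hx ↦ ?_) (by simp) (fun x x' h h' ↦ by rw [lie_add]; exact add_mem h h')
  exact Submodule.mem_iSup_of_mem (p := fun α : {α : H.root // b.IsPos α} ↦
      (rootSpace H (α.1.1 : H → ℂ)).toSubmodule) α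
    ((rootSpace H (α.1.1 : H → ℂ)).lie_mem (x := (⟨h, hh⟩ : H)) hx)

/-- The Borel subalgebra `𝔟 = 𝔥 ⊕ 𝔫` attached to a Cartan subalgebra `H` and a base `b`
of the root system. -/
def borel (b : (rootSystem H).Base) : LieSubalgebra ℂ g where
  toSubmodule := H.toSubmodule ⊔ positivePart b
  lie_mem' := by
    intro x y hx hy
    obtain ⟨h, hh, u, hu, rfl⟩ := Submodule.mem_sup.mp hx
    obtain ⟨k, hk, v, hv, rfl⟩ := Submodule.mem_sup.mp hy
    have e : ⁅h + u, k + v⁆ = ⁅h, k⁆ + (⁅h, v⁆ - ⁅k, u⁆ + ⁅u, v⁆) := by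
      rw [add_lie, lie_add, lie_add, ← lie_skew u k]
      abel
    change ⁅h + u, k + v⁆ ∈ H.toSubmodule ⊔ positivePart b
    rw [e]
    exact Submodule.add_mem_sup (H.lie_mem hh hk) (add_mem (sub_mem
      (lie_cartan_mem_positivePart b hh hv) (lie_cartan_mem_positivePart b hk hu))
      (lie_mem_positivePart b hu hv))

/-- The ad-nilpotent ideals of the Borel subalgebra: those ideals of `borel b` all of whose
elements are ad-nilpotent. -/
def adNilpotentIdeals (b : (rootSystem H).Base) : Set (LieIdeal ℂ (borel b)) :=
  {I | ∀ x ∈ I, IsNilpotent (LieAlgebra.ad ℂ g (x : g))}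

/-- The class of nilpotence of an ideal `I` of `borel b`, as a Lie algebra in its own right: the
least `m` such that the `m`-fold bracketing of `I` with itself is zero (so the zero ideal has
class `0` and the nonzero abelian ideals have class `1`). -/
def nilpotenceClass (b : (rootSystem H).Base) (I : LieIdeal ℂ (borel b)) : ℕ :=
  nilpotencyLength I I

/-- The number of ad-nilpotent ideals of `borel b` with class of nilpotence at most `h`. -/
def numIdeals (b : (rootSystem H).Base) (h : ℕ) : ℕ :=
  {I ∈ adNilpotentIdeals b | nilpotenceClass b I ≤ h}.ncard

end LieAlgebra

section Chebyshev

/-- The field of Hahn series `∑ c_q x^q` with rational coefficients and rational exponents: it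
contains the power series in `x` and a square root of `x`. -/
abbrev Series : Type := HahnSeries ℚ ℚ

/-- The series `√x`. -/
def sqrtX : Series := HahnSeries.single (1 / 2 : ℚ) 1

/-- `Ũ_k = U_k(1 / (2 √x))`, with `U_k` the Chebyshev polynomial of the second kind. -/
def Utilde (k : ℤ) : Series :=
  Polynomial.aeval (1 / (2 * sqrtX)) (Polynomial.Chebyshev.U ℚ k)

/-- The power series `∑ a_n x^(n+1)`, with `n` running over the natural numbers, seen in the field
of series that contains `√x`. -/
def genFun (a : ℕ → ℕ) : Series :=
  HahnSeries.ofPowerSeries ℚ ℚ (PowerSeries.X * PowerSeries.mk fun n ↦ (a n : ℚ))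

end Chebyshev

end TypeBIdeals

end

/-! An ad-nilpotent ideal of the Borel subalgebra is stable under the Cartan subalgebra and meets it
in zero, so it is the sum of the root spaces of a set `Φ` of positive roots closed under adding
positive roots. The bracket of the root spaces of `α` and `β` is the whole root space of `α + β`
when this is a root, so the lower central series of the ideal is given by the iterated sums of
elements of `Φ` (`numIdeals_eq_ncard_isUpper`).

In type `Bₙ`, let `ω p`, `-n ≤ p ≤ n`, be the weights of the representation of dimension `2n + 1`.
The positive roots are the differences `ω p - ω q` with `p < q` and `p ≠ -q`, and `ω p - ω q = ω
(-q) - ω (-p)`. So `Φ` becomes a sequence `v 1, …, v n`, and iterated sums become chains of labels.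
A longest chain is found greedily: it jumps from `-n` to `v n`, runs through a longest chain between
`v n` and `-v n`, and makes one step out of that interval. Let `m` be its length and `n - c` the
least label at which such a chain can end. By `chain_stat`, `(m, c)` obeys a recursion, and the
class is at most `h` exactly when `m ≤ h`, or `m = h + 1` and `c = 0`.

The recursion cuts a sequence with statistic `m + 2` into its last entry, two independent blocks and
a sequence with statistic `m` (`layer_add_two`). With the weight `x ^ n * A ^ c * B ^ s`, where `s`
is `slack`, counting the blocks replaces `A`, `B` by `(1 - x * A)⁻¹`, `(1 - x * B)⁻¹` and
contributes a factor (`layerSum_add_three`). For `x = q / (1 + q) ^ 2` this Möbius map is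
multiplication by `q` in a suitable coordinate, which gives closed forms for every `m`
(`layerParam_odd`, `layerParam_even`). Their sums over `m` are evaluated by induction.

Finally `q = exp (2it)` corresponds to `1 / (2 √x) = cos t`, so powers of `q` are Chebyshev values.
An identity valid for `0 < q < 1` is one of power series in `x`, since `x` tends to `0` with `q`;
after multiplication by a power of `√x` it is the claimed formula. -/

namespace TypeBIdeals

/-! ### Ad-nilpotent ideals and upper sets of positive roots -/

section LieTheory

open LieAlgebra LieAlgebra.IsKilling LieModule Module

variable {g : Type*} [LieRing g] [LieAlgebra ℂ g] [FiniteDimensional ℂ g] [IsKilling ℂ g]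
  {H : LieSubalgebra ℂ g} [H.IsCartanSubalgebra]

/-- The bracket of nonzero root vectors is nonzero as soon as the sum of the weights is again a
weight. -/
lemma lie_ne_zero_of_add_ne_bot {α β : Weight ℂ H g} (hα : α.IsNonZero) (hβ : β.IsNonZero)
    (hαβ : rootSpace H ((α : H → ℂ) + (β : H → ℂ)) ≠ ⊥) {x y : g}
    (hx : x ∈ rootSpace H (α : H → ℂ)) (hx0 : x ≠ 0)
    (hy : y ∈ rootSpace H (β : H → ℂ)) (hy0 : y ≠ 0) : ⁅x, y⁆ ≠ 0 := by
  -- The `sl₂`-triple of `α` acts on the `α`-string through `β`, of length `L`. With `z` at the top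
  -- and `β` lying `p + 1` places below it, `e f ^ (p + 1) z = (p + 1) (L - p) f ^ p z`, which is
  -- nonzero because `p + 1 ≤ L`. As root spaces are lines, `x` and `y` may replace `e` and `f ^ (p
  -- + 1) z`.
  obtain ⟨z, hz, z_ne0⟩ := (chainTop α β).exists_ne_zero
  obtain ⟨h, e, f, isSl2, he, hf⟩ := exists_isSl2Triple_of_weight_isNonZero hα
  obtain rfl := isSl2.h_eq_coroot hα he hf
  have prim : isSl2.HasPrimitiveVectorWith z (chainLength α β : ℂ) :=
    have := lie_mem_genWeightSpace_of_mem_genWeightSpace he hz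
    ⟨z_ne0, (chainLength_smul _ _ hz).symm, by rwa [genWeightSpace_add_chainTop _ _ hα] at this⟩
  have htop : 1 ≤ chainTopCoeff α β := by
    have := ((rootSpace_zsmul_add_ne_bot_iff α β hα 1).mp (by simpa using hαβ)).1
    exact_mod_cast this
  obtain ⟨p, hp⟩ : ∃ p, chainTopCoeff α β = p + 1 := ⟨chainTopCoeff α β - 1, by omega⟩
  have hlen : p + 1 ≤ chainLength α β := hp ▸ chainTopCoeff_le_chainLength α β
  have hw : ((toEnd ℂ g g f) ^ (p + 1)) z ∈ rootSpace H (β : H → ℂ) := by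
    have := toEnd_pow_apply_mem hf hz (p + 1)
    rw [coe_chainTop, hp] at this
    convert this using 2
    module
  have hw0 := prim.pow_toEnd_f_ne_zero_of_eq_nat rfl hlen
  have hep : ⁅e, ((toEnd ℂ g g f) ^ (p + 1)) z⁆ ≠ 0 := by
    rw [prim.lie_e_pow_succ_toEnd_f]
    refine smul_ne_zero (mul_ne_zero (by exact_mod_cast p.succ_ne_zero) ?_)
      (prim.pow_toEnd_f_ne_zero_of_eq_nat rfl (by omega))
    rw [sub_ne_zero]
    exact_mod_cast (by omega : chainLength α β ≠ p)
  obtain ⟨c, hc⟩ : ∃ c : ℂ, c • y = ((toEnd ℂ g g f) ^ (p + 1)) z := by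
    simpa using (finrank_eq_one_iff_of_nonzero' (⟨y, hy⟩ : rootSpace H (β : H → ℂ))
      (by simpa using hy0)).mp (finrank_rootSpace_eq_one β hβ) ⟨_, hw⟩
  obtain ⟨d, hd⟩ : ∃ d : ℂ, d • x = e := by
    simpa using (finrank_eq_one_iff_of_nonzero' (⟨x, hx⟩ : rootSpace H (α : H → ℂ))
      (by simpa using hx0)).mp (finrank_rootSpace_eq_one α hα) ⟨_, he⟩
  intro h0
  apply hep
  rw [← hc, ← hd, lie_smul, smul_lie, h0, smul_zero, smul_zero]

variable (b : (rootSystem H).Base)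

/-- The positive roots. -/
abbrev PosRoot : Type _ := {α : H.root // b.IsPos α}

variable {b}

/-- The sum of the root spaces of a set of positive roots. -/
noncomputable def sumRootSpaces (Φ : Set (PosRoot b)) : Submodule ℂ g :=
  ⨆ α ∈ Φ, (rootSpace H (α.1.1 : H → ℂ)).toSubmodule

/-- `γ = α + β` for positive roots. -/
def IsSum (α β γ : PosRoot b) : Prop :=
  (rootSystem H).root γ.1 = (rootSystem H).root α.1 + (rootSystem H).root β.1

lemma IsSum.coe_eq {α β γ : PosRoot b} (h : IsSum α β γ) :
    (γ.1.1 : H → ℂ) = (α.1.1 : H → ℂ) + (β.1.1 : H → ℂ) := by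
  funext x
  simpa using! LinearMap.congr_fun h x

/-- The sets of positive roots that are closed under adding positive roots. -/
def IsUpper (Φ : Set (PosRoot b)) : Prop :=
  ∀ α β γ : PosRoot b, IsSum α β γ → β ∈ Φ → γ ∈ Φ

/-- The set of roots that are sums of an element of `Φ` and one of `Ψ`. -/
def sumSet (Φ Ψ : Set (PosRoot b)) : Set (PosRoot b) :=
  {γ | ∃ α ∈ Φ, ∃ β ∈ Ψ, IsSum α β γ}

/-- The set of roots that are iterated sums of `k + 1` elements of `Φ`. -/
def sumPow (Φ : Set (PosRoot b)) : ℕ → Set (PosRoot b)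
  | 0 => Φ
  | k + 1 => sumSet Φ (sumPow Φ k)

lemma rootSpace_le_sumRootSpaces {Φ : Set (PosRoot b)} {α : PosRoot b} (h : α ∈ Φ) :
    (rootSpace H (α.1.1 : H → ℂ)).toSubmodule ≤ sumRootSpaces Φ :=
  le_iSup₂_of_le α h le_rfl

lemma sumRootSpaces_induction {Φ : Set (PosRoot b)} {p : g → Prop}
    (hp : ∀ α ∈ Φ, ∀ x ∈ rootSpace H (α.1.1 : H → ℂ), p x) (h0 : p 0)
    (hadd : ∀ x y, p x → p y → p (x + y)) {x : g} (hx : x ∈ sumRootSpaces Φ) : p x := by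
  rw [sumRootSpaces, iSup_subtype'] at hx
  exact Submodule.iSup_induction _ (motive := p) hx (fun α x hx ↦ hp α.1 α.2 x hx) h0 hadd

omit [IsKilling ℂ g] in
lemma isNonZero_of_root (α : H.root) : α.1.IsNonZero := LieSubalgebra.isNonZero_coe_root α

lemma rootSpace_atom (α : H.root) : IsAtom (rootSpace H (α.1 : H → ℂ)).toSubmodule :=
  Submodule.isAtom_iff_finrank_eq_one.mpr (finrank_rootSpace_eq_one α.1 (isNonZero_of_root α))

omit [FiniteDimensional ℂ g] [IsKilling ℂ g] in
lemma iSupIndep_rootSpaces :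
    iSupIndep fun χ : H → ℂ ↦ (rootSpace H χ).toSubmodule := by
  have := iSupIndep_genWeightSpace ℂ H g
  rwa [LieSubmodule.iSupIndep_toSubmodule]

lemma disjoint_rootSpace_sumRootSpaces {Φ : Set (PosRoot b)} {χ : H → ℂ}
    (h : ∀ α ∈ Φ, (α.1.1 : H → ℂ) ≠ χ) :
    Disjoint (rootSpace H χ).toSubmodule (sumRootSpaces Φ) := by
  refine (iSupIndep_rootSpaces (H := H) χ).mono_right (iSup₂_le fun α hα ↦ ?_)
  exact le_iSup₂_of_le (α.1.1 : H → ℂ) (h α hα) le_rfl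

lemma posRoot_ext {α β : PosRoot b} (h : (α.1.1 : H → ℂ) = (β.1.1 : H → ℂ)) : α = β :=
  Subtype.ext (Subtype.ext (DFunLike.coe_injective h))

lemma rootSpace_le_sumRootSpaces_iff {Φ : Set (PosRoot b)} {α : PosRoot b} :
    (rootSpace H (α.1.1 : H → ℂ)).toSubmodule ≤ sumRootSpaces Φ ↔ α ∈ Φ := by
  refine ⟨fun h ↦ ?_, rootSpace_le_sumRootSpaces⟩
  by_contra hα
  have := disjoint_rootSpace_sumRootSpaces (Φ := Φ) (χ := (α.1.1 : H → ℂ))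
    (fun β hβ e ↦ hα (posRoot_ext e ▸ hβ))
  exact (rootSpace_atom α.1).1 (this.eq_bot_of_le h)

lemma sumRootSpaces_injective : Function.Injective (sumRootSpaces (b := b)) := by
  intro Φ Ψ h
  ext α
  rw [← rootSpace_le_sumRootSpaces_iff, ← rootSpace_le_sumRootSpaces_iff, h]

lemma sumRootSpaces_mono {Φ Ψ : Set (PosRoot b)} (h : Φ ⊆ Ψ) :
    sumRootSpaces Φ ≤ sumRootSpaces Ψ :=
  biSup_mono h

lemma sumRootSpaces_eq_bot_iff {Φ : Set (PosRoot b)} : sumRootSpaces Φ = ⊥ ↔ Φ = ∅ := by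
  rw [← sumRootSpaces_injective.eq_iff]
  simp [sumRootSpaces]

/-- Brackets of root vectors for positive roots lie in the root space of the sum. -/
lemma lie_mem_of_posRoot {Ξ : Set (PosRoot b)} {α β : PosRoot b}
    (h : ∀ γ, IsSum α β γ → γ ∈ Ξ) {x y : g}
    (hx : x ∈ rootSpace H (α.1.1 : H → ℂ)) (hy : y ∈ rootSpace H (β.1.1 : H → ℂ)) :
    ⁅x, y⁆ ∈ sumRootSpaces Ξ := by
  have hxy := lie_mem_genWeightSpace_of_mem_genWeightSpace hx hy
  by_cases h0 : genWeightSpace g ((α.1.1 : H → ℂ) + (β.1.1 : H → ℂ)) = ⊥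
  · rw [h0, LieSubmodule.mem_bot] at hxy
    rw [hxy]
    exact zero_mem _
  let γ : Weight ℂ H g := ⟨(α.1.1 : H → ℂ) + (β.1.1 : H → ℂ), h0⟩
  by_cases hγ : γ.IsZero
  · exfalso
    have hneg : (rootSystem H).root β.1 = - (rootSystem H).root α.1 := by
      ext h
      have h2 : α.1.1 h + β.1.1 h = 0 := congr_fun hγ h
      simp only [rootSystem_root_apply, Weight.toLinear_apply, LinearMap.neg_apply]
      linear_combination h2
    have h1 : b.height α.1 = b.height β.1 + (-2 : ℤ) • b.height β.1 :=
      b.height_add_zsmul (by rw [hneg]; module)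
    have h2 : 0 < b.height α.1 := α.2
    have h3 : 0 < b.height β.1 := β.2
    simp only [smul_eq_mul] at h1
    linarith
  · let δ : H.root := ⟨γ, by simpa using hγ⟩
    have hadd : (rootSystem H).root δ = (rootSystem H).root α.1 + (rootSystem H).root β.1 := by
      ext h
      rfl
    exact rootSpace_le_sumRootSpaces (h ⟨δ, α.2.add β.2 hadd⟩ hadd) hxy

lemma lie_mem_sumRootSpaces {Φ Ψ Ξ : Set (PosRoot b)}
    (h : ∀ α ∈ Φ, ∀ β ∈ Ψ, ∀ γ, IsSum α β γ → γ ∈ Ξ) {x y : g}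
    (hx : x ∈ sumRootSpaces Φ) (hy : y ∈ sumRootSpaces Ψ) : ⁅x, y⁆ ∈ sumRootSpaces Ξ := by
  refine sumRootSpaces_induction (p := fun x ↦ ⁅x, y⁆ ∈ sumRootSpaces Ξ)
    (fun α hα x hx ↦ ?_) (by simp) (fun x x' h h' ↦ by rw [add_lie]; exact add_mem h h') hx
  refine sumRootSpaces_induction (p := fun y ↦ ⁅x, y⁆ ∈ sumRootSpaces Ξ)
    (fun β hβ y hy ↦ ?_) (by simp) (fun y y' h h' ↦ by rw [lie_add]; exact add_mem h h') hy
  exact lie_mem_of_posRoot (fun γ ↦ h α hα β hβ γ) hx hy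

lemma lie_cartan_mem_sumRootSpaces {Φ : Set (PosRoot b)} {h x : g} (hh : h ∈ H)
    (hx : x ∈ sumRootSpaces Φ) : ⁅h, x⁆ ∈ sumRootSpaces Φ := by
  refine sumRootSpaces_induction (p := fun x ↦ ⁅h, x⁆ ∈ sumRootSpaces Φ)
    (fun α hα x hx ↦ ?_) (by simp) (fun x x' h h' ↦ by rw [lie_add]; exact add_mem h h') hx
  exact rootSpace_le_sumRootSpaces hα
    ((rootSpace H (α.1.1 : H → ℂ)).lie_mem (x := (⟨h, hh⟩ : H)) hx)

lemma positivePart_eq : positivePart b = sumRootSpaces (Set.univ : Set (PosRoot b)) := by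
  simp [positivePart, sumRootSpaces]

/-- The root space of `α + β` is contained in every subspace that contains the brackets of the
root vectors for `α` and `β`. -/
lemma rootSpace_le_of_isSum {α β γ : PosRoot b} (h : IsSum α β γ) {N : Submodule ℂ g}
    (hN : ∀ x ∈ rootSpace H (α.1.1 : H → ℂ), ∀ y ∈ rootSpace H (β.1.1 : H → ℂ), ⁅x, y⁆ ∈ N) :
    (rootSpace H (γ.1.1 : H → ℂ)).toSubmodule ≤ N := by
  obtain ⟨x, hx, hx0⟩ := α.1.1.exists_ne_zero
  obtain ⟨y, hy, hy0⟩ := β.1.1.exists_ne_zero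
  have hne : rootSpace H ((α.1.1 : H → ℂ) + (β.1.1 : H → ℂ)) ≠ ⊥ := by
    rw [← h.coe_eq]; exact γ.1.1.genWeightSpace_ne_bot
  have hxy0 := lie_ne_zero_of_add_ne_bot (isNonZero_of_root α.1) (isNonZero_of_root β.1) hne
    hx hx0 hy hy0
  have hxy := lie_mem_genWeightSpace_of_mem_genWeightSpace hx hy
  rw [← h.coe_eq] at hxy
  intro z hz
  obtain ⟨c, hc⟩ : ∃ c : ℂ, c • ⁅x, y⁆ = z := by
    simpa using (finrank_eq_one_iff_of_nonzero' (⟨_, hxy⟩ : rootSpace H (γ.1.1 : H → ℂ))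
      (by simpa using hxy0)).mp (finrank_rootSpace_eq_one γ.1.1 (isNonZero_of_root γ.1)) ⟨_, hz⟩
  rw [← hc]
  exact N.smul_mem c (hN x hx y hy)

variable (b) in
/-- The linear functional on the dual of the Cartan subalgebra that is `1` on simple roots. -/
noncomputable def heightFunctional : Dual ℂ H →ₗ[ℂ] ℂ :=
  b.toWeightBasis.constr ℂ fun _ ↦ (1 : ℂ)

lemma heightFunctional_root (α : H.root) :
    heightFunctional b ((rootSystem H).root α) = (b.height α : ℂ) := by
  obtain ⟨f, -, -, hf⟩ := b.exists_root_eq_sum_int α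
  rw [RootPairing.Base.height_eq_sum hf, hf, map_sum, Int.cast_sum]
  refine Finset.sum_congr rfl fun j hj ↦ ?_
  have h1 : heightFunctional b ((rootSystem H).root j) = 1 := by
    have := b.toWeightBasis.constr_basis ℂ (fun _ ↦ (1 : ℂ)) ⟨j, hj⟩
    rwa [RootPairing.Base.toWeightBasis_apply] at this
  rw [map_zsmul, h1, zsmul_eq_mul, mul_one]

variable (b) in
/-- The sum of the weight spaces of height at least `r`. -/
noncomputable def heightFiltration (r : ℝ) : Submodule ℂ g :=
  ⨆ χ : {χ : Weight ℂ H g // r ≤ (heightFunctional b χ.toLinear).re},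
    (rootSpace H (χ.1 : H → ℂ)).toSubmodule

lemma lie_mem_heightFiltration {r : ℝ} {x y : g} (hx : x ∈ sumRootSpaces (Set.univ : Set (PosRoot b)))
    (hy : y ∈ heightFiltration b r) : ⁅x, y⁆ ∈ heightFiltration b (r + 1) := by
  refine sumRootSpaces_induction (p := fun x ↦ ⁅x, y⁆ ∈ heightFiltration b (r + 1))
    (fun α hα x hx ↦ ?_) (by simp) (fun x x' h h' ↦ by rw [add_lie]; exact add_mem h h') hx
  refine Submodule.iSup_induction _ (motive := fun y ↦ ⁅x, y⁆ ∈ heightFiltration b (r + 1)) hy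
    (fun χ y hy ↦ ?_) (by simp) (fun y y' h h' ↦ by rw [lie_add]; exact add_mem h h')
  have hxy := lie_mem_genWeightSpace_of_mem_genWeightSpace hx hy
  by_cases h0 : genWeightSpace g ((α.1.1 : H → ℂ) + (χ.1 : H → ℂ)) = ⊥
  · rw [h0, LieSubmodule.mem_bot] at hxy
    rw [hxy]
    exact zero_mem _
  let ψ : Weight ℂ H g := ⟨(α.1.1 : H → ℂ) + (χ.1 : H → ℂ), h0⟩
  have hψ : ψ.toLinear = (rootSystem H).root α.1 + χ.1.toLinear := by
    ext h
    rfl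
  have hr : r + 1 ≤ (heightFunctional b ψ.toLinear).re := by
    rw [hψ, map_add, heightFunctional_root, Complex.add_re, Complex.intCast_re]
    have h1 : (1 : ℝ) ≤ b.height α.1 := by exact_mod_cast α.2
    linarith [χ.2]
  exact Submodule.mem_iSup_of_mem
    (p := fun χ : {χ : Weight ℂ H g // r + 1 ≤ (heightFunctional b χ.toLinear).re} ↦
      (rootSpace H (χ.1 : H → ℂ)).toSubmodule) ⟨ψ, hr⟩ hxy

/-- Each application of `ad x` raises the real part of the height by at least `1`. Only finitely
many weights occur, all with heights in `[-M, M]`, so more than `2 * M` applications give zero. -/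
lemma isNilpotent_ad_of_mem_sumRootSpaces {x : g}
    (hx : x ∈ sumRootSpaces (Set.univ : Set (PosRoot b))) : IsNilpotent (LieAlgebra.ad ℂ g x) := by
  obtain ⟨M, hM⟩ : ∃ M : ℝ, ∀ χ : Weight ℂ H g, |(heightFunctional b χ.toLinear).re| ≤ M := by
    obtain ⟨M, hM⟩ := (Set.finite_range
      fun χ : Weight ℂ H g ↦ |(heightFunctional b χ.toLinear).re|).bddAbove
    exact ⟨M, fun χ ↦ hM ⟨χ, rfl⟩⟩
  obtain ⟨N, hN⟩ := exists_nat_gt (2 * M)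
  refine ⟨N, ?_⟩
  ext y
  have hy : y ∈ heightFiltration b (-M) := by
    have htop : (⨆ χ : Weight ℂ H g, (rootSpace H (χ : H → ℂ)).toSubmodule) = ⊤ := by
      rw [← LieSubmodule.iSup_toSubmodule, iSup_genWeightSpace_eq_top' ℂ H g,
        LieSubmodule.top_toSubmodule]
    have : y ∈ (⨆ χ : Weight ℂ H g, (rootSpace H (χ : H → ℂ)).toSubmodule) := by
      rw [htop]; trivial
    refine (iSup_le fun χ ↦ ?_ : _ ≤ heightFiltration b (-M)) this
    exact le_iSup_of_le (f := fun χ : {χ : Weight ℂ H g // -M ≤ _} ↦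
      (rootSpace H (χ.1 : H → ℂ)).toSubmodule) ⟨χ, (abs_le.mp (hM χ)).1⟩ le_rfl
  have key : ∀ k : ℕ, ((LieAlgebra.ad ℂ g x) ^ k) y ∈ heightFiltration b (-M + k) := by
    intro k
    induction k with
    | zero => simpa using hy
    | succ k ih =>
      rw [pow_succ', Module.End.mul_apply, LieAlgebra.ad_apply, Nat.cast_succ, ← add_assoc]
      exact lie_mem_heightFiltration hx ih
  have hbot : heightFiltration b (-M + N) = ⊥ := by
    rw [eq_bot_iff]
    refine iSup_le fun χ ↦ ?_
    have h1 := χ.2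
    have h2 := (abs_le.mp (hM χ.1)).2
    linarith
  have := key N
  rw [hbot, Submodule.mem_bot] at this
  simpa using this

/-- An ideal of the Borel subalgebra as a subspace of the whole Lie algebra. -/
noncomputable def idealSubmodule (I : LieIdeal ℂ (borel b)) : Submodule ℂ g :=
  I.toSubmodule.map (borel b).toSubmodule.subtype

lemma mem_idealSubmodule {I : LieIdeal ℂ (borel b)} {x : g} :
    x ∈ idealSubmodule I ↔ ∃ h : x ∈ borel b, (⟨x, h⟩ : borel b) ∈ I := by
  constructor
  · rintro ⟨y, hy, rfl⟩
    exact ⟨y.2, hy⟩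
  · rintro ⟨h, hx⟩
    exact ⟨⟨x, h⟩, hx, rfl⟩

lemma idealSubmodule_injective : Function.Injective (idealSubmodule (b := b)) := by
  intro I J h
  ext x
  have := SetLike.ext_iff.mp h x.1
  simpa [mem_idealSubmodule] using this

lemma cartan_le_borel {x : g} (hx : x ∈ H) : x ∈ borel b :=
  Submodule.mem_sup_left (S := H.toSubmodule) (T := positivePart b) hx

lemma sumRootSpaces_le_borel {Φ : Set (PosRoot b)} {x : g} (hx : x ∈ sumRootSpaces Φ) :
    x ∈ borel b := by
  refine Submodule.mem_sup_right (S := H.toSubmodule) (T := positivePart b) ?_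
  rw [positivePart_eq]
  exact sumRootSpaces_mono (Set.subset_univ Φ) hx

/-- An ad-nilpotent ideal is a sum of root spaces for an upper set of positive roots. -/
lemma exists_eq_sumRootSpaces {I : LieIdeal ℂ (borel b)} (hI : I ∈ adNilpotentIdeals b) :
    ∃ Φ : Set (PosRoot b), IsUpper Φ ∧ idealSubmodule I = sumRootSpaces Φ := by
  let Φ : Set (PosRoot b) := {α | (rootSpace H (α.1.1 : H → ℂ)).toSubmodule ≤ idealSubmodule I}
  refine ⟨Φ, fun α β γ h hβ ↦ ?_, le_antisymm ?_ (iSup₂_le fun α hα ↦ hα)⟩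
  · refine rootSpace_le_of_isSum h fun x hx y hy ↦ ?_
    obtain ⟨hy1, hy2⟩ := mem_idealSubmodule.mp (hβ hy)
    have hx1 : x ∈ borel b := sumRootSpaces_le_borel
      (rootSpace_le_sumRootSpaces (Set.mem_univ α) hx)
    exact ⟨_, lie_mem_right ℂ (borel b) I ⟨x, hx1⟩ _ hy2, rfl⟩
  -- Stability under `H` makes the ideal the sum of its intersections with the weight spaces. Weight
  -- zero contributes nothing, since ad-nilpotent elements of a Cartan subalgebra vanish. Neither do
  -- negative roots, whose root spaces are independent of the Borel subalgebra.
  · let N : LieSubmodule ℂ H g :=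
      { idealSubmodule I with
        lie_mem := by
          intro h x hx
          obtain ⟨hx1, hx2⟩ := mem_idealSubmodule.mp hx
          exact ⟨_, lie_mem_right ℂ (borel b) I ⟨h.1, cartan_le_borel h.2⟩ _ hx2, rfl⟩ }
    have hN : N.toSubmodule = ⨆ χ : Weight ℂ H g, (N ⊓ rootSpace H (χ : H → ℂ)).toSubmodule := by
      rw [← LieSubmodule.iSup_toSubmodule, ← eq_iSup_inf_genWeightSpace ℂ H g N]
    change N.toSubmodule ≤ _
    rw [hN]
    refine iSup_le fun χ x hx ↦ ?_
    obtain ⟨hxN, hxχ⟩ : x ∈ idealSubmodule I ∧ x ∈ rootSpace H (χ : H → ℂ) := hx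
    by_cases hx0 : x = 0
    · rw [hx0]; exact zero_mem _
    by_cases hχ : χ.IsZero
    · rw [hχ.eq, rootSpace_zero_eq] at hxχ
      obtain ⟨hx1, hx2⟩ := mem_idealSubmodule.mp hxN
      exact absurd (eq_zero_of_isNilpotent_ad_of_mem_isCartanSubalgebra ℂ g H hxχ (hI _ hx2)) hx0
    let α : H.root := ⟨χ, by simpa using hχ⟩
    by_cases hα : b.IsPos α
    · refine rootSpace_le_sumRootSpaces (α := ⟨α, hα⟩) ?_ hxχ
      refine ((rootSpace_atom α).le_iff_eq ?_).mp inf_le_left |>.symm.trans_le inf_le_right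
      intro h
      have : x ∈ (rootSpace H (α.1 : H → ℂ)).toSubmodule ⊓ idealSubmodule I := ⟨hxχ, hxN⟩
      rw [h] at this
      exact hx0 this
    · exfalso
      have hdis : Disjoint (rootSpace H (χ : H → ℂ)).toSubmodule (borel b).toSubmodule := by
        refine (iSupIndep_rootSpaces (H := H) χ).mono_right (sup_le ?_ ?_)
        · refine le_iSup₂_of_le (0 : H → ℂ) (fun h ↦ hχ h.symm) ?_
          change H.toSubmodule ≤ (rootSpace H (0 : H → ℂ)).toSubmodule
          rw [rootSpace_zero_eq]
          exact le_rfl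
        · refine iSup_le fun β ↦ le_iSup₂_of_le (β.1.1 : H → ℂ) (fun h ↦ hα ?_) le_rfl
          have : α = β.1 := Subtype.ext (DFunLike.coe_injective h.symm)
          exact this ▸ β.2
      exact hx0 (Submodule.disjoint_def.mp hdis x hxχ (mem_idealSubmodule.mp hxN).1)

/-- Every upper set of positive roots gives an ad-nilpotent ideal. -/
lemma exists_ideal_of_isUpper {Φ : Set (PosRoot b)} (hΦ : IsUpper Φ) :
    ∃ I ∈ adNilpotentIdeals b, idealSubmodule I = sumRootSpaces Φ := by
  let I : LieIdeal ℂ (borel b) :=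
    { (sumRootSpaces Φ).comap (borel b).toSubmodule.subtype with
      lie_mem := by
        rintro ⟨x, hx⟩ ⟨y, hy'⟩ hy
        obtain ⟨h, hh, u, hu, rfl⟩ := Submodule.mem_sup.mp hx
        change ⁅h + u, y⁆ ∈ sumRootSpaces Φ
        rw [add_lie]
        rw [positivePart_eq] at hu
        exact add_mem (lie_cartan_mem_sumRootSpaces hh hy)
          (lie_mem_sumRootSpaces (fun α _ β hβ γ h ↦ hΦ α β γ h hβ) hu hy) }
  refine ⟨I, fun x hx ↦ ?_, ?_⟩
  · exact isNilpotent_ad_of_mem_sumRootSpaces (sumRootSpaces_mono (Set.subset_univ Φ) hx)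
  · ext x
    rw [mem_idealSubmodule]
    exact ⟨fun ⟨_, h⟩ ↦ h, fun h ↦ ⟨sumRootSpaces_le_borel h, h⟩⟩

/-- Brackets of root vectors span each term, and none vanishes when the sum of the two roots is a
root. On both sides the index `k` stands for `k + 1` factors. -/
lemma mem_lowerCentralSeries_iff {I : LieIdeal ℂ (borel b)} {Φ : Set (PosRoot b)}
    (hI : idealSubmodule I = sumRootSpaces Φ) (k : ℕ) :
    (lowerCentralSeries ℂ I I k).toSubmodule.map
      ((borel b).toSubmodule.subtype ∘ₗ I.toSubmodule.subtype) = sumRootSpaces (sumPow Φ k) := by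
  induction k with
  | zero =>
    rw [lowerCentralSeries_zero, LieSubmodule.top_toSubmodule, Submodule.map_comp,
      Submodule.map_top, Submodule.range_subtype]
    exact hI
  | succ k ih =>
    rw [lowerCentralSeries_succ, LieSubmodule.lieIdeal_oper_eq_linear_span',
      Submodule.map_span]
    apply le_antisymm
    · rw [Submodule.span_le]
      rintro _ ⟨_, ⟨x, -, m, hm, rfl⟩, rfl⟩
      change ⁅x.1.1, m.1.1⁆ ∈ sumRootSpaces (sumPow Φ (k + 1))
      have hx : x.1.1 ∈ sumRootSpaces Φ := by
        rw [← hI]; exact ⟨x.1, x.2, rfl⟩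
      have hm' : m.1.1 ∈ sumRootSpaces (sumPow Φ k) := by
        rw [← ih]; exact ⟨m, hm, rfl⟩
      exact lie_mem_sumRootSpaces (Ξ := sumPow Φ (k + 1))
        (fun α hα β hβ γ h ↦ (⟨α, hα, β, hβ, h⟩ : γ ∈ sumSet Φ (sumPow Φ k))) hx hm'
    · refine iSup₂_le fun γ hγ ↦ ?_
      obtain ⟨α, hα, β, hβ, h⟩ := hγ
      refine rootSpace_le_of_isSum h fun x hx y hy ↦ Submodule.subset_span ?_
      have hx' := rootSpace_le_sumRootSpaces hα hx
      have hy' := rootSpace_le_sumRootSpaces hβ hy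
      rw [← hI] at hx'
      rw [← ih] at hy'
      obtain ⟨hx1, hx2⟩ := mem_idealSubmodule.mp hx'
      obtain ⟨m, hm, rfl⟩ := hy'
      refine ⟨⁅(⟨⟨x, hx1⟩, hx2⟩ : I), m⁆, ?_, rfl⟩
      exact ⟨⟨⟨x, hx1⟩, hx2⟩, trivial, m, hm, rfl⟩

lemma height_of_mem_sumPow {Φ : Set (PosRoot b)} (k : ℕ) {α : PosRoot b} (h : α ∈ sumPow Φ k) :
    (k : ℤ) < b.height α.1 := by
  induction k generalizing α with
  | zero => exact α.2
  | succ k ih =>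
    obtain ⟨β, -, γ, hγ, h⟩ := h
    have h1 := ih hγ
    have h2 : 0 < b.height β.1 := β.2
    rw [b.height_add h]
    push_cast
    omega

/-- A sum of `k + 1` positive roots has height greater than `k`, and heights are bounded. This makes
the set whose infimum is the nilpotency length nonempty, so that the default value of the infimum is
not met. -/
lemma exists_sumPow_eq_empty (Φ : Set (PosRoot b)) : ∃ k, sumPow Φ k = ∅ := by
  obtain ⟨M, hM⟩ := (Set.finite_range fun α : PosRoot b ↦ b.height α.1).bddAbove
  refine ⟨M.toNat, Set.eq_empty_of_forall_notMem fun α hα ↦ ?_⟩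
  have h1 := height_of_mem_sumPow _ hα
  have h2 : b.height α.1 ≤ M := hM ⟨α, rfl⟩
  omega

lemma nilpotenceClass_le_iff {I : LieIdeal ℂ (borel b)} {Φ : Set (PosRoot b)}
    (hI : idealSubmodule I = sumRootSpaces Φ) (h : ℕ) :
    nilpotenceClass b I ≤ h ↔ sumPow Φ h = ∅ := by
  -- The nilpotency length refers to the lower central series over `ℤ`, which has the same
  -- underlying sets as the one over `ℂ`.
  have key (k : ℕ) : lowerCentralSeries ℤ I I k = ⊥ ↔ sumPow Φ k = ∅ := by
    have hinj : Function.Injective ((borel b).toSubmodule.subtype ∘ₗ I.toSubmodule.subtype) :=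
      Subtype.val_injective.comp Subtype.val_injective
    rw [← sumRootSpaces_eq_bot_iff, ← mem_lowerCentralSeries_iff hI,
      ← Submodule.map_bot ((borel b).toSubmodule.subtype ∘ₗ I.toSubmodule.subtype),
      (Submodule.map_injective_of_injective hinj).eq_iff, LieSubmodule.toSubmodule_eq_bot]
    simp [SetLike.ext'_iff, coe_lowerCentralSeries_eq_int ℂ I I]
  have hne : {k | lowerCentralSeries ℤ I I k = ⊥}.Nonempty := by
    obtain ⟨k, hk⟩ := exists_sumPow_eq_empty Φ
    exact ⟨k, (key k).mpr hk⟩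
  rw [← key]
  constructor
  · intro hle
    have := Nat.sInf_mem hne
    exact eq_bot_iff.mpr ((antitone_lowerCentralSeries ℤ I I hle).trans_eq this)
  · exact fun hk ↦ Nat.sInf_le hk

/-- The number of ad-nilpotent ideals in terms of upper sets of positive roots. -/
theorem numIdeals_eq_ncard_isUpper (h : ℕ) :
    numIdeals b h = {Φ : Set (PosRoot b) | IsUpper Φ ∧ sumPow Φ h = ∅}.ncard := by
  rw [numIdeals, ← Set.ncard_image_of_injective _ idealSubmodule_injective,
    ← Set.ncard_image_of_injective {Φ : Set (PosRoot b) | _} sumRootSpaces_injective]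
  congr 1
  ext N
  constructor
  · rintro ⟨I, ⟨hI, hIh⟩, rfl⟩
    obtain ⟨Φ, hΦ, h'⟩ := exists_eq_sumRootSpaces hI
    exact ⟨Φ, ⟨hΦ, (nilpotenceClass_le_iff h' h).mp hIh⟩, h'.symm⟩
  · rintro ⟨Φ, ⟨hΦ, hΦh⟩, rfl⟩
    obtain ⟨I, hI, h'⟩ := exists_ideal_of_isUpper hΦ
    exact ⟨I, ⟨hI, (nilpotenceClass_le_iff h' h).mpr hΦh⟩, h'⟩

end LieTheory

/-! ### Labels determined by signed coordinates -/

section Labels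

/-- The conditional expression is the `l`-th coordinate of the weight `ω j`, where `ω (-k) = ε_k`
and `ω k = -ε_k`. -/
lemma eq_of_signs {j j' : ℤ} (h : ∀ l : ℤ, 1 ≤ l →
    (if j = -l then 1 else if j = l then -1 else 0 : ℤ) =
      if j' = -l then 1 else if j' = l then -1 else 0) : j = j' := by
  rcases lt_trichotomy j 0 with hj | hj | hj
  · have := h (-j) (by omega)
    rw [if_pos (by omega)] at this
    split_ifs at this
    all_goals omega
  · rcases lt_trichotomy j' 0 with hj' | hj' | hj'
    · have := h (-j') (by omega)
      rw [if_neg (by omega), if_neg (by omega), if_pos (by omega)] at this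
      omega
    · omega
    · have := h j' (by omega)
      rw [if_neg (by omega), if_neg (by omega), if_neg (by omega), if_pos rfl] at this
      omega
  · have := h j (by omega)
    rw [if_neg (by omega), if_pos rfl] at this
    split_ifs at this
    omega

/-- In coordinates the hypothesis is `ε_k - ω j = (ε_k₁ - ω j₁) + (ε_k₂ - ω j₂)`. The largest index
gives `k = k₁`, leaving `ω j = ω j₁ + ω j₂ - ε_k₂`. The left side has at most one nonzero
coordinate, so either `ω j₁` cancels `ε_k₂`, or `ω j₁` and `ω j₂` cancel each other. -/
lemma sum_labels_aux {k j k₁ j₁ k₂ j₂ : ℤ} (h : -k < j ∧ j < k) (h₁ : -k₁ < j₁ ∧ j₁ < k₁)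
    (h₂ : -k₂ < j₂ ∧ j₂ < k₂) (hlt : k₂ < k₁)
    (key : ∀ l : ℤ, 1 ≤ l →
      ((if k = l then 1 else 0) - (if j = -l then 1 else if j = l then -1 else 0) : ℤ) =
        (if k₁ = l then 1 else 0) - (if j₁ = -l then 1 else if j₁ = l then -1 else 0) +
        ((if k₂ = l then 1 else 0) - (if j₂ = -l then 1 else if j₂ = l then -1 else 0))) :
    k = k₁ ∧ (j₁ = -k₂ ∧ j = j₂ ∨ j₂ = -j₁ ∧ j = k₂) := by
  have hk : k = k₁ := by
    have z (l j : ℤ) (h : -l < j ∧ j < l) :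
        (if j = -l then 1 else if j = l then -1 else 0 : ℤ) = 0 := by
      rw [if_neg (by omega), if_neg (by omega)]
    rcases lt_trichotomy k k₁ with hk | hk | hk
    · have a := key k₁ (by omega)
      rw [z k₁ j ⟨by omega, by omega⟩, z k₁ j₁ h₁, z k₁ j₂ ⟨by omega, by omega⟩,
        if_neg (by omega), if_pos rfl, if_neg (by omega)] at a
      omega
    · exact hk
    · have a := key k (by omega)
      rw [z k j h, z k j₁ ⟨by omega, by omega⟩, z k j₂ ⟨by omega, by omega⟩, if_pos rfl,
        if_neg (by omega), if_neg (by omega)] at a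
      omega
  subst hk
  refine ⟨rfl, ?_⟩
  have key' (l : ℤ) (hl : 1 ≤ l) : (if j = -l then 1 else if j = l then -1 else 0 : ℤ) =
        (if j₁ = -l then 1 else if j₁ = l then -1 else 0)
        - ((if k₂ = l then 1 else 0) - (if j₂ = -l then 1 else if j₂ = l then -1 else 0)) := by
    linarith [key l hl]
  clear key
  have c := key' k₂ (by omega)
  rw [if_pos rfl] at c
  by_cases e1 : j₁ = -k₂
  · refine Or.inl ⟨e1, eq_of_signs fun l hl ↦ ?_⟩
    rw [key' l hl, e1]
    split_ifs <;> omega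
  · have e2 : j = k₂ := by
      rw [if_neg e1] at c
      split_ifs at c <;> omega
    refine Or.inr ⟨?_, e2⟩
    rw [← neg_eq_iff_eq_neg]
    refine eq_of_signs fun l hl ↦ ?_
    have := key' l hl
    rw [e2, if_neg (show ¬ k₂ = -l by omega)] at this
    have e3 : (if -j₂ = -l then 1 else if -j₂ = l then -1 else 0 : ℤ) =
        -(if j₂ = -l then 1 else if j₂ = l then -1 else 0) := by
      split_ifs <;> omega
    rw [e3]
    by_cases hkl : k₂ = l
    · rw [if_pos hkl, if_pos hkl] at this; linarith
    · rw [if_neg hkl, if_neg hkl] at this; linarith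

end Labels

set_option linter.unusedSectionVars false

/-! ### Roots of type B as differences of weights -/

section RootsOfTypeB

open RootPairing

variable {ι R M N : Type*} [Field R] [CharZero R] [AddCommGroup M] [Module R M]
  [AddCommGroup N] [Module R N] [Finite ι] {P : RootPairing ι R M N} [P.IsRootSystem]
  [P.IsCrystallographic] [P.IsReduced] {b : P.Base} {n : ℕ}

/-- The `l`-th simple root, counted from the short one, with `1 ≤ l ≤ n`. -/
def simpleRoot (e : Fin n ≃ b.support) (l : ℤ) : M :=
  if h : 1 ≤ l ∧ l ≤ n then P.root (e ⟨(n - l).toNat, by omega⟩) else 0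

/-- The vectors `ε_k`, as partial sums of the simple roots. -/
def epsVec (e : Fin n ≃ b.support) (k : ℕ) : M :=
  ∑ l ∈ Finset.range k, simpleRoot e (l + 1)

/-- The weights `ω p` of the natural representation: `ω (-k) = ε_k`, `ω 0 = 0`, `ω k = -ε_k`. -/
def natWeight (e : Fin n ≃ b.support) (p : ℤ) : M :=
  (-p.sign) • epsVec e p.natAbs

lemma simpleRoot_eq (e : Fin n ≃ b.support) {l : ℤ} (h : 1 ≤ l ∧ l ≤ n) :
    simpleRoot e l = P.root (e ⟨(n - l).toNat, by omega⟩) := by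
  rw [simpleRoot, dif_pos h]

lemma natWeight_neg (e : Fin n ≃ b.support) (p : ℤ) : natWeight e (-p) = -natWeight e p := by
  simp [natWeight]

lemma natWeight_zero (e : Fin n ≃ b.support) : natWeight e 0 = 0 := by
  simp [natWeight]

lemma natWeight_neg_natCast (e : Fin n ≃ b.support) (k : ℕ) :
    natWeight e (-(k : ℤ)) = epsVec e k := by
  rcases Nat.eq_zero_or_pos k with rfl | hk
  · simp [natWeight, epsVec]
  · simp [natWeight, Int.sign_eq_one_of_pos (show (0 : ℤ) < k by exact_mod_cast hk)]

lemma simpleRoot_eq_sub (e : Fin n ≃ b.support) {l : ℤ} (h : 1 ≤ l) :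
    simpleRoot e l = natWeight e (-l) - natWeight e (-(l - 1)) := by
  obtain ⟨k, rfl⟩ : ∃ k : ℕ, l = k + 1 := ⟨(l - 1).toNat, by omega⟩
  have h1 := natWeight_neg_natCast e (k + 1)
  push_cast at h1
  rw [h1, add_sub_cancel_right, natWeight_neg_natCast, epsVec, epsVec, Finset.sum_range_succ]
  abel

/-- The weights `ω p` are partial sums of simple roots up to sign, so a linear form is known on them
once it is known on simple roots. This serves for coordinates, coroots and heights. -/
lemma map_natWeight (e : Fin n ≃ b.support) (f : M →ₗ[R] R) (G : ℤ → R)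
    (hneg : ∀ p, G (-p) = -G p)
    (hs : ∀ k : ℤ, 0 ≤ k → k < n → f (simpleRoot e (k + 1)) = G (-(k + 1)) - G (-k))
    (h0 : G 0 = 0) {p : ℤ} (hp : |p| ≤ n) : f (natWeight e p) = G p := by
  have key (k : ℕ) (hk : k ≤ n) : f (epsVec e k) = G (-(k : ℤ)) := by
    induction k with
    | zero => simp [epsVec, h0]
    | succ k ih =>
      rw [epsVec, Finset.sum_range_succ, map_add, ← epsVec, ih (by omega),
        hs k (by omega) (by omega)]
      push_cast
      ring
  rw [abs_le] at hp
  obtain ⟨k, rfl | rfl⟩ := p.eq_nat_or_neg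
  · rw [← neg_neg (k : ℤ), natWeight_neg, natWeight_neg_natCast, map_neg, key k (by omega), hneg (-(k : ℤ))]
  · rw [natWeight_neg_natCast, key k (by omega)]

lemma exists_functional (e : Fin n ≃ b.support) (φ : ℤ → R) :
    ∃ f : M →ₗ[R] R, ∀ l : ℤ, 1 ≤ l → l ≤ n → f (simpleRoot e l) = φ l := by
  refine ⟨b.toWeightBasis.constr R fun i ↦ φ (n - (e.symm i : ℕ)), fun l h1 h2 ↦ ?_⟩
  rw [simpleRoot_eq e ⟨h1, h2⟩, ← b.toWeightBasis_apply, Module.Basis.constr_basis,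
    Equiv.symm_apply_apply]
  congr 1
  simp only
  omega

/-- The coordinate functionals with respect to the vectors `ε_l`. -/
lemma exists_coordinate (e : Fin n ≃ b.support) (l : ℤ) (hl : 1 ≤ l) :
    ∃ f : M →ₗ[R] R, ∀ p : ℤ, |p| ≤ n →
      f (natWeight e p) = ((if p = -l then 1 else if p = l then -1 else 0 : ℤ) : R) := by
  obtain ⟨f, hf⟩ := exists_functional (P := P) e
    fun k ↦ ((if k = l then 1 else if k = l + 1 then -1 else 0 : ℤ) : R)
  refine ⟨f, fun p hp ↦ map_natWeight e f
    (fun p ↦ ((if p = -l then 1 else if p = l then -1 else 0 : ℤ) : R))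
    (fun p ↦ ?_) (fun k hk hk' ↦ ?_) ?_ hp⟩
  · rw [← Int.cast_neg]
    congr 1
    split_ifs <;> omega
  · rw [hf _ (by omega) (by omega), ← Int.cast_sub]
    congr 1
    split_ifs <;> omega
  · rw [if_neg (by omega), if_neg (by omega), Int.cast_zero]

/-- The reflection in the `l`-th simple root, acting on the labels of the weights. -/
def labelSwap (l p : ℤ) : ℤ :=
  if l = 1 then (if p = 1 then -1 else if p = -1 then 1 else p)
  else if p = l then l - 1 else if p = l - 1 then l
  else if p = -l then -(l - 1) else if p = -(l - 1) then -l else p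

/-- The pairing of `ω p` with the `l`-th simple coroot. -/
def corootCoeff (l p : ℤ) : ℤ :=
  if l = 1 then (if p = -1 then 2 else if p = 1 then -2 else 0)
  else if p = l then -1 else if p = l - 1 then 1
  else if p = -l then 1 else if p = -(l - 1) then -1 else 0

lemma corootCoeff_neg {l : ℤ} (hl : 1 ≤ l) (p : ℤ) : corootCoeff l (-p) = -corootCoeff l p := by
  unfold corootCoeff
  split_ifs <;> omega

lemma cartanMatrix_B_apply {k l : ℤ} (hk : 1 ≤ k ∧ k ≤ n) (hl : 1 ≤ l ∧ l ≤ n) :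
    CartanMatrix.B n ⟨(n - k).toNat, by omega⟩ ⟨(n - l).toNat, by omega⟩ =
      if k = l then 2 else if k = l + 1 then (if l = 1 then -2 else -1)
      else if k + 1 = l then -1 else 0 := by
  simp only [CartanMatrix.B, Matrix.of_apply, Fin.mk.injEq]
  split_ifs <;> omega

lemma corootCoeff_sub {k l : ℤ} (hk : 1 ≤ k) (hl : 1 ≤ l) :
    corootCoeff l (-k) - corootCoeff l (-(k - 1)) =
      if k = l then 2 else if k = l + 1 then (if l = 1 then -2 else -1)
      else if k + 1 = l then -1 else 0 := by
  unfold corootCoeff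
  split_ifs <;> omega

lemma coroot_natWeight {e : Fin n ≃ b.support}
    (he : ∀ i j, b.cartanMatrix (e i) (e j) = CartanMatrix.B n i j) {l : ℤ}
    (hl : 1 ≤ l ∧ l ≤ n) {p : ℤ} (hp : |p| ≤ n) :
    P.coroot' (e ⟨(n - l).toNat, by omega⟩) (natWeight e p) = (corootCoeff l p : R) := by
  refine map_natWeight e (P.coroot' (e ⟨(n - l).toNat, by omega⟩))
    (fun p ↦ (corootCoeff l p : R)) (fun p ↦ ?_) (fun k hk hk' ↦ ?_) ?_ hp
  · rw [← Int.cast_neg, corootCoeff_neg hl.1]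
  · have h1 := he ⟨(n - (k + 1)).toNat, by omega⟩ ⟨(n - l).toNat, by omega⟩
    rw [cartanMatrix_B_apply ⟨by omega, by omega⟩ hl,
      ← corootCoeff_sub (by omega) hl.1, add_sub_cancel_right] at h1
    rw [simpleRoot_eq e ⟨by omega, by omega⟩, root_coroot'_eq_pairing,
      ← P.algebraMap_pairingIn ℤ, ← Int.cast_sub]
    change P.pairingIn ℤ _ _ = _ at h1
    rw [h1]
    rfl
  · have := corootCoeff_neg hl.1 0
    rw [neg_zero] at this
    rw [show corootCoeff l 0 = 0 by omega, Int.cast_zero]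

/-- The simple reflections act as signed permutations: the first one negates `ε_1`, the `l`-th one
exchanges `ε_l` and `ε_(l-1)`. -/
lemma reflection_natWeight {e : Fin n ≃ b.support}
    (he : ∀ i j, b.cartanMatrix (e i) (e j) = CartanMatrix.B n i j) {l : ℤ}
    (hl : 1 ≤ l ∧ l ≤ n) {p : ℤ} (hp : |p| ≤ n) :
    P.reflection (e ⟨(n - l).toNat, by omega⟩) (natWeight e p) = natWeight e (labelSwap l p) := by
  rw [P.reflection_apply, coroot_natWeight he hl hp, ← simpleRoot_eq e hl,
    simpleRoot_eq_sub e hl.1, Int.cast_smul_eq_zsmul, natWeight_neg, natWeight_neg]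
  unfold corootCoeff labelSwap
  rcases eq_or_ne l 1 with rfl | h1
  · have h0 := natWeight_zero e
    rw [if_pos rfl, if_pos rfl, sub_self, h0]
    by_cases h2 : p = 1
    · rw [if_neg (by omega), if_pos h2, if_pos h2, natWeight_neg, h2]; module
    by_cases h3 : p = -1
    · rw [if_pos h3, if_neg h2, if_pos h3, h3, natWeight_neg]; module
    rw [if_neg h3, if_neg h2, if_neg h2, if_neg h3]; module
  · rw [if_neg h1, if_neg h1]
    by_cases h2 : p = l
    · rw [if_pos h2, if_pos h2, h2]; module
    by_cases h3 : p = l - 1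
    · rw [if_neg h2, if_neg h2, if_pos h3, if_pos h3, h3]; module
    by_cases h4 : p = -l
    · rw [if_neg h2, if_neg h2, if_neg h3, if_neg h3, if_pos h4, if_pos h4, h4, natWeight_neg,
        natWeight_neg]; module
    by_cases h5 : p = -(l - 1)
    · rw [if_neg h2, if_neg h2, if_neg h3, if_neg h3, if_neg h4, if_neg h4, if_pos h5, if_pos h5,
        h5, natWeight_neg, natWeight_neg]; module
    rw [if_neg h2, if_neg h2, if_neg h3, if_neg h3, if_neg h4, if_neg h4, if_neg h5, if_neg h5]
    module

lemma abs_labelSwap_le {l p : ℤ} (hl : 1 ≤ l ∧ l ≤ n) (hp : |p| ≤ n) : |labelSwap l p| ≤ n := by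
  rw [abs_le] at *
  unfold labelSwap
  split_ifs <;> omega

lemma labelSwap_neg {l : ℤ} (hl : 1 ≤ l) (p : ℤ) : labelSwap l (-p) = -labelSwap l p := by
  grind [labelSwap]

lemma labelSwap_labelSwap {l : ℤ} (hl : 1 ≤ l) (p : ℤ) : labelSwap l (labelSwap l p) = p := by
  grind [labelSwap]

lemma labelSwap_injective {l : ℤ} (hl : 1 ≤ l) : Function.Injective (labelSwap l) :=
  Function.LeftInverse.injective (labelSwap_labelSwap hl)

/-- The ordered pairs of labels whose difference of weights is a root. -/
def IsRootPair (n : ℕ) (p q : ℤ) : Prop :=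
  |p| ≤ n ∧ |q| ≤ n ∧ p ≠ q ∧ p ≠ -q

lemma exists_simple_index (e : Fin n ≃ b.support) {i : ι} (hi : i ∈ b.support) :
    ∃ l : ℤ, ∃ h : 1 ≤ l ∧ l ≤ n, (e ⟨(n - l).toNat, by omega⟩ : ι) = i := by
  have h1 := (e.symm ⟨i, hi⟩).2
  refine ⟨n - (e.symm ⟨i, hi⟩ : ℕ), by omega, ?_⟩
  have : (⟨((n : ℤ) - (n - (e.symm ⟨i, hi⟩ : ℕ))).toNat, by omega⟩ : Fin n) = e.symm ⟨i, hi⟩ := by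
    ext
    simp
  rw [this, Equiv.apply_symm_apply]

/-- Positive roots arise from simple roots by simple reflections, and these permute the weights `ω
p` compatibly with `p ↦ -p`. -/
lemma exists_root_eq {e : Fin n ≃ b.support}
    (he : ∀ i j, b.cartanMatrix (e i) (e j) = CartanMatrix.B n i j) {i : ι} (hi : b.IsPos i) :
    ∃ p q, IsRootPair n p q ∧ P.root i = natWeight e p - natWeight e q := by
  refine hi.induction_on_reflect
    (p := fun i ↦ ∃ p q, IsRootPair n p q ∧ P.root i = natWeight e p - natWeight e q)
    (fun i hi ↦ ?_) (fun i j ⟨p, q, ⟨hp, hq, h1, h2⟩, hr⟩ hj ↦ ?_)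
  · obtain ⟨l, hl, rfl⟩ := exists_simple_index e hi
    refine ⟨-l, -(l - 1), ⟨?_, ?_, by omega, by omega⟩, ?_⟩
    · rw [abs_le]; omega
    · rw [abs_le]; omega
    · rw [← simpleRoot_eq_sub e hl.1, simpleRoot_eq e hl]
  · obtain ⟨l, hl, rfl⟩ := exists_simple_index e hj
    refine ⟨labelSwap l p, labelSwap l q, ⟨abs_labelSwap_le hl hp, abs_labelSwap_le hl hq,
      (labelSwap_injective hl.1).ne h1, ?_⟩, ?_⟩
    · rw [← labelSwap_neg hl.1]
      exact (labelSwap_injective hl.1).ne h2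
    · rw [P.root_reflectionPerm, hr, map_sub, reflection_natWeight he hl hp,
        reflection_natWeight he hl hq]

/-- `ω p - ω q` being a root is invariant under the simple reflections. -/
lemma sub_labelSwap_mem_range {e : Fin n ≃ b.support}
    (he : ∀ i j, b.cartanMatrix (e i) (e j) = CartanMatrix.B n i j) {l : ℤ}
    (hl : 1 ≤ l ∧ l ≤ n) {p q : ℤ} (hp : |p| ≤ n) (hq : |q| ≤ n)
    (h : natWeight e p - natWeight e q ∈ Set.range P.root) :
    natWeight e (labelSwap l p) - natWeight e (labelSwap l q) ∈ Set.range P.root := by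
  obtain ⟨i, hi⟩ := h
  rw [← reflection_natWeight he hl hp, ← reflection_natWeight he hl hq, ← map_sub, ← hi]
  exact ⟨_, P.root_reflectionPerm _ _⟩

/-- Starting from a simple root, simple reflections move one end of the difference by one place at a
time: `short` moves the first end, `low` moves `j` up to `-1`, and `high` crosses zero by the
reflection in the short simple root and continues. -/
lemma sub_mem_range_root {e : Fin n ≃ b.support}
    (he : ∀ i j, b.cartanMatrix (e i) (e j) = CartanMatrix.B n i j) {k j : ℤ}
    (hk : k ≤ n) (hj : -k < j) (hjk : j < k) :
    natWeight e (-k) - natWeight e j ∈ Set.range P.root := by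
  have simple {k : ℤ} (h1 : 1 ≤ k) (hk : k ≤ n) :
      natWeight e (-k) - natWeight e (-k + 1) ∈ Set.range P.root := by
    have := simpleRoot_eq_sub e h1
    rw [show -(k - 1) = -k + 1 by ring] at this
    rw [← this, simpleRoot_eq e ⟨h1, hk⟩]
    exact ⟨_, rfl⟩
  have short {k : ℤ} (h1 : 1 ≤ k) : k ≤ n → natWeight e (-k) - natWeight e 0 ∈ Set.range P.root := by
    induction k, h1 using Int.leInduction with
    | base => exact fun h ↦ by simpa using simple le_rfl h
    | succ k h1 ih =>
      intro hk
      have := sub_labelSwap_mem_range he (l := k + 1) ⟨by omega, hk⟩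
        (by rw [abs_le]; omega) (by rw [abs_le]; omega) (ih (by omega))
      convert this using 3
      · unfold labelSwap; split_ifs <;> omega
      · unfold labelSwap; split_ifs <;> omega
  have low {j : ℤ} (hj : -k + 1 ≤ j) :
      j < 0 → natWeight e (-k) - natWeight e j ∈ Set.range P.root := by
    induction j, hj using Int.leInduction with
    | base => exact fun _ ↦ simple (by omega) hk
    | succ j hj ih =>
      intro hj0
      have := sub_labelSwap_mem_range he (l := -j) ⟨by omega, by omega⟩
        (by rw [abs_le]; omega) (by rw [abs_le]; omega) (ih (by omega))
      convert this using 3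
      · unfold labelSwap; split_ifs <;> omega
      · unfold labelSwap; split_ifs <;> omega
  have high {j : ℤ} (hj : 1 ≤ j) :
      j < k → natWeight e (-k) - natWeight e j ∈ Set.range P.root := by
    induction j, hj using Int.leInduction with
    | base =>
      intro h1
      have := sub_labelSwap_mem_range he (l := 1) ⟨le_rfl, by omega⟩
        (by rw [abs_le]; omega) (by rw [abs_le]; omega) (low (j := -1) (by omega) (by omega))
      convert this using 3
      · unfold labelSwap; split_ifs <;> omega
      · simp [labelSwap]
    | succ j hj ih =>
      intro h1
      have := sub_labelSwap_mem_range he (l := j + 1) ⟨by omega, by omega⟩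
        (by rw [abs_le]; omega) (by rw [abs_le]; omega) (ih (by omega))
      convert this using 3
      · unfold labelSwap; split_ifs <;> omega
      · unfold labelSwap; split_ifs <;> omega
  rcases lt_trichotomy j 0 with h | rfl | h
  · exact low (by omega) h
  · exact short (by omega) hk
  · exact high (by omega) hjk

/-- The height functional on the weights. -/
lemma height_eq_of_root_eq {e : Fin n ≃ b.support} {i : ι} {p q : ℤ} (hp : |p| ≤ n) (hq : |q| ≤ n)
    (h : P.root i = natWeight e p - natWeight e q) : b.height i = q - p := by
  obtain ⟨f, hf⟩ := exists_functional (P := P) e fun _ ↦ (1 : R)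
  have hval {p : ℤ} (hp : |p| ≤ n) : f (natWeight e p) = ((-p : ℤ) : R) :=
    map_natWeight e f (fun p ↦ ((-p : ℤ) : R)) (fun p ↦ by push_cast; ring)
      (fun k _ _ ↦ by rw [hf _ (by omega) (by omega)]; push_cast; ring) (by simp) hp
  have hheight : f (P.root i) = (b.height i : R) := by
    obtain ⟨c, -, -, hc⟩ := b.exists_root_eq_sum_int i
    rw [RootPairing.Base.height_eq_sum hc, hc, map_sum, Int.cast_sum]
    refine Finset.sum_congr rfl fun j hj ↦ ?_
    obtain ⟨l, hl, rfl⟩ := exists_simple_index e hj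
    rw [map_zsmul, ← simpleRoot_eq e hl, hf l hl.1 hl.2, zsmul_eq_mul, mul_one]
  rw [h, map_sub, hval hp, hval hq, ← Int.cast_sub] at hheight
  have := Int.cast_injective hheight
  omega

/-- The labels `(k, j)` of the positive roots `ω (-k) - ω j`. -/
abbrev RootLabel (n : ℕ) : Type :=
  {r : ℤ × ℤ // r.1 ≤ n ∧ -r.1 < r.2 ∧ r.2 < r.1}

/-- The root labelled `r` is the sum of those labelled by `p` and `q`, the first entry of `p` being
larger than that of `q`. -/
def LabelSumAux {n : ℕ} (p q r : RootLabel n) : Prop :=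
  q.1.1 < p.1.1 ∧ r.1.1 = p.1.1 ∧
    (p.1.2 = -q.1.1 ∧ r.1.2 = q.1.2 ∨ q.1.2 = -p.1.2 ∧ r.1.2 = q.1.1)

/-- The root labelled `r` is the sum of those labelled by `p` and `q`. -/
def LabelSum {n : ℕ} (p q r : RootLabel n) : Prop :=
  LabelSumAux p q r ∨ LabelSumAux q p r

/-- The vector belonging to a label. -/
def labelVec (e : Fin n ≃ b.support) (r : RootLabel n) : M :=
  natWeight e (-r.1.1) - natWeight e r.1.2

lemma labelVec_eq_add_iff (e : Fin n ≃ b.support) (p q r : RootLabel n) :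
    labelVec e r = labelVec e p + labelVec e q ↔ LabelSum p q r := by
  obtain ⟨⟨k₁, j₁⟩, h₁⟩ := p
  obtain ⟨⟨k₂, j₂⟩, h₂⟩ := q
  obtain ⟨⟨k, j⟩, h⟩ := r
  simp only [labelVec, LabelSum, LabelSumAux] at *
  constructor
  · intro heq
    have key (l : ℤ) (hl : 1 ≤ l) :
        ((if k = l then 1 else 0) - (if j = -l then 1 else if j = l then -1 else 0) : ℤ) =
        (if k₁ = l then 1 else 0) - (if j₁ = -l then 1 else if j₁ = l then -1 else 0) +
        ((if k₂ = l then 1 else 0) - (if j₂ = -l then 1 else if j₂ = l then -1 else 0)) := by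
      obtain ⟨f, hf⟩ := exists_coordinate (P := P) e l hl
      have := congrArg f heq
      rw [map_add, map_sub, map_sub, map_sub, hf (-k) (by rw [abs_le]; omega),
        hf j (by rw [abs_le]; omega), hf (-k₁) (by rw [abs_le]; omega),
        hf j₁ (by rw [abs_le]; omega), hf (-k₂) (by rw [abs_le]; omega),
        hf j₂ (by rw [abs_le]; omega)] at this
      simp only [← Int.cast_sub, ← Int.cast_add] at this
      have := Int.cast_injective this
      have e1 (k : ℤ) (hk : 0 < k) :
          (if -k = -l then 1 else if -k = l then -1 else 0 : ℤ) = if k = l then 1 else 0 := by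
        split_ifs <;> omega
      rwa [e1 k (by omega), e1 k₁ (by omega), e1 k₂ (by omega)] at this
    rcases lt_trichotomy k₁ k₂ with hlt | rfl | hlt
    · refine Or.inr ⟨hlt, sum_labels_aux h.2 h₂.2 h₁.2 hlt fun l hl ↦ ?_⟩
      rw [key l hl, add_comm]
    -- With equal first entries the sum has coordinate `2` at `k₁`, while all coordinates of a
    -- `labelVec` are `0` or `±1`.
    · exfalso
      have a := key k₁ (by omega)
      rw [if_pos rfl, if_neg (show ¬ j₁ = -k₁ by omega), if_neg (show ¬ j₁ = k₁ by omega),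
        if_neg (show ¬ j₂ = -k₁ by omega), if_neg (show ¬ j₂ = k₁ by omega)] at a
      split_ifs at a <;> omega
    · exact Or.inl ⟨hlt, sum_labels_aux h.2 h₁.2 h₂.2 hlt key⟩
  · rintro (⟨h1, rfl, ⟨rfl, rfl⟩ | ⟨rfl, rfl⟩⟩ | ⟨h1, rfl, ⟨rfl, rfl⟩ | ⟨rfl, rfl⟩⟩) <;>
      simp only [natWeight_neg] <;> abel

lemma exists_labelVec_eq {e : Fin n ≃ b.support}
    (he : ∀ i j, b.cartanMatrix (e i) (e j) = CartanMatrix.B n i j) {i : ι} (hi : b.IsPos i) :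
    ∃ r : RootLabel n, P.root i = labelVec e r := by
  obtain ⟨p, q, ⟨hp, hq, h1, h2⟩, hr⟩ := exists_root_eq he hi
  have hpq := height_eq_of_root_eq hp hq hr
  have hi' : 0 < b.height i := hi
  rw [abs_le] at hp hq
  -- Of the two expressions `ω p - ω q = ω (-q) - ω (-p)`, the one whose first label has the larger
  -- absolute value is a `labelVec`.
  rcases lt_or_gt_of_ne (show p + q ≠ 0 by omega) with h | h
  · refine ⟨⟨(-p, q), by simp only; omega⟩, ?_⟩
    simp only [hr, labelVec, neg_neg]
  · refine ⟨⟨(q, -p), by simp only; omega⟩, ?_⟩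
    rw [hr, labelVec]
    simp only [natWeight_neg]
    abel

lemma labelVec_injective (e : Fin n ≃ b.support) :
    Function.Injective (labelVec (b := b) e) := by
  rintro ⟨⟨k₁, j₁⟩, h₁⟩ ⟨⟨k, j⟩, h⟩ heq
  simp only [labelVec] at *
  have key (l : ℤ) (hl : 1 ≤ l) :
      ((if k₁ = l then 1 else 0) - (if j₁ = -l then 1 else if j₁ = l then -1 else 0) : ℤ) =
      (if k = l then 1 else 0) - (if j = -l then 1 else if j = l then -1 else 0) := by
    obtain ⟨f, hf⟩ := exists_coordinate (P := P) e l hl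
    have := congrArg f heq
    rw [map_sub, map_sub, hf (-k) (by rw [abs_le]; omega),
      hf j (by rw [abs_le]; omega), hf (-k₁) (by rw [abs_le]; omega),
      hf j₁ (by rw [abs_le]; omega)] at this
    simp only [← Int.cast_sub] at this
    have := Int.cast_injective this
    have e1 (k : ℤ) (hk : 0 < k) :
        (if -k = -l then 1 else if -k = l then -1 else 0 : ℤ) = if k = l then 1 else 0 := by
      split_ifs <;> omega
    rwa [e1 k (by omega), e1 k₁ (by omega)] at this
  have hk : k₁ = k := by
    rcases lt_trichotomy k₁ k with hlt | rfl | hlt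
    · have a := key k (by omega)
      rw [if_neg (by omega), if_neg (by omega), if_neg (by omega), if_pos rfl, if_neg (by omega),
        if_neg (by omega)] at a
      omega
    · rfl
    · have a := key k₁ (by omega)
      rw [if_pos rfl, if_neg (by omega), if_neg (by omega), if_neg (by omega), if_neg (by omega),
        if_neg (by omega)] at a
      omega
  subst hk
  have hj : j₁ = j := eq_of_signs fun l hl ↦ by linarith [key l hl]
  rw [Subtype.mk.injEq, hj]

/-- The sets of labels of positive roots that are closed under adding positive roots. -/
def IsUpperLabels (Φ : Set (RootLabel n)) : Prop :=
  ∀ p q r : RootLabel n, LabelSum p q r → q ∈ Φ → r ∈ Φ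

/-- The labels of iterated sums of `k + 1` roots with labels in `Φ`. -/
def labelPow (Φ : Set (RootLabel n)) : ℕ → Set (RootLabel n)
  | 0 => Φ
  | k + 1 => {r | ∃ p ∈ Φ, ∃ q ∈ labelPow Φ k, LabelSum p q r}

end RootsOfTypeB

/-! ### Ideals as upper sets of labels -/

section LieAlgebraOfTypeB

open LieAlgebra LieAlgebra.IsKilling

variable {g : Type*} [LieRing g] [LieAlgebra ℂ g] [FiniteDimensional ℂ g] [IsKilling ℂ g]
  {H : LieSubalgebra ℂ g} [H.IsCartanSubalgebra] {b : (rootSystem H).Base} {n : ℕ}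

/-- In type `B`, the positive roots are in bijection with the labels, compatibly with sums. -/
lemma exists_equiv_rootLabel (hB : IsTypeB n b) :
    ∃ E : PosRoot b ≃ RootLabel n, ∀ α β γ, IsSum α β γ ↔ LabelSum (E α) (E β) (E γ) := by
  obtain ⟨e, he⟩ := hB
  choose E hE using fun α : PosRoot b ↦ exists_labelVec_eq he α.2
  have hinj : Function.Injective E := by
    intro α β h
    have h1 : (rootSystem H).root α.1 = (rootSystem H).root β.1 := by rw [hE α, hE β, h]
    exact Subtype.ext ((rootSystem H).root.injective h1)
  have hsurj : Function.Surjective E := by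
    intro r
    obtain ⟨i, hi⟩ := sub_mem_range_root he r.2.1 r.2.2.1 r.2.2.2
    have hpos : b.IsPos i := by
      have := height_eq_of_root_eq (by rw [abs_le]; have := r.2; omega)
        (by rw [abs_le]; have := r.2; omega) hi
      change 0 < b.height i
      have := r.2
      omega
    refine ⟨⟨i, hpos⟩, labelVec_injective e ?_⟩
    rw [← hE]
    exact hi
  refine ⟨Equiv.ofBijective E (show Function.Bijective E from ⟨hinj, hsurj⟩), fun α β γ ↦ ?_⟩
  simp only [Equiv.ofBijective_apply]
  rw [← labelVec_eq_add_iff e, ← hE, ← hE, ← hE, IsSum]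

theorem numIdeals_eq_ncard_isUpperLabels (hB : IsTypeB n b) (h : ℕ) :
    numIdeals b h = {Φ : Set (RootLabel n) | IsUpperLabels Φ ∧ labelPow Φ h = ∅}.ncard := by
  obtain ⟨E, hE⟩ := exists_equiv_rootLabel hB
  have hpow (Φ : Set (RootLabel n)) (k : ℕ) : sumPow (E ⁻¹' Φ) k = E ⁻¹' labelPow Φ k := by
    induction k with
    | zero => rfl
    | succ k ih =>
      ext γ
      rw [sumPow, ih, labelPow]
      constructor
      · rintro ⟨α, hα, β, hβ, h⟩
        exact ⟨E α, hα, E β, hβ, (hE α β γ).mp h⟩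
      · rintro ⟨p, hp, q, hq, h⟩
        refine ⟨E.symm p, by simpa using hp, E.symm q, by simpa using hq, (hE _ _ _).mpr ?_⟩
        simpa using h
  rw [numIdeals_eq_ncard_isUpper,
    ← Set.ncard_image_of_injective {Φ : Set (RootLabel n) | _} E.surjective.preimage_injective]
  congr 1
  ext Ψ
  constructor
  · rintro ⟨hΨ, hh⟩
    obtain ⟨Φ, rfl⟩ : ∃ Φ, E ⁻¹' Φ = Ψ := ⟨E.symm ⁻¹' Ψ, by ext; simp⟩
    refine ⟨Φ, ⟨fun p q r h hq ↦ ?_, ?_⟩, rfl⟩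
    · have := hΨ (E.symm p) (E.symm q) (E.symm r) ((hE _ _ _).mpr (by simpa using h))
        (by simpa using hq)
      simpa using this
    · rw [hpow] at hh
      exact E.surjective.preimage_injective (hh.trans Set.preimage_empty.symm)
  · rintro ⟨Φ, ⟨hΦ, hh⟩, rfl⟩
    refine ⟨fun α β γ h hβ ↦ hΦ _ _ _ ((hE _ _ _).mp h) hβ, ?_⟩
    rw [hpow, hh, Set.preimage_empty]

end LieAlgebraOfTypeB

/-! ### Nilpotence class as the length of a longest chain -/

section Chains

/-- The sequences `v 1, …, v n` that describe upper sets of positive roots: `v k` is the least `j`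
such that `(k, j)` belongs to the upper set, and is `k` if there is none. -/
def IsProfile (v : ℤ → ℤ) (n : ℤ) : Prop :=
  ∀ k, 1 ≤ k → k ≤ n → -k < v k ∧ v k ≤ k ∧ (k + 1 ≤ n → v (k + 1) ≤ v k ∨ v k = k)

/-- The symmetric relation on labels of weights that extends the upper set described by `v`. -/
def Step (v : ℤ → ℤ) (i j : ℤ) : Prop :=
  i < j ∧ (i + j ≤ 0 ∧ v (-i) ≤ j ∧ v (-i) < -i ∨ 0 ≤ i + j ∧ v j ≤ -i ∧ v j < j)

/-- There is a chain of `s` steps from `i` to a label that is at most `j`. -/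
def Chain (v : ℤ → ℤ) : ℕ → ℤ → ℤ → Prop
  | 0, i, j => i ≤ j
  | s + 1, i, j => ∃ p, Step v i p ∧ Chain v s p j

variable {v : ℤ → ℤ} {n : ℤ}

lemma IsProfile.mono {m : ℤ} (hv : IsProfile v n) (h : m ≤ n) : IsProfile v m :=
  fun k h1 h2 ↦ ⟨(hv k h1 (by omega)).1, (hv k h1 (by omega)).2.1,
    fun h3 ↦ (hv k h1 (by omega)).2.2 (by omega)⟩

lemma IsProfile.le_of_le (hv : IsProfile v n) {k k' : ℤ} (hk : 1 ≤ k) (hlt : v k < k)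
    (hkk' : k ≤ k') : k' ≤ n → v k' ≤ v k := by
  induction k', hkk' using Int.leInduction with
  | base => exact fun _ ↦ le_rfl
  | succ l hl ih =>
    intro h
    have h1 := ih (by omega)
    have h2 := (hv l (by omega) (by omega)).2.2 h
    omega

/-- Both pairs describe the same difference of weights, as `ω` is odd. -/
lemma Step.symm {i j : ℤ} (h : Step v i j) : Step v (-j) (-i) := by
  obtain ⟨h1, h2⟩ := h
  refine ⟨by omega, ?_⟩
  simp only [neg_neg]
  rcases h2 with h2 | h2
  · exact Or.inr ⟨by omega, by omega, by omega⟩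
  · exact Or.inl ⟨by omega, by omega, by omega⟩

/-- When `j'` passes `-i`, the relevant row changes from `-i` to the longer row `j'`, whose
threshold is no larger because row `-i` is nonempty. -/
lemma Step.mono_right (hv : IsProfile v n) {i j j' : ℤ} (h : Step v i j)
    (hj : j ≤ j') (hj' : j' ≤ n) : Step v i j' := by
  obtain ⟨h1, h2 | h2⟩ := h
  · rcases le_or_gt (i + j') 0 with h3 | h3
    · exact ⟨by omega, Or.inl ⟨h3, by omega, by omega⟩⟩
    · have := hv.le_of_le (k := -i) (k' := j') (by omega) h2.2.2 (by omega) hj'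
      exact ⟨by omega, Or.inr ⟨by omega, by omega, by omega⟩⟩
  · have := hv.le_of_le (k := j) (k' := j') (by omega) h2.2.2 hj hj'
    exact ⟨by omega, Or.inr ⟨by omega, by omega, by omega⟩⟩

lemma Step.mono_left (hv : IsProfile v n) {i i' j : ℤ} (h : Step v i j)
    (hi : i' ≤ i) (hi' : -n ≤ i') : Step v i' j := by
  have := (h.symm.mono_right hv (by omega : -i ≤ -i') (by omega)).symm
  simpa using this

lemma Chain.add_le {s : ℕ} {i j : ℤ} (h : Chain v s i j) : i + s ≤ j := by
  induction s generalizing i with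
  | zero => simpa [Chain] using h
  | succ s ih =>
    obtain ⟨p, hp, h⟩ := h
    have := ih h
    have := hp.1
    push_cast
    omega

lemma Chain.mono_right {s : ℕ} {i j j' : ℤ} (h : Chain v s i j) (hj : j ≤ j') :
    Chain v s i j' := by
  induction s generalizing i with
  | zero => exact le_trans (b := j) h hj
  | succ s ih =>
    obtain ⟨p, hp, h⟩ := h
    exact ⟨p, hp, ih h⟩

lemma Chain.mono_left (hv : IsProfile v n) {s : ℕ} {i i' j : ℤ} (h : Chain v s i j)
    (hi : i' ≤ i) (hi' : -n ≤ i') : Chain v s i' j := by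
  cases s with
  | zero => exact le_trans (b := i) hi h
  | succ s =>
    obtain ⟨p, hp, h⟩ := h
    exact ⟨p, hp.mono_left hv hi hi', h⟩

lemma Chain.of_succ (hv : IsProfile v n) {s : ℕ} {i j : ℤ} (h : Chain v (s + 1) i j)
    (hi : -n ≤ i) : Chain v s i j := by
  obtain ⟨p, hp, h⟩ := h
  exact h.mono_left hv hp.1.le hi

lemma Chain.of_le (hv : IsProfile v n) {s t : ℕ} (hst : s ≤ t) {i j : ℤ} (h : Chain v t i j)
    (hi : -n ≤ i) : Chain v s i j := by
  induction t, hst using Nat.le_induction with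
  | base => exact h
  | succ t _ ih => exact ih (h.of_succ hv hi)

/-- The inequality allowed at the end of a chain may be moved to any other place, since `Step` is
monotone in both arguments. -/
lemma chain_succ_right_iff (hv : IsProfile v n) {s : ℕ} {i j : ℤ} (hi : -n ≤ i) (hj : j ≤ n) :
    Chain v (s + 1) i j ↔ ∃ q, Chain v s i q ∧ Step v q j := by
  induction s generalizing i with
  | zero =>
    constructor
    · rintro ⟨p, hp, h⟩
      exact ⟨i, le_refl i, hp.mono_right hv h hj⟩
    · rintro ⟨q, hq, h⟩
      exact ⟨j, h.mono_left hv hq hi, le_refl j⟩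
  | succ s ih =>
    constructor
    · rintro ⟨p, hp, h⟩
      have := hp.1
      obtain ⟨q, hq, h'⟩ := (ih (by omega)).mp h
      exact ⟨q, ⟨p, hp, hq⟩, h'⟩
    · rintro ⟨q, ⟨p, hp, hq⟩, h'⟩
      have := hp.1
      exact ⟨p, hp, (ih (by omega)).mpr ⟨q, hq, h'⟩⟩

lemma Chain.symm (hv : IsProfile v n) {s : ℕ} {i j : ℤ} (h : Chain v s i j) (hi : -n ≤ i)
    (hj : j ≤ n) : Chain v s (-j) (-i) := by
  induction s generalizing i with
  | zero => exact neg_le_neg h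
  | succ s ih =>
    obtain ⟨p, hp, h⟩ := h
    have := hp.1
    exact (chain_succ_right_iff hv (by omega) (by omega)).mpr ⟨-p, ih h (by omega), hp.symm⟩

/-- The upper set described by a sequence. -/
def profileSet (v : ℤ → ℤ) (n : ℕ) : Set (RootLabel n) := {r | v r.1.1 ≤ r.1.2}

lemma step_of_mem_profileSet {n : ℕ} {r : RootLabel n} (h : r ∈ profileSet v n) :
    Step v (-r.1.1) r.1.2 := by
  have h1 := r.2
  have h2 : v r.1.1 ≤ r.1.2 := h
  refine ⟨by omega, Or.inl ⟨by omega, ?_, ?_⟩⟩ <;> rw [neg_neg] <;> omega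

/-- Adding a root of the upper set puts one step before or after the chain. When the second entries
are opposite, one of the two summands has first to be reversed by symmetry. -/
lemma chain_of_mem_labelPow {n : ℕ} (hv : IsProfile v n) {s : ℕ} {r : RootLabel n}
    (h : r ∈ labelPow (profileSet v n) s) : Chain v (s + 1) (-r.1.1) r.1.2 := by
  induction s generalizing r with
  | zero => exact ⟨_, step_of_mem_profileSet h, le_refl _⟩
  | succ s ih =>
    obtain ⟨p, hp, q, hq, h⟩ := h
    have hp' := step_of_mem_profileSet hp
    have hq' := ih hq
    have h1 := p.2
    have h2 := q.2
    have h3 := r.2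
    rcases h with ⟨h4, h5, ⟨h6, h7⟩ | ⟨h6, h7⟩⟩ | ⟨h4, h5, ⟨h6, h7⟩ | ⟨h6, h7⟩⟩
    · rw [h5, h7]
      rw [h6] at hp'
      exact ⟨_, hp', hq'⟩
    · rw [h5, h7]
      have := hq'.symm hv (by omega) (by omega)
      rw [h6, neg_neg, neg_neg] at this
      exact ⟨_, hp', this⟩
    · rw [h5, h7, chain_succ_right_iff hv (by omega) (by omega)]
      rw [h6] at hq'
      exact ⟨_, hq', hp'⟩
    · rw [h5, h7, chain_succ_right_iff hv (by omega) (by omega)]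
      have := hp'.symm
      rw [h6, neg_neg, neg_neg] at this
      exact ⟨_, hq', this⟩

lemma mem_labelPow_of_chain {n : ℕ} (hv : IsProfile v n) {s : ℕ} {i j : ℤ}
    (h : Chain v (s + 1) i j) (hij : 0 < i + j) (hj : j ≤ n) (hlt : i < j) :
    (⟨(j, -i), hj, by simp only; omega, by simp only; omega⟩ : RootLabel n) ∈
      labelPow (profileSet v n) s := by
  induction s generalizing i with
  | zero =>
    obtain ⟨p, hp, h⟩ := h
    obtain ⟨-, h1 | h1⟩ := hp.mono_right hv h hj
    · omega
    · exact h1.2.1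
  | succ s ih =>
    obtain ⟨p, hp, hpi, h⟩ : ∃ p, Step v i p ∧ p ≠ -i ∧ Chain v (s + 1) p j := by
      obtain ⟨p, hp, h⟩ := h
      -- The difference `ω i - ω (-i)` is not a root, so a first step to `-i` must be replaced. It
      -- means that row `-i` is nonempty; the row then contains its last entry `-i - 1`, which can
      -- serve as the end of the step.
      by_cases hpi : p = -i
      · have h0 := hp.1
        refine ⟨p - 1, ⟨by omega, Or.inl ⟨by omega, ?_, ?_⟩⟩, by omega,
          h.mono_left hv (by omega) (by omega)⟩
        all_goals
          obtain ⟨-, h1 | h1⟩ := hp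
          · omega
          · rw [hpi] at h1; omega
      · exact ⟨p, hp, hpi, h⟩
    have h0 := hp.1
    have h1 := h.add_le
    push_cast at h1
    have hq := ih h (by omega) (by omega)
    rcases lt_or_gt_of_ne (show i + p ≠ 0 by omega) with h2 | h2
    · refine ⟨⟨(-i, p), by simp only; omega⟩, ?_, _, hq, Or.inr ⟨?_, rfl, Or.inr ⟨?_, rfl⟩⟩⟩
      · obtain ⟨-, h3 | h3⟩ := hp
        · exact h3.2.1
        · omega
      · simp only; omega
      · simp only; omega
    · refine ⟨⟨(p, -i), by simp only; omega⟩, ?_, _, hq, Or.inr ⟨?_, rfl, Or.inl ⟨rfl, rfl⟩⟩⟩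
      · obtain ⟨-, h3 | h3⟩ := hp
        · omega
        · exact h3.2.1
      · simp only; omega

/-- The right end is `n - 1` because `ω (-n) - ω n` is not a root. By monotonicity every chain
coming from a root can be widened to these ends. -/
lemma labelPow_profileSet_eq_empty_iff {n : ℕ} (hv : IsProfile v n) (hn : 1 ≤ n) (s : ℕ) :
    labelPow (profileSet v n) s = ∅ ↔ ¬ Chain v (s + 1) (-n) (n - 1) := by
  constructor
  · intro h hc
    have := hc.symm hv (by omega) (by omega)
    rw [neg_neg] at this
    have := mem_labelPow_of_chain hv this (by omega) (by omega) (by omega)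
    rw [h] at this
    exact this
  · intro h
    refine Set.eq_empty_of_forall_notMem fun r hr ↦ h ?_
    have h1 := r.2
    exact ((chain_of_mem_labelPow hv hr).mono_right (by omega)).mono_left hv (by omega) (by omega)

/-- The pair `(m, c)` such that `m` is the largest length of a chain from `-n` to `n`, and `n - c`
is the least label that is reached by a chain of length `m` from `-n`. -/
noncomputable def stat (v : ℤ → ℤ) (n : ℕ) : ℕ × ℕ :=
  if v n ≤ 0 ∧ -(n : ℤ) < v n then
    ((stat v (-v n).toNat).1 + 2,
      ((Finset.Ioo (-v n) n).filter fun k ↦ v k ≤ v n + (stat v (-v n).toNat).2).card)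
  else if v n < n then (1, (n - v n).toNat) else (0, 2 * n)
termination_by n
decreasing_by all_goals omega

lemma stat_of_nonpos {n : ℕ} (h : v n ≤ 0) (h' : -(n : ℤ) < v n) :
    stat v n = ((stat v (-v n).toNat).1 + 2,
      ((Finset.Ioo (-v n) n).filter fun k ↦ v k ≤ v n + (stat v (-v n).toNat).2).card) := by
  rw [stat, if_pos ⟨h, h'⟩]

lemma stat_of_pos {n : ℕ} (h : 0 < v n) (h' : v n < n) : stat v n = (1, (n - v n).toNat) := by
  rw [stat, if_neg (by omega), if_pos h']

lemma stat_of_eq {n : ℕ} (h : v n = n) : stat v n = (0, 2 * n) := by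
  rw [stat, if_neg (by omega), if_neg (by omega)]

lemma card_filter_Ioo_of_upper {a n : ℤ} (han : a < n) (p : ℤ → Prop) [DecidablePred p]
    (hp : ∀ k l, a < k → k ≤ l → l ≤ n → p k → p l) (hn : p n) {j : ℤ} (haj : a < j)
    (hj : j ≤ n) : p j ↔ n - ((Finset.Ioo a n).filter p).card ≤ j := by
  obtain ⟨t, ht1, ht2, ht3⟩ : ∃ t, a < t ∧ t ≤ n ∧ ∀ k, a < k → k ≤ n → (p k ↔ t ≤ k) := by
    obtain ⟨t, ⟨h1, h2, h3⟩, hmin⟩ := Int.exists_least_of_bdd (P := fun k ↦ a < k ∧ k ≤ n ∧ p k)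
      ⟨a, fun z hz ↦ hz.1.le⟩ ⟨n, han, le_rfl, hn⟩
    exact ⟨t, h1, h2, fun k hk hkn ↦ ⟨fun h ↦ hmin k ⟨hk, hkn, h⟩, fun h ↦ hp t k h1 h hkn h3⟩⟩
  have : (Finset.Ioo a n).filter p = Finset.Ico t n := by
    ext k
    simp only [Finset.mem_filter, Finset.mem_Ioo, Finset.mem_Ico]
    constructor
    · rintro ⟨⟨h1, h2⟩, h3⟩
      exact ⟨(ht3 k h1 h2.le).mp h3, h2⟩
    · rintro ⟨h1, h2⟩
      exact ⟨⟨by omega, h2⟩, (ht3 k (by omega) h2.le).mpr h1⟩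
  rw [this, Int.card_Ico, ht3 j haj hj]
  omega

/-- If `v n = -n₁ ≤ 0`, the best first step goes from `-n` to `-n₁`. Inside `[-n₁, n₁]` a longest
chain has `m` steps and can end at `n₁ - c₁` at the earliest. A further step leaves the interval,
and it reaches `j > n₁` exactly when `v j ≤ -n₁ + c₁`. No step starts beyond `n₁`, since `v k ≥ -n₁`
for `k > n₁`. If `0 < v n < n` there is only the first step, and if `v n = n` there is none. -/
theorem chain_stat {n : ℕ} (hv : IsProfile v n) (hv0 : v 0 = 0) :
    (stat v n).2 ≤ 2 * n ∧
    (∀ j : ℤ, j ≤ n → (Chain v (stat v n).1 (-n) j ↔ n - (stat v n).2 ≤ j)) ∧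
    ∀ j : ℤ, j ≤ n → ¬ Chain v ((stat v n).1 + 1) (-n) j := by
  induction n using Nat.strong_induction_on with
  | _ n ih =>
  rcases Nat.eq_zero_or_pos n with rfl | hn
  · rw [stat_of_eq (by simpa using hv0)]
    refine ⟨by simp, fun j hj ↦ by simp [Chain], fun j hj h ↦ ?_⟩
    have := h.add_le
    push_cast at this hj
    omega
  obtain ⟨hlow, hhigh, -⟩ := hv n (by omega) le_rfl
  rcases lt_trichotomy (v n) n with hlt | heq | hgt
  · rcases le_or_gt (v n) 0 with hneg | hpos
    · -- the recursive case
      obtain ⟨n₁, hn₁⟩ : ∃ n₁ : ℕ, v n = -n₁ := ⟨(-v n).toNat, by omega⟩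
      have hn₁n : n₁ < n := by omega
      have hstat := stat_of_nonpos hneg hlow
      rw [hn₁, neg_neg, Int.toNat_natCast] at hstat
      obtain ⟨ih1, ih2, ih3⟩ := ih n₁ hn₁n (hv.mono (by omega))
      set m := (stat v n₁).1
      set c₁ := (stat v n₁).2
      have hge (k : ℤ) (h1 : n₁ < k) (h2 : k ≤ n) : -(n₁ : ℤ) ≤ v k := by
        have h3 := (hv k (by omega) h2).2.1
        rcases h3.lt_or_eq with h4 | h4
        · have := hv.le_of_le (by omega) h4 h2 le_rfl
          omega
        · omega
      -- This property is inherited by larger rows and holds for `n`. Hence the number of rows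
      -- strictly between `n₁` and `n` that have it locates the first such row.
      set p : ℤ → Prop := fun k ↦ v k ≤ -n₁ + c₁
      have hpn : p n := by simp only [p]; omega
      have hpmono (k l : ℤ) (h1 : n₁ < k) (h2 : k ≤ l) (h3 : l ≤ n) (h4 : p k) : p l := by
        have h5 : v k ≤ -n₁ + c₁ := h4
        have := hv.le_of_le (by omega) (by omega : v k < k) h2 h3
        simp only [p]
        omega
      have hcard {j : ℤ} (h1 : n₁ < j) (h2 : j ≤ n) : p j ↔ n - (stat v n).2 ≤ j := by
        rw [hstat]
        exact card_filter_Ioo_of_upper (by omega) p hpmono hpn h1 h2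
      have hc : (stat v n).2 < n - n₁ := by
        rw [hstat]
        have h1 := Finset.card_filter_le (Finset.Ioo (n₁ : ℤ) n) p
        rw [Int.card_Ioo] at h1
        change ((Finset.Ioo (n₁ : ℤ) n).filter p).card < _
        omega
      have hstep {q j : ℤ} (h1 : n₁ < q) (hj : j ≤ n) : ¬ Step v q j := by
        rintro ⟨h2, h3 | h3⟩
        · omega
        · have := hge j (by omega) hj
          omega
      have hinner {j : ℤ} (h1 : n₁ < j) (h2 : j ≤ n) :
          Chain v (m + 1) (-n₁) j ↔ n - (stat v n).2 ≤ j := by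
        rw [← hcard h1 h2, chain_succ_right_iff hv (by omega) h2]
        constructor
        · rintro ⟨q, hq, hs⟩
          rcases le_or_gt q n₁ with hqn | hqn
          · have h3 := (ih2 q hqn).mp hq
            obtain ⟨-, h4 | h4⟩ := hs.mono_left hv h3 (by omega)
            · omega
            · simp only [p]
              omega
          · exact absurd hs (hstep hqn h2)
        · intro h3
          refine ⟨n₁ - c₁, (ih2 _ (by omega)).mpr le_rfl, by omega, Or.inr ⟨by omega, ?_, ?_⟩⟩
          · simp only [p] at h3
            omega
          · simp only [p] at h3
            omega
      have houter {s : ℕ} {j : ℤ} (h2 : j ≤ n) :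
          Chain v (s + 1) (-n) j ↔ Chain v s (-n₁) j := by
        constructor
        · rintro ⟨q, ⟨h3, h4⟩, hq⟩
          have h5 := hq.add_le
          refine hq.mono_left hv ?_ (by omega)
          rcases h4 with h4 | h4
          · rw [neg_neg] at h4; omega
          · have : q = n := by omega
            omega
        · intro h
          exact ⟨-n₁, ⟨by omega, Or.inl ⟨by omega, by rw [neg_neg]; omega,
            by rw [neg_neg]; omega⟩⟩, h⟩
      have hm : (stat v n).1 = m + 2 := by rw [hstat]
      refine ⟨by omega, fun j hj ↦ ?_, fun j hj ↦ ?_⟩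
      · rw [hm, houter hj]
        rcases le_or_gt j n₁ with h1 | h1
        · exact iff_of_false (ih3 j h1) (by omega)
        · exact hinner h1 hj
      · rw [hm, houter hj, chain_succ_right_iff hv (by omega) hj]
        rintro ⟨q, hq, hs⟩
        have hqj := hs.1
        rcases le_or_gt q n₁ with h1 | h1
        · exact ih3 q h1 hq
        · exact hstep h1 hj hs
    · rw [stat_of_pos hpos hlt]
      refine ⟨by simp only; omega, fun j hj ↦ ?_, fun j hj ↦ ?_⟩
      · constructor
        · rintro ⟨p, ⟨h1, h2⟩, h3⟩
          have h3' : p ≤ j := h3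
          simp only
          rw [neg_neg] at h2
          rcases h2 with h2 | h2
          · omega
          · have : p = n := by omega
            omega
        · intro h
          simp only at h
          exact ⟨v n, ⟨by omega, Or.inl ⟨by omega, by rw [neg_neg], by rw [neg_neg]; omega⟩⟩,
            by change v n ≤ j; omega⟩
      · rintro ⟨p, ⟨h1, h2⟩, q, ⟨h3, h4⟩, h5⟩
        have h5' : q ≤ j := h5
        rw [neg_neg] at h2
        have hp : v n ≤ p := by
          rcases h2 with h2 | h2
          · omega
          · have : p = n := by omega
            omega
        rcases h4 with h4 | h4
        · omega
        · have := hv.le_of_le (by omega) h4.2.2 (by omega : q ≤ n) le_rfl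
          omega
  · rw [stat_of_eq heq]
    refine ⟨le_rfl, fun j hj ↦ by simp only [Chain]; push_cast; omega, fun j hj ↦ ?_⟩
    rintro ⟨p, ⟨h1, h2⟩, h3⟩
    have h3' : p ≤ j := h3
    rw [neg_neg] at h2
    rcases h2 with h2 | h2
    · omega
    · have : p = n := by omega
      rw [this] at h2
      omega
  · omega

/-- A chain of `h + 1` steps must end before `n` to matter. If `h + 1` is the maximal length, this
is possible unless `c = 0`; if longer chains exist, dropping a last step suffices. -/
theorem labelPow_profileSet_eq_empty_iff_stat {n : ℕ} (hv : IsProfile v n) (hv0 : v 0 = 0)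
    (hn : 1 ≤ n) (h : ℕ) :
    labelPow (profileSet v n) h = ∅ ↔
      (stat v n).1 ≤ h ∨ (stat v n).1 = h + 1 ∧ (stat v n).2 = 0 := by
  obtain ⟨h1, h2, h3⟩ := chain_stat hv hv0
  rw [labelPow_profileSet_eq_empty_iff hv hn]
  rcases lt_trichotomy (stat v n).1 (h + 1) with hlt | heq | hgt
  · refine iff_of_true (fun hc ↦ ?_) (Or.inl (by omega))
    exact h3 _ (by omega) (hc.of_le hv (by omega) (by omega))
  · rw [← heq, h2 _ (by omega)]
    omega
  · refine iff_of_false (fun hc ↦ hc ?_) (by omega)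
    have h4 := (h2 n le_rfl).mpr (by omega)
    have h5 := h4.of_le hv (show h + 2 ≤ (stat v n).1 by omega) (by omega)
    obtain ⟨q, hq, hs⟩ := (chain_succ_right_iff hv (by omega) le_rfl).mp h5
    have := hs.1
    exact hq.mono_right (by omega)

end Chains

/-! ### Upper sets encoded by lists -/

section Lists

/-- The value at `k` of the sequence given by a list, the last value being the head. -/
def val : List ℤ → ℤ → ℤ
  | [], _ => 0
  | u :: l, k => if k = l.length + 1 then u else val l k

/-- The lists that describe upper sets of positive roots. -/
def ValidList : List ℤ → Prop
  | [] => True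
  | u :: l => ValidList l ∧ -((l.length : ℤ) + 1) < u ∧ u ≤ l.length + 1 ∧
      (u ≤ l.headD 0 ∨ l.headD 0 = l.length)

lemma val_cons_of_ne {u : ℤ} {l : List ℤ} {k : ℤ} (h : k ≠ l.length + 1) :
    val (u :: l) k = val l k := by
  rw [val, if_neg h]

lemma val_length (l : List ℤ) : val l l.length = l.headD 0 := by
  cases l with
  | nil => rfl
  | cons u l => simp [val]

lemma val_zero (l : List ℤ) : val l 0 = 0 := by
  induction l with
  | nil => rfl
  | cons u l ih => rw [val_cons_of_ne (by omega), ih]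

lemma val_append (B l : List ℤ) {k : ℤ} (h : k ≤ l.length) : val (B ++ l) k = val l k := by
  induction B with
  | nil => rfl
  | cons u B ih =>
    rw [List.cons_append, val_cons_of_ne (by rw [List.length_append]; push_cast; omega), ih]

lemma ValidList.of_append {B l : List ℤ} (h : ValidList (B ++ l)) : ValidList l := by
  induction B with
  | nil => exact h
  | cons u B ih => exact ih h.1

lemma ValidList.isProfile {l : List ℤ} (h : ValidList l) : IsProfile (val l) l.length := by
  induction l with
  | nil =>
    intro k h1 h2
    simp at h2
    omega
  | cons u l ih =>
    obtain ⟨h0, h1, h2, h3⟩ := h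
    intro k hk hk'
    rw [List.length_cons] at hk'
    push_cast at hk'
    rcases hk'.lt_or_eq with hlt | rfl
    · obtain ⟨a, b, c⟩ := ih h0 k hk (by omega)
      rw [val_cons_of_ne (by omega)]
      refine ⟨a, b, fun h4 ↦ ?_⟩
      rcases (show k ≤ l.length by omega).lt_or_eq with h5 | rfl
      · rw [val_cons_of_ne (by omega)]
        exact c (by omega)
      · rw [val_length, val, if_pos rfl]
        exact h3
    · have : val (u :: l) (l.length + 1) = u := if_pos rfl
      rw [this]
      refine ⟨h1, h2, fun h4 ↦ ?_⟩
      rw [List.length_cons] at h4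
      push_cast at h4
      omega

/-- The list of the values of a function at `n, …, 1`. -/
def listOf (v : ℤ → ℤ) : ℕ → List ℤ
  | 0 => []
  | n + 1 => v (n + 1) :: listOf v n

lemma length_listOf (v : ℤ → ℤ) (n : ℕ) : (listOf v n).length = n := by
  induction n with
  | zero => rfl
  | succ n ih => rw [listOf, List.length_cons, ih]

lemma val_listOf (v : ℤ → ℤ) (n : ℕ) {k : ℤ} (h1 : 1 ≤ k) (h2 : k ≤ n) :
    val (listOf v n) k = v k := by
  induction n with
  | zero => omega
  | succ n ih =>
    rw [listOf, val, length_listOf]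
    split_ifs with h
    · rw [h]
    · exact ih (by push_cast at h2; omega)

lemma validList_listOf {v : ℤ → ℤ} {n : ℕ} (hv : IsProfile v n) : ValidList (listOf v n) := by
  induction n with
  | zero => trivial
  | succ n ih =>
    obtain ⟨a, b, -⟩ := hv (n + 1) (by omega) (by push_cast; rfl)
    refine ⟨ih (hv.mono (by omega)), ?_, ?_, ?_⟩
    · rw [length_listOf]; exact a
    · rw [length_listOf]; exact b
    · rcases Nat.eq_zero_or_pos n with rfl | hn
      · exact Or.inr rfl
      · have h1 : (listOf v n).headD 0 = v n := by
          rw [← val_length, length_listOf, val_listOf v n (by omega) le_rfl]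
        rw [h1, length_listOf]
        exact (hv n (by omega) (by omega)).2.2 (by push_cast; rfl)

lemma list_eq_of_val_eq {l l' : List ℤ} (hlen : l.length = l'.length)
    (h : ∀ k : ℤ, 1 ≤ k → k ≤ l.length → val l k = val l' k) : l = l' := by
  induction l generalizing l' with
  | nil => exact (List.length_eq_zero_iff.mp hlen.symm).symm
  | cons u l ih =>
    cases l' with
    | nil => simp at hlen
    | cons u' l' =>
      rw [List.length_cons, List.length_cons, Nat.add_right_cancel_iff] at hlen
      have h1 := h (l.length + 1) (by omega) (by rw [List.length_cons]; push_cast; rfl)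
      rw [val, if_pos rfl, val, if_pos (by rw [hlen])] at h1
      rw [h1, ih hlen fun k hk hk' ↦ ?_]
      have := h k hk (by rw [List.length_cons]; push_cast; omega)
      rwa [val_cons_of_ne (by omega), val_cons_of_ne (by omega)] at this

lemma isUpperLabels_profileSet {v : ℤ → ℤ} {n : ℕ} (hv : IsProfile v n) :
    IsUpperLabels (profileSet v n) := by
  intro p q r h hq
  have hq' : v q.1.1 ≤ q.1.2 := hq
  have h1 := p.2
  have h2 := q.2
  have h3 := r.2
  change v r.1.1 ≤ r.1.2
  rcases h with ⟨h4, h5, h6⟩ | ⟨h4, h5, h6⟩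
  · have := hv.le_of_le (k := q.1.1) (k' := r.1.1) (by omega) (by omega) (by omega) (by omega)
    omega
  · rw [h5]
    omega

/-- Upper sets of positive roots are described by sequences. -/
lemma exists_profile {n : ℕ} {Φ : Set (RootLabel n)} (hΦ : IsUpperLabels Φ) :
    ∃ v, IsProfile v n ∧ profileSet v n = Φ := by
  have hmem (k : ℤ) (hk : 1 ≤ k) (hkn : k ≤ n) : ∃ t, -k < t ∧ t ≤ k ∧
      ∀ r : RootLabel n, r.1.1 = k → (r ∈ Φ ↔ t ≤ r.1.2) := by
    obtain ⟨t, ⟨ht1, ht2⟩, hmin⟩ := Int.exists_least_of_bdd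
      (P := fun j ↦ -k < j ∧ ∀ r : RootLabel n, r.1 = (k, j) → r ∈ Φ)
      ⟨-k, fun z hz ↦ hz.1.le⟩ ⟨k, by omega, fun r hr ↦ by
        have := r.2; rw [hr] at this; simp only at this; omega⟩
    refine ⟨t, ht1, hmin k ⟨by omega, fun r hr ↦ by
      have := r.2; rw [hr] at this; simp only at this; omega⟩, fun r hr ↦ ⟨fun h ↦ ?_, fun h ↦ ?_⟩⟩
    · refine hmin _ ⟨by have := r.2; omega, fun r' hr' ↦ ?_⟩
      have : r' = r := Subtype.ext (by rw [hr', ← hr])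
      rwa [this]
    · have key (j : ℤ) (hj : t ≤ j) : ∀ r : RootLabel n, r.1 = (k, j) → r ∈ Φ := by
        induction j, hj using Int.leInduction with
        | base => exact ht2
        | succ j hj ih =>
          intro r hr
          have h3 := r.2
          rw [hr] at h3
          simp only at h3
          have hq := ih ⟨(k, j), by simp only; omega⟩ rfl
          -- Moving from `j` to `j + 1` within a row adds the root `ω j - ω (j + 1)`, whose label
          -- depends on the sign of `j`.
          rcases le_or_gt 0 j with h0 | h0
          · refine hΦ ⟨(j + 1, -j), by simp only; omega⟩ _ r (Or.inr ⟨?_, ?_, Or.inr ⟨rfl, ?_⟩⟩) hq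
            · simp only; omega
            · rw [hr]
            · rw [hr]
          · refine hΦ ⟨(-j, j + 1), by simp only; omega⟩ _ r
              (Or.inr ⟨?_, ?_, Or.inl ⟨?_, ?_⟩⟩) hq
            · simp only; omega
            · rw [hr]
            · simp
            · rw [hr]
      exact key _ h r (Prod.ext hr rfl)
  choose! v hv1 hv2 hv3 using hmem
  refine ⟨v, fun k hk hkn ↦ ⟨hv1 k hk hkn, hv2 k hk hkn, fun hk1 ↦ ?_⟩, ?_⟩
  · rw [or_iff_not_imp_right]
    intro hne
    have h1 := hv1 k hk hkn
    have h2 := hv2 k hk hkn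
    let q : RootLabel n := ⟨(k, v k), by simp only; omega⟩
    have hq : q ∈ Φ := (hv3 k hk hkn q rfl).mpr le_rfl
    have := hΦ ⟨(k + 1, -k), by simp only; omega⟩ q ⟨(k + 1, v k), by simp only; omega⟩
      (Or.inl ⟨by simp [q], rfl, Or.inl ⟨rfl, rfl⟩⟩) hq
    exact (hv3 (k + 1) (by omega) hk1 _ rfl).mp this
  · ext r
    have := r.2
    exact (hv3 r.1.1 (by omega) (by omega) r rfl).symm

/-- The statistics of a list. -/
noncomputable def listStat (l : List ℤ) : ℕ × ℕ := stat (val l) l.length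

/-- The lists of length `n` describing ideals of class at most `h`. -/
def idealLists (h n : ℕ) : Set (List ℤ) :=
  {l | ValidList l ∧ ((listStat l).1 ≤ h ∨ (listStat l).1 = h + 1 ∧ (listStat l).2 = 0) ∧
    l.length = n}

theorem ncard_isUpperLabels_eq {n : ℕ} (hn : 1 ≤ n) (h : ℕ) :
    {Φ : Set (RootLabel n) | IsUpperLabels Φ ∧ labelPow Φ h = ∅}.ncard =
      (idealLists h n).ncard := by
  have hinj : Set.InjOn (fun l ↦ profileSet (val l) n) (idealLists h n) := by
    rintro l ⟨hl, -, hln⟩ l' ⟨hl', -, hln'⟩ heq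
    refine list_eq_of_val_eq (hln.trans hln'.symm) fun k hk hkn ↦ ?_
    obtain ⟨a, b, -⟩ := hl.isProfile k hk hkn
    obtain ⟨a', b', -⟩ := hl'.isProfile k hk (by omega)
    have key (j : ℤ) (h1 : -k < j) (h2 : j < k) : val l k ≤ j ↔ val l' k ≤ j :=
      Set.ext_iff.mp heq ⟨(k, j), by simp only; omega⟩
    rcases lt_trichotomy (val l k) (val l' k) with h1 | h1 | h1
    · have := (key (val l k) a (by omega)).mp le_rfl
      omega
    · exact h1
    · have := (key (val l' k) a' (by omega)).mpr le_rfl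
      omega
  rw [← hinj.ncard_image]
  congr 1
  ext Φ
  constructor
  · rintro ⟨hΦ, hh⟩
    obtain ⟨v, hv, rfl⟩ := exists_profile hΦ
    have hset : profileSet (val (listOf v n)) n = profileSet v n := by
      ext r
      have := r.2
      change val (listOf v n) r.1.1 ≤ _ ↔ _
      rw [val_listOf v n (by omega) (by omega)]
      rfl
    have hvalid := validList_listOf hv
    have hprof := hvalid.isProfile
    rw [length_listOf] at hprof
    refine ⟨listOf v n, ⟨hvalid, ?_, length_listOf v n⟩, hset⟩
    rw [listStat, length_listOf, ← labelPow_profileSet_eq_empty_iff_stat hprof (val_zero _) hn, hset]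
    exact hh
  · rintro ⟨l, ⟨hl, hs, rfl⟩, rfl⟩
    exact ⟨isUpperLabels_profileSet hl.isProfile,
      (labelPow_profileSet_eq_empty_iff_stat hl.isProfile (val_zero _) hn h).mpr hs⟩

lemma stat_congr {v w : ℤ → ℤ} {n : ℕ} (h : ∀ k : ℤ, 0 ≤ k → k ≤ n → v k = w k) :
    stat v n = stat w n := by
  induction n using Nat.strong_induction_on with
  | _ n ih =>
  have hn := h n (by omega) le_rfl
  by_cases h1 : v n ≤ 0 ∧ -(n : ℤ) < v n
  · have h2 : stat v (-v n).toNat = stat w (-v n).toNat :=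
      ih _ (by omega) fun k hk hk' ↦ h k hk (by omega)
    rw [stat_of_nonpos h1.1 h1.2, stat_of_nonpos (v := w) (by omega) (by omega), h2, ← hn]
    congr 2
    refine Finset.filter_congr fun k hk ↦ ?_
    rw [Finset.mem_Ioo] at hk
    rw [h k (by omega) hk.2.le]
  · have h2 : ¬ (w n ≤ 0 ∧ -(n : ℤ) < w n) := by rwa [← hn]
    rw [stat, if_neg h1, hn]
    conv_rhs => rw [stat, if_neg h2]

lemma stat_append (B l : List ℤ) : stat (val (B ++ l)) l.length = listStat l :=
  stat_congr fun _ _ hk ↦ val_append B l hk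

lemma card_filter_val (t : ℤ) (B l : List ℤ) :
    ((Finset.Ioc (l.length : ℤ) (B.length + l.length)).filter fun k ↦ val (B ++ l) k ≤ t).card =
      B.countP (· ≤ t) := by
  induction B with
  | nil => simp
  | cons u B ih =>
    have hI : Finset.Ioc (l.length : ℤ) ((u :: B).length + l.length) =
        insert ((B.length : ℤ) + l.length + 1) (Finset.Ioc (l.length : ℤ) (B.length + l.length)) := by
      ext k
      simp only [List.length_cons, Finset.mem_Ioc, Finset.mem_insert]
      push_cast
      omega
    have hval : val (u :: B ++ l) ((B.length : ℤ) + l.length + 1) = u := by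
      rw [List.cons_append, val, if_pos (by rw [List.length_append]; push_cast; ring)]
    have hfil : ((Finset.Ioc (l.length : ℤ) (B.length + l.length)).filter
          fun k ↦ val (u :: B ++ l) k ≤ t) =
        (Finset.Ioc (l.length : ℤ) (B.length + l.length)).filter fun k ↦ val (B ++ l) k ≤ t := by
      refine Finset.filter_congr fun k hk ↦ ?_
      rw [Finset.mem_Ioc] at hk
      rw [List.cons_append, val_cons_of_ne (by rw [List.length_append]; push_cast; omega)]
    rw [hI, Finset.filter_insert, hval, hfil, List.countP_cons]
    by_cases hu : u ≤ t
    · rw [if_pos hu, Finset.card_insert_of_notMem (by simp), ih]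
      simp [hu]
    · rw [if_neg hu, ih]
      simp [hu]

end Lists

/-! ### Decomposition of lists into blocks -/

section Blocks

/-- The list `q + s, …, q + 1`. -/
def rise (q : ℕ) : ℕ → List ℤ
  | 0 => []
  | s + 1 => ((q : ℤ) + s + 1) :: rise q s

lemma length_rise (q s : ℕ) : (rise q s).length = s := by
  induction s with
  | zero => rfl
  | succ s ih => rw [rise, List.length_cons, ih]

lemma rise_append (q s : ℕ) : rise q s ++ rise 0 q = rise 0 (q + s) := by
  induction s with
  | zero => rfl
  | succ s ih =>
    rw [← add_assoc, rise, rise, List.cons_append, ih]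
    push_cast
    simp

lemma lt_of_mem_rise {q s : ℕ} {u : ℤ} (h : u ∈ rise q s) : q < u ∧ u ≤ q + s := by
  induction s with
  | zero => simp [rise] at h
  | succ s ih =>
    rw [rise, List.mem_cons] at h
    push_cast
    rcases h with rfl | h
    · omega
    · have := ih h
      omega

lemma headD_rise (n : ℕ) : (rise 0 n).headD 0 = n := by
  cases n <;> simp [rise]

lemma validList_rise (n : ℕ) : ValidList (rise 0 n) := by
  induction n with
  | zero => trivial
  | succ n ih =>
    refine ⟨ih, ?_, ?_, Or.inr ?_⟩ <;> simp only [length_rise, headD_rise] <;> push_cast <;> omega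

lemma validList_cons {u : ℤ} {l : List ℤ} : ValidList (u :: l) ↔ ValidList l ∧
    -((l.length : ℤ) + 1) < u ∧ u ≤ l.length + 1 ∧ (u ≤ l.headD 0 ∨ l.headD 0 = l.length) :=
  Iff.rfl

lemma ValidList.headD_bounds {l : List ℤ} (h : ValidList l) :
    l.headD 0 ≤ l.length ∧ -(l.length : ℤ) ≤ l.headD 0 := by
  cases l with
  | nil => simp
  | cons u l =>
    obtain ⟨-, h1, h2, -⟩ := h
    simp only [List.headD_cons, List.length_cons]
    push_cast
    omega

/-- A nonempty row makes all later rows nonempty, so an empty last row means that the whole upper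
set is empty. -/
lemma ValidList.eq_rise {l : List ℤ} (h : ValidList l) (h' : l.headD 0 = l.length) :
    l = rise 0 l.length := by
  induction l with
  | nil => rfl
  | cons u l ih =>
    have h1 := h.1.headD_bounds.1
    obtain ⟨h0, -, -, h2⟩ := h
    simp only [List.headD_cons, List.length_cons] at h'
    push_cast at h'
    rw [List.length_cons, rise, ← ih h0 (by omega)]
    simpa using h'

/-- Sorted lists of integers `u` with `a ≤ u < a + N`. -/
def sortedLists (a : ℤ) (N : ℕ) : Set (List ℤ) :=
  {X | X.Pairwise (· ≤ ·) ∧ ∀ u ∈ X, a ≤ u ∧ u < a + N}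

lemma ValidList.sorted_append {l X : List ℤ} (hl : ValidList l) (hX : X.Pairwise (· ≤ ·))
    (h1 : ∀ u ∈ X, u ≤ l.headD 0) (h2 : ∀ u ∈ X, -((l.length : ℤ) + 1) < u) :
    ValidList (X ++ l) := by
  have h5 := hl.headD_bounds
  induction X with
  | nil => exact hl
  | cons u X ih =>
    simp only [List.mem_cons, forall_eq_or_imp] at h1 h2
    have hX' := List.pairwise_cons.mp hX
    rw [List.cons_append, validList_cons]
    refine ⟨ih hX'.2 h1.2 h2.2, ?_, ?_, Or.inl ?_⟩
    · rw [List.length_append]; push_cast; omega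
    · rw [List.length_append]; push_cast; omega
    · cases X with
      | nil => simpa using h1.1
      | cons w X => simpa using hX'.1 w (by simp)

/-- An entry of `B` that is at most `t` is smaller than its index, so from there towards the head
the entries can only decrease. Thus the small entries form a sorted initial segment. -/
lemma ValidList.exists_split {l B : List ℤ} (h : ValidList (B ++ l)) {t : ℤ}
    (ht : t ≤ l.length) : ∃ X Y, B = X ++ Y ∧ X.Pairwise (· ≤ ·) ∧ (∀ u ∈ X, u ≤ t) ∧
      ∀ u ∈ Y, t < u := by
  induction B with
  | nil => exact ⟨[], [], rfl, by simp, by simp, by simp⟩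
  | cons u B ih =>
    obtain ⟨X, Y, rfl, h1, h2, h3⟩ := ih h.1
    have h4 := h.2.2.2
    rcases X with _ | ⟨w, X⟩
    · rcases le_or_gt u t with hu | hu
      · exact ⟨[u], Y, rfl, by simp, by simpa using hu, h3⟩
      · exact ⟨[], u :: Y, rfl, by simp, by simp, by simpa using ⟨hu, h3⟩⟩
    · simp only [List.mem_cons, forall_eq_or_imp] at h2
      have huw : u ≤ w := by
        rcases h4 with h4 | h4
        · simpa using h4
        · simp at h4
          omega
      refine ⟨u :: w :: X, Y, rfl, List.pairwise_cons.mpr ⟨?_, h1⟩, ?_, h3⟩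
      · simp only [List.mem_cons, forall_eq_or_imp]
        exact ⟨huw, fun z hz ↦ huw.trans ((List.pairwise_cons.mp h1).1 z hz)⟩
      · simp only [List.mem_cons, forall_eq_or_imp]
        exact ⟨by omega, h2⟩

lemma ValidList.sorted_of_append {l B : List ℤ} (h : ValidList (B ++ l))
    (hl : l.headD 0 ≠ l.length) : B.Pairwise (· ≤ ·) ∧ ∀ u ∈ B, u ≤ l.headD 0 := by
  have hl' := h.of_append.headD_bounds.1
  induction B with
  | nil => simp
  | cons u B ih =>
    obtain ⟨h1, h2⟩ := ih h.1
    have h4 := h.2.2.2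
    rcases B with _ | ⟨w, X⟩
    · simp at h4
      rcases h4 with h4 | h4
      · simpa using h4
      · simp at hl
        contradiction
    · have hw := h2 w (by simp)
      have huw : u ≤ w := by
        rcases h4 with h4 | h4
        · simpa using h4
        · simp at h4
          omega
      refine ⟨List.pairwise_cons.mpr ⟨?_, h1⟩, ?_⟩
      · simp only [List.mem_cons, forall_eq_or_imp]
        exact ⟨huw, fun z hz ↦ huw.trans ((List.pairwise_cons.mp h1).1 z hz)⟩
      · rw [List.forall_mem_cons]
        exact ⟨by omega, h2⟩

/-- The ways to extend a list by entries larger than `t`. -/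
def extensions (l : List ℤ) (t : ℤ) : Set (List ℤ) :=
  {Y | ValidList (Y ++ l) ∧ ∀ u ∈ Y, t < u}

lemma extensions_eq_sortedLists {l : List ℤ} (hl : ValidList l) (hl' : l.headD 0 ≠ l.length)
    {t : ℤ} (ht : -(l.length : ℤ) ≤ t) (ht' : t ≤ l.headD 0) :
    extensions l t = sortedLists (t + 1) (l.headD 0 - t).toNat := by
  ext Y
  constructor
  · rintro ⟨h1, h2⟩
    have := h1.sorted_of_append hl'
    exact ⟨this.1, fun u hu ↦ ⟨h2 u hu, by have := this.2 u hu; omega⟩⟩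
  · rintro ⟨h1, h2⟩
    exact ⟨hl.sorted_append h1 (fun u hu ↦ by have := h2 u hu; omega)
      fun u hu ↦ by have := h2 u hu; omega, fun u hu ↦ (h2 u hu).1⟩

/-- A sorted list followed by a list `q + s, …, q + 1`. -/
def sortedRise (q : ℕ) (p : Σ s : ℕ, sortedLists (q + 1) s) : List ℤ := p.2.1 ++ rise q p.1

lemma validList_sortedRise (q : ℕ) (p : Σ s : ℕ, sortedLists (q + 1) s) :
    ValidList (sortedRise q p ++ rise 0 q) := by
  obtain ⟨s, Z, h1, h2⟩ := p
  rw [sortedRise, List.append_assoc, rise_append]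
  refine (validList_rise _).sorted_append h1 (fun u hu ↦ ?_) (fun u hu ↦ ?_)
  · have := h2 u hu
    rw [headD_rise]
    push_cast
    omega
  · have := h2 u hu
    rw [length_rise]
    omega

/-- Read from the tail, an extension first continues the rise for `s` rows. Once an entry falls
short of its index, all later ones are bounded by it. -/
lemma range_sortedRise (q : ℕ) : Set.range (sortedRise q) = extensions (rise 0 q) q := by
  ext Y
  constructor
  · rintro ⟨⟨s, Z, h1, h2⟩, rfl⟩
    refine ⟨validList_sortedRise q _, fun u hu ↦ ?_⟩
    rcases List.mem_append.mp hu with hu | hu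
    · have := h2 u hu
      omega
    · exact (lt_of_mem_rise hu).1
  · rintro ⟨h, hY⟩
    induction Y with
    | nil => exact ⟨⟨0, [], by simp, by simp⟩, rfl⟩
    | cons u Y ih =>
      rw [List.forall_mem_cons] at hY
      obtain ⟨⟨s, Z, h1, h2⟩, rfl⟩ := ih h.1 hY.2
      rw [List.cons_append, validList_cons] at h
      obtain ⟨-, -, h4, h5⟩ := h
      simp only [sortedRise] at h4 h5
      rw [List.append_assoc, rise_append] at h4 h5
      rcases Z with _ | ⟨w, Z⟩
      · simp only [List.nil_append, length_rise, headD_rise] at h4 h5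
        push_cast at h4 h5
        rcases h4.lt_or_eq with h6 | h6
        · exact ⟨⟨s, [u], by simp, by simp; omega⟩, rfl⟩
        · exact ⟨⟨s + 1, [], by simp, by simp⟩, by simp [sortedRise, rise, h6]⟩
      · have hw := h2 w (by simp)
        have huw : u ≤ w := by
          rcases h5 with h5 | h5
          · simpa using h5
          · simp [length_rise] at h5
            omega
        refine ⟨⟨s, u :: w :: Z, List.pairwise_cons.mpr ⟨?_, h1⟩, ?_⟩, rfl⟩
        · simp only [List.mem_cons, forall_eq_or_imp]
          exact ⟨huw, fun z hz ↦ huw.trans ((List.pairwise_cons.mp h1).1 z hz)⟩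
        · rw [List.forall_mem_cons]
          exact ⟨by omega, h2⟩

/-- The sorted part has no entry above `q + s`, so it cannot contain the next term of the rise. This
recovers `s`. -/
lemma sortedRise_injective (q : ℕ) : Function.Injective (sortedRise q) := by
  have key {s s' : ℕ} {Z Z' : List ℤ} (h1 : Z ∈ sortedLists (q + 1) s)
      (h : Z ++ rise q s = Z' ++ rise q s') : s' ≤ s := by
    by_contra! hlt
    obtain ⟨r, rfl⟩ := Nat.exists_eq_add_of_lt hlt
    have hr : rise q (s + r + 1) = rise (q + s) (r + 1) ++ rise q s := by
      clear h hlt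
      induction r with
      | zero => simp [rise]
      | succ r ih =>
        rw [← add_assoc, rise, ih, rise.eq_def (q + s) (r + 1 + 1)]
        push_cast
        simp [add_assoc]
    rw [hr, ← List.append_assoc, List.append_cancel_right_eq] at h
    have hmem : ((q : ℤ) + s + r + 1) ∈ Z := by
      rw [h, rise]
      push_cast
      simp
    have := h1.2 _ hmem
    omega
  rintro ⟨s, Z, hZ⟩ ⟨s', Z', hZ'⟩ h
  simp only [sortedRise] at h
  obtain rfl : s = s' := le_antisymm (key hZ' h.symm) (key hZ h)
  rw [List.append_cancel_right_eq] at h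
  subst h
  rfl

/-- The valid lists with a given first statistic. -/
def layer (m : ℕ) : Set (List ℤ) := {l | ValidList l ∧ (listStat l).1 = m}

lemma listStat_of_headD_eq {l : List ℤ} (h : l.headD 0 = l.length) :
    listStat l = (0, 2 * l.length) :=
  stat_of_eq (by rw [val_length, h])

lemma listStat_of_headD_pos {l : List ℤ} (h : 0 < l.headD 0) (h' : l.headD 0 < l.length) :
    listStat l = (1, (l.length - l.headD 0).toNat) := by
  rw [listStat, stat_of_pos (by rwa [val_length]) (by rwa [val_length]), val_length]

lemma listStat_nonpos_append {u : ℤ} {B l : List ℤ} (hu : u = -(l.length : ℤ)) :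
    listStat (u :: B ++ l) =
      ((listStat l).1 + 2, B.countP (· ≤ u + (listStat l).2)) := by
  have hv : val (u :: B ++ l) (u :: B ++ l).length = u := by
    rw [val_length]
    rfl
  have hlen : (u :: B ++ l).length = B.length + l.length + 1 := by
    simp only [List.cons_append, List.length_cons, List.length_append]
  rw [listStat, stat_of_nonpos (by rw [hv]; omega) (by rw [hv]; omega), hv]
  have h1 : (-u).toNat = l.length := by omega
  rw [h1, stat_append, ← card_filter_val _ B l]
  congr 2
  ext k
  simp only [Finset.mem_filter, Finset.mem_Ioo, Finset.mem_Ioc]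
  rw [hlen]
  push_cast
  constructor
  · rintro ⟨h2, h3⟩
    rw [List.cons_append, val_cons_of_ne (by rw [List.length_append]; push_cast; omega)] at h3
    exact ⟨by omega, h3⟩
  · rintro ⟨h2, h3⟩
    rw [List.cons_append, val_cons_of_ne (by rw [List.length_append]; push_cast; omega)]
    exact ⟨by omega, h3⟩

lemma exists_append_of_headD_nonpos {l : List ℤ} (hl : ValidList l) (h : l.headD 0 ≤ 0)
    (h' : l.headD 0 ≠ l.length) : ∃ u B l0, l = u :: B ++ l0 ∧ u = -(l0.length : ℤ) := by
  rcases l with _ | ⟨u, L⟩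
  · simp at h'
  · obtain ⟨-, h1, -, -⟩ := hl
    simp only [List.headD_cons] at h
    refine ⟨u, L.take (L.length - (-u).toNat), L.drop (L.length - (-u).toNat), by simp, ?_⟩
    rw [List.length_drop]
    omega

/-- These bounds place `bound l` below the head of `l` and show that the truncated difference in
`slack` is exact when the first statistic is nonzero. -/
lemma listStat_snd_le {l : List ℤ} (hl : ValidList l) :
    ((listStat l).2 : ℤ) ≤ l.length + l.headD 0 ∧
      ((listStat l).1 ≠ 0 → ((listStat l).2 : ℤ) + 1 ≤ l.length + l.headD 0) := by
  by_cases h : l.headD 0 = l.length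
  · rw [listStat_of_headD_eq h, h]
    push_cast
    simp
    omega
  have hb := hl.headD_bounds
  rcases le_or_gt (l.headD 0) 0 with h1 | h1
  · obtain ⟨u, B, l0, rfl, hu⟩ := exists_append_of_headD_nonpos hl h1 h
    rw [listStat_nonpos_append hu]
    have := List.countP_le_length (p := fun x ↦ decide (x ≤ u + (listStat l0).2)) (l := B)
    simp only [List.cons_append, List.length_cons, List.length_append, List.headD_cons]
    push_cast
    omega
  · rw [listStat_of_headD_pos h1 (by omega)]
    simp only
    omega

lemma layer_zero : layer 0 = Set.range (rise 0) := by
  ext l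
  constructor
  · rintro ⟨hl, h⟩
    refine ⟨l.length, (hl.eq_rise ?_).symm⟩
    by_contra h'
    have hb := hl.headD_bounds
    rcases le_or_gt (l.headD 0) 0 with h1 | h1
    · obtain ⟨u, B, l0, rfl, hu⟩ := exists_append_of_headD_nonpos hl h1 h'
      rw [listStat_nonpos_append hu] at h
      simp at h
    · rw [listStat_of_headD_pos h1 (by omega)] at h
      simp at h
  · rintro ⟨n, rfl⟩
    refine ⟨validList_rise n, ?_⟩
    rw [listStat_of_headD_eq (by rw [headD_rise, length_rise])]

/-- A nonempty row `k ≤ q` would keep all later entries below `q`. So a head larger than `q` forces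
the first `q` rows to be empty and the later entries to exceed `q`. -/
lemma mem_extensions_of_headD {L : List ℤ} (hL : ValidList L) {q : ℕ} (hq : q ≤ L.length)
    (h : (q : ℤ) + 1 ≤ L.headD 0 ∨ L.headD 0 = L.length) :
    ∃ B ∈ extensions (rise 0 q) q, L = B ++ rise 0 q := by
  suffices ∃ B, (∀ u ∈ B, (q : ℤ) < u) ∧ L = B ++ rise 0 q by
    obtain ⟨B, h1, rfl⟩ := this
    exact ⟨B, ⟨hL, h1⟩, rfl⟩
  have hfull {L : List ℤ} (hL : ValidList L) (hq : q ≤ L.length) (h : L.headD 0 = L.length) :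
      ∃ B, (∀ u ∈ B, (q : ℤ) < u) ∧ L = B ++ rise 0 q := by
    refine ⟨rise q (L.length - q), fun u hu ↦ (lt_of_mem_rise hu).1, ?_⟩
    rw [rise_append, Nat.add_sub_cancel' hq]
    exact hL.eq_rise h
  induction L with
  | nil => exact hfull hL hq (by simp)
  | cons w L ih =>
    rcases h with h | h
    · rw [validList_cons] at hL
      obtain ⟨h1, h2, h3, h4⟩ := hL
      simp only [List.headD_cons] at h
      obtain ⟨B, hB, hB'⟩ := ih h1 (by omega) (by omega)
      refine ⟨w :: B, ?_, by rw [hB', List.cons_append]⟩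
      rw [List.forall_mem_cons]
      exact ⟨by omega, hB⟩
    · exact hfull hL hq h

/-- The lists with first statistic `1`. -/
def layerOneMap (p : Σ q s : ℕ, sortedLists ((q : ℤ) + 1) (s + 1)) : List ℤ :=
  ((p.1 : ℤ) + 1) :: sortedRise p.1 ⟨p.2.1 + 1, p.2.2⟩ ++ rise 0 p.1

lemma length_layerOneMap (q s : ℕ) (Z : sortedLists ((q : ℤ) + 1) (s + 1)) :
    (layerOneMap ⟨q, s, Z⟩).length = q + s + 2 + Z.1.length := by
  simp only [layerOneMap, sortedRise, List.cons_append, List.length_cons, List.length_append,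
    length_rise]
  ring

lemma headD_layerOneMap (q s : ℕ) (Z : sortedLists ((q : ℤ) + 1) (s + 1)) :
    (layerOneMap ⟨q, s, Z⟩).headD 0 = q + 1 := rfl

lemma listStat_layerOneMap (q s : ℕ) (Z : sortedLists ((q : ℤ) + 1) (s + 1)) :
    listStat (layerOneMap ⟨q, s, Z⟩) = (1, s + 1 + Z.1.length) := by
  rw [listStat_of_headD_pos, length_layerOneMap, headD_layerOneMap]
  · congr 1
    push_cast
    omega
  · rw [headD_layerOneMap]
    omega
  · rw [length_layerOneMap, headD_layerOneMap]
    push_cast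
    omega

lemma layer_one : layer 1 = Set.range layerOneMap := by
  ext l
  constructor
  · rintro ⟨hl, h⟩
    have hb := hl.headD_bounds
    by_cases h0 : l.headD 0 = l.length
    · rw [listStat_of_headD_eq h0] at h
      simp at h
    rcases le_or_gt (l.headD 0) 0 with h1 | h1
    · obtain ⟨u, B, l0, rfl, hu⟩ := exists_append_of_headD_nonpos hl h1 h0
      rw [listStat_nonpos_append hu] at h
      simp at h
    rcases l with _ | ⟨u, L⟩
    · simp at h1
    simp only [List.headD_cons, List.length_cons] at h0 h1 hb
    push_cast at h0 hb
    obtain ⟨q, rfl⟩ : ∃ q : ℕ, u = q + 1 := ⟨(u - 1).toNat, by omega⟩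
    rw [validList_cons] at hl
    obtain ⟨B, hB, rfl⟩ := mem_extensions_of_headD hl.1 (q := q) (by omega) (by omega)
    rw [← range_sortedRise] at hB
    obtain ⟨⟨s, Z, hZ⟩, rfl⟩ := hB
    -- For `s = 0` there is no room for a sorted part, and the list would be a full rise, with first
    -- statistic `0`.
    rcases s with _ | s
    · exfalso
      rcases Z with _ | ⟨z, Z⟩
      · simp [sortedRise, rise, length_rise] at h0
      · have := hZ.2 z (by simp)
        push_cast at this
        omega
    · exact ⟨⟨q, s, Z, hZ⟩, rfl⟩
  · rintro ⟨⟨q, s, Z, h1, h2⟩, rfl⟩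
    refine ⟨?_, by rw [listStat_layerOneMap]⟩
    rw [layerOneMap, List.cons_append, validList_cons]
    refine ⟨validList_sortedRise _ _, by omega, ?_, ?_⟩
    · simp only [sortedRise, List.length_append, length_rise]
      push_cast
      omega
    · simp only [sortedRise]
      rcases Z with _ | ⟨z, Z⟩
      · right
        simp only [List.nil_append]
        rw [rise_append, headD_rise, length_rise]
      · left
        exact (h2 z (by simp)).1

lemma layerOneMap_injective : Function.Injective layerOneMap := by
  rintro ⟨q, s, Z, hZ⟩ ⟨q', s', Z', hZ'⟩ h
  rw [layerOneMap, layerOneMap, List.cons_append, List.cons_append, List.cons.injEq] at h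
  obtain ⟨h1, h2⟩ := h
  simp only [add_left_inj, Nat.cast_inj] at h1
  subst h1
  rw [List.append_cancel_right_eq] at h2
  have := sortedRise_injective q h2
  simp only [Sigma.mk.injEq, Nat.add_right_cancel_iff] at this
  obtain ⟨rfl, h3⟩ := this
  simpa using h3

/-- The largest entry that is counted by the second statistic of a list which begins with the
negative of the length of `l` and ends with `l`. -/
noncomputable def bound (l : List ℤ) : ℤ := -(l.length : ℤ) + (listStat l).2

/-- The lists with first statistic `m + 2`, in terms of those with first statistic `m`. -/
noncomputable def layerMap (m : ℕ) (p : Σ l : layer m,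
    sortedLists (-(l.1.length : ℤ)) ((listStat l.1).2 + 1) × extensions l.1 (bound l.1)) :
    List ℤ :=
  (-(p.1.1.length : ℤ)) :: (p.2.1.1 ++ p.2.2.1) ++ p.1.1

lemma length_layerMap {m : ℕ} (l : layer m)
    (X : sortedLists (-(l.1.length : ℤ)) ((listStat l.1).2 + 1))
    (Y : extensions l.1 (bound l.1)) :
    (layerMap m ⟨l, X, Y⟩).length = l.1.length + 1 + X.1.length + Y.1.length := by
  simp only [layerMap, List.cons_append, List.length_cons, List.length_append]
  ring

lemma headD_layerMap {m : ℕ} (l : layer m)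
    (X : sortedLists (-(l.1.length : ℤ)) ((listStat l.1).2 + 1))
    (Y : extensions l.1 (bound l.1)) :
    (layerMap m ⟨l, X, Y⟩).headD 0 = -(l.1.length : ℤ) := rfl

lemma filter_append {X Y : List ℤ} {t : ℤ} (hX : ∀ u ∈ X, u ≤ t) (hY : ∀ u ∈ Y, t < u) :
    (X ++ Y).filter (· ≤ t) = X := by
  rw [List.filter_append, List.filter_eq_self.mpr (by simpa using hX),
    List.filter_eq_nil_iff.mpr (by simpa using hY), List.append_nil]

lemma listStat_layerMap {m : ℕ} (l : layer m)
    (X : sortedLists (-(l.1.length : ℤ)) ((listStat l.1).2 + 1))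
    (Y : extensions l.1 (bound l.1)) :
    listStat (layerMap m ⟨l, X, Y⟩) = (m + 2, X.1.length) := by
  have hf : (X.1 ++ Y.1).filter (· ≤ -(l.1.length : ℤ) + (listStat l.1).2) = X.1 :=
    filter_append (fun u hu ↦ ?_) Y.2.2
  · rw [layerMap, listStat_nonpos_append rfl, l.2.2, List.countP_eq_length_filter, hf]
  have := X.2.2 u hu
  push_cast at this
  omega

/-- A nonpositive head `u` says at which length `-u` to cut off the inner list. The other outer
entries split at `bound`: those up to it form `X` and are counted by the new second statistic, those
above it form `Y`. -/
lemma layer_add_two (m : ℕ) : layer (m + 2) = Set.range (layerMap m) := by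
  ext l
  constructor
  · rintro ⟨hl, h⟩
    have hb := hl.headD_bounds
    by_cases h0 : l.headD 0 = l.length
    · rw [listStat_of_headD_eq h0] at h
      simp at h
    rcases le_or_gt (l.headD 0) 0 with h1 | h1
    swap
    · rw [listStat_of_headD_pos h1 (by omega)] at h
      simp at h
    obtain ⟨u, B, l0, rfl, rfl⟩ := exists_append_of_headD_nonpos hl h1 h0
    rw [listStat_nonpos_append rfl] at h
    have hl0 : ValidList l0 := hl.of_append
    have hc := (listStat_snd_le hl0).1
    have hb0 := hl0.headD_bounds
    -- The head takes part in the splitting, so sortedness also bounds the entries of `X` below by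
    -- it.
    obtain ⟨X, Y, hXY, h2, h3, h4⟩ := hl.exists_split (t := bound l0) (by rw [bound]; omega)
    rcases X with _ | ⟨w, X⟩
    · rw [List.nil_append] at hXY
      have := h4 _ (by rw [← hXY]; exact List.mem_cons_self)
      rw [bound] at this
      omega
    · rw [List.cons_append, List.cons.injEq] at hXY
      obtain ⟨rfl, rfl⟩ := hXY
      rw [List.pairwise_cons] at h2
      refine ⟨⟨⟨l0, hl0, by simpa using h⟩, ⟨X, h2.2, fun u hu ↦ ⟨h2.1 u hu, ?_⟩⟩,
        ⟨Y, ?_, h4⟩⟩, rfl⟩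
      · have := h3 u (List.mem_cons_of_mem _ hu)
        rw [bound] at this
        simp only
        push_cast
        omega
      · rw [List.cons_append, List.append_assoc] at hl
        exact hl.1.of_append
  · rintro ⟨⟨⟨l, hl, hm⟩, ⟨X, hX, hX'⟩, ⟨Y, hY, hY'⟩⟩, rfl⟩
    refine ⟨?_, by rw [listStat_layerMap]⟩
    rw [layerMap]
    simp only
    rw [← List.cons_append, List.append_assoc]
    have hb0 := hl.headD_bounds
    have hc := (listStat_snd_le hl).1
    have hX'' : ∀ u ∈ (-(l.length : ℤ)) :: X, -(l.length : ℤ) ≤ u ∧ u ≤ bound l := by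
      rw [List.forall_mem_cons, bound]
      refine ⟨by omega, fun u hu ↦ ?_⟩
      have := hX' u hu
      push_cast at this
      omega
    refine hY.sorted_append (List.pairwise_cons.mpr ⟨fun u hu ↦ (hX' u hu).1, hX⟩)
      (fun u hu ↦ (hX'' u hu).2.trans ?_) (fun u hu ↦ ?_)
    · rcases Y with _ | ⟨y, Y⟩
      · change bound l ≤ l.headD 0
        rw [bound]
        omega
      · exact (hY' y (by simp)).le
    · have := (hX'' u hu).1
      rw [List.length_append]
      push_cast
      omega

/-- The head gives the length of the inner list, and filtering by `bound` separates `X` from `Y`. -/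
lemma layerMap_injective (m : ℕ) : Function.Injective (layerMap m) := by
  rintro ⟨⟨l, hl⟩, ⟨X, hX⟩, ⟨Y, hY⟩⟩ ⟨⟨l', hl'⟩, ⟨X', hX'⟩, ⟨Y', hY'⟩⟩ h
  simp only [layerMap] at h
  have h0 := h
  rw [List.cons_append, List.cons_append, List.cons.injEq] at h0
  obtain ⟨h1, h2⟩ := h0
  obtain ⟨h3, rfl⟩ := List.append_inj' h2 (by omega)
  have key {X Y : List ℤ} (hX : X ∈ sortedLists (-(l.length : ℤ)) ((listStat l).2 + 1))
      (hY : Y ∈ extensions l (bound l)) : (X ++ Y).filter (· ≤ bound l) = X := by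
    refine filter_append (fun u hu ↦ ?_) hY.2
    have := hX.2 u hu
    rw [bound]
    push_cast at this
    omega
  obtain rfl : X = X' := by rw [← key hX hY, h3, key hX' hY']
  rw [List.append_cancel_left_eq] at h3
  subst h3
  rfl

end Blocks

/-! ### Generating functions of the layers -/

section Sums

open scoped ENNReal

/-- Prepending copies of `a` to a sorted list with entries larger than `a`. -/
def replicateAppend (a : ℤ) (N : ℕ) (p : ℕ × sortedLists (a + 1) N) : List ℤ :=
  List.replicate p.1 a ++ p.2.1

lemma range_replicateAppend (a : ℤ) (N : ℕ) :
    Set.range (replicateAppend a N) = sortedLists a (N + 1) := by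
  ext X
  constructor
  · rintro ⟨⟨j, X, h1, h2⟩, rfl⟩
    refine ⟨List.pairwise_append.mpr ⟨?_, h1, fun u hu v hv ↦ ?_⟩, fun u hu ↦ ?_⟩
    · simp [List.pairwise_replicate]
    · rw [List.eq_of_mem_replicate hu]
      have := h2 v hv
      omega
    · push_cast
      rcases List.mem_append.mp hu with hu | hu
      · rw [List.eq_of_mem_replicate hu]
        omega
      · have := h2 u hu
        omega
  · rintro ⟨h1, h2⟩
    induction X with
    | nil => exact ⟨⟨0, [], by simp, by simp⟩, rfl⟩
    | cons u X ih =>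
      rw [List.pairwise_cons] at h1
      have h3 := h2 u (by simp)
      push_cast at h3
      rcases h3.1.eq_or_lt with h | h
      · obtain ⟨⟨j, Z⟩, hZ⟩ := ih h1.2 fun v hv ↦ h2 v (by simp [hv])
        refine ⟨⟨j + 1, Z⟩, ?_⟩
        rw [← hZ, ← h]
        rfl
      · refine ⟨⟨0, u :: X, List.pairwise_cons.mpr h1, fun v hv ↦ ?_⟩, rfl⟩
        have h4 := h2 v hv
        push_cast at h4
        rcases List.mem_cons.mp hv with rfl | hv
        · omega
        · have := h1.1 v hv
          omega

lemma replicateAppend_injective (a : ℤ) (N : ℕ) : Function.Injective (replicateAppend a N) := by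
  rintro ⟨j, X, hX⟩ ⟨j', X', hX'⟩ h
  simp only [replicateAppend] at h
  have key {j : ℕ} {X : List ℤ} (hX : X ∈ sortedLists (a + 1) N) :
      (List.replicate j a ++ X).filter (· ≤ a) = List.replicate j a :=
    filter_append (fun u hu ↦ (List.eq_of_mem_replicate hu).le) fun u hu ↦ by
      have := hX.2 u hu
      omega
  have h1 := congrArg (List.filter (· ≤ a)) h
  rw [key hX, key hX'] at h1
  obtain rfl : j = j' := by simpa using congrArg List.length h1
  rw [List.append_cancel_left_eq] at h
  subst h
  rfl

/-- A sorted list is an arbitrary choice of multiplicities for the `N` admissible values. -/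
lemma tsum_sortedLists (a : ℤ) (N : ℕ) (y : ℝ≥0∞) :
    ∑' X : sortedLists a N, y ^ X.1.length = ((1 - y)⁻¹) ^ N := by
  induction N generalizing a with
  | zero =>
    have : sortedLists a 0 = {[]} := by
      ext X
      rcases X with _ | ⟨u, X⟩
      · simp [sortedLists]
      · simp only [sortedLists, Set.mem_ofPred_eq, Set.mem_singleton_iff, reduceCtorEq, iff_false]
        rintro ⟨-, h⟩
        have := h u (by simp)
        simp at this
        omega
    rw [this, tsum_singleton ([] : List ℤ) (fun X ↦ y ^ X.length)]
    simp
  | succ N ih =>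
    rw [← range_replicateAppend, tsum_range (fun X : List ℤ ↦ y ^ X.length)
      (replicateAppend_injective a N), ENNReal.tsum_prod']
    simp only [replicateAppend, List.length_append, List.length_replicate, pow_add,
      ENNReal.tsum_mul_left, ih, ENNReal.tsum_mul_right, ENNReal.tsum_geometric]
    ring

lemma tsum_extensions_rise (q : ℕ) (y : ℝ≥0∞) :
    ∑' Y : extensions (rise 0 q) q, y ^ Y.1.length = (1 - y * (1 - y)⁻¹)⁻¹ := by
  rw [← range_sortedRise, tsum_range (fun X : List ℤ ↦ y ^ X.length) (sortedRise_injective q),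
    ENNReal.tsum_sigma']
  simp only [sortedRise, List.length_append, length_rise, pow_add, ENNReal.tsum_mul_right,
    tsum_sortedLists, ← mul_pow, ENNReal.tsum_geometric]
  rw [mul_comm y]

/-- The third statistic of a list. -/
noncomputable def slack (l : List ℤ) : ℕ := (l.length + l.headD 0 - (listStat l).2 - 1).toNat

/-- The weight of a list. -/
noncomputable def weight (x A B : ℝ≥0∞) (l : List ℤ) : ℝ≥0∞ :=
  x ^ l.length * A ^ (listStat l).2 * B ^ slack l

/-- The generating function of the lists with a given first statistic. -/
noncomputable def layerSum (m : ℕ) (x A B : ℝ≥0∞) : ℝ≥0∞ := ∑' l : layer m, weight x A B l.1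

lemma rise_injective : Function.Injective (rise 0) := fun n n' h ↦ by
  rw [← length_rise 0 n, h, length_rise]

lemma layerSum_zero (x A B : ℝ≥0∞) : layerSum 0 x A B = (1 - x * A ^ 2)⁻¹ := by
  have h (n : ℕ) : weight x A B (rise 0 n) = (x * A ^ 2) ^ n := by
    have h1 : listStat (rise 0 n) = (0, 2 * n) := by
      rw [listStat_of_headD_eq (by rw [headD_rise, length_rise]), length_rise]
    have h2 : slack (rise 0 n) = 0 := by
      rw [slack, h1, headD_rise, length_rise]
      push_cast
      omega
    rw [weight, h1, h2, length_rise, mul_pow, ← pow_mul, pow_zero, mul_one]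
  rw [layerSum, layer_zero, tsum_range _ rise_injective]
  simp only [h, ENNReal.tsum_geometric]

lemma layerSum_one (x A B : ℝ≥0∞) : layerSum 1 x A B =
    x * B * (1 - x * B ^ 2)⁻¹ *
      (x * A * (1 - x * A)⁻¹ * (1 - x * A * (1 - x * A)⁻¹)⁻¹) := by
  have h (q s : ℕ) (Z : sortedLists ((q : ℤ) + 1) (s + 1)) :
      weight x A B (layerOneMap ⟨q, s, Z⟩) =
        x * B * (x * B ^ 2) ^ q * ((x * A) * (x * A) ^ s * (x * A) ^ Z.1.length) := by
    have h2 : slack (layerOneMap ⟨q, s, Z⟩) = 2 * q + 1 := by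
      rw [slack, listStat_layerOneMap, length_layerOneMap, headD_layerOneMap]
      push_cast
      omega
    rw [weight, h2, listStat_layerOneMap, length_layerOneMap]
    ring
  rw [layerSum, layer_one, tsum_range _ layerOneMap_injective, ENNReal.tsum_sigma']
  simp only [ENNReal.tsum_sigma', h, ENNReal.tsum_mul_left, tsum_sortedLists]
  have h3 (s : ℕ) : x * A * (x * A) ^ s * ((1 - x * A)⁻¹) ^ (s + 1) =
      x * A * (1 - x * A)⁻¹ * (x * A * (1 - x * A)⁻¹) ^ s := by ring
  simp only [h3, ENNReal.tsum_mul_left, ENNReal.tsum_mul_right, ENNReal.tsum_geometric]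

/-- In `layerMap` the new second statistic is the length of `X` and the new slack that of `Y`, so
the two blocks are weighted by `x * A` and `x * B` per entry. -/
lemma layerSum_add_two (m : ℕ) (x A B : ℝ≥0∞) : layerSum (m + 2) x A B =
    x * (1 - x * A)⁻¹ * ∑' l : layer m, x ^ l.1.length * ((1 - x * A)⁻¹) ^ (listStat l.1).2 *
      ∑' Y : extensions l.1 (bound l.1), (x * B) ^ Y.1.length := by
  have h (l : layer m) (X : sortedLists (-(l.1.length : ℤ)) ((listStat l.1).2 + 1))
      (Y : extensions l.1 (bound l.1)) : weight x A B (layerMap m ⟨l, X, Y⟩) =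
        x * x ^ l.1.length * ((x * A) ^ X.1.length * (x * B) ^ Y.1.length) := by
    have h2 : slack (layerMap m ⟨l, X, Y⟩) = Y.1.length := by
      rw [slack, listStat_layerMap, length_layerMap, headD_layerMap]
      push_cast
      omega
    rw [weight, h2, listStat_layerMap, length_layerMap]
    ring
  rw [layerSum, layer_add_two, tsum_range _ (layerMap_injective m), ENNReal.tsum_sigma']
  simp only [ENNReal.tsum_prod', h, ENNReal.tsum_mul_left, ENNReal.tsum_mul_right,
    tsum_sortedLists]
  rw [← ENNReal.tsum_mul_left]
  exact tsum_congr fun l ↦ by ring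

lemma layerSum_two (x A B : ℝ≥0∞) : layerSum 2 x A B =
    x * (1 - x * A)⁻¹ * (1 - x * ((1 - x * A)⁻¹) ^ 2)⁻¹ *
      (1 - x * B * (1 - x * B)⁻¹)⁻¹ := by
  have h (n : ℕ) : (listStat (rise 0 n)).2 = 2 * n := by
    rw [listStat_of_headD_eq (by rw [headD_rise, length_rise]), length_rise]
  have h' (n : ℕ) : bound (rise 0 n) = n := by
    rw [bound, h, length_rise]
    push_cast
    omega
  have h'' (n : ℕ) : ∑' Y : extensions (rise 0 n) (bound (rise 0 n)), (x * B) ^ Y.1.length =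
      (1 - x * B * (1 - x * B)⁻¹)⁻¹ := by
    rw [h']
    exact tsum_extensions_rise n _
  rw [layerSum_add_two 0, layer_zero, tsum_range (fun l : List ℤ ↦ x ^ l.length *
    ((1 - x * A)⁻¹) ^ (listStat l).2 * ∑' Y : extensions l (bound l), (x * B) ^ Y.1.length)
    rise_injective]
  simp only [h, h'', length_rise, ENNReal.tsum_mul_right, pow_mul, ← mul_pow,
    ENNReal.tsum_geometric]
  ring

/-- For an inner list with nonzero first statistic, `X` and `Y` are sorted lists over `c + 1` and
`slack + 1` values. Their sums are `(1 - x * A)⁻¹` and `(1 - x * B)⁻¹` to these powers, which is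
again a weight of the inner list times one extra factor of each. -/
lemma layerSum_add_three (m : ℕ) (x A B : ℝ≥0∞) : layerSum (m + 3) x A B =
    x * (1 - x * A)⁻¹ * (1 - x * B)⁻¹ * layerSum (m + 1) x (1 - x * A)⁻¹ (1 - x * B)⁻¹ := by
  rw [layerSum_add_two (m + 1), mul_assoc _ _ (layerSum _ _ _ _), layerSum]
  refine congrArg _ ?_
  rw [← ENNReal.tsum_mul_left]
  refine tsum_congr fun ⟨l, hl, hm⟩ ↦ ?_
  have hb := hl.headD_bounds
  have hc := (listStat_snd_le hl).2 (by omega)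
  have hne : l.headD 0 ≠ l.length := fun h ↦ by
    rw [listStat_of_headD_eq h] at hm
    simp at hm
  have hs : (l.headD 0 - bound l).toNat = slack l + 1 := by
    rw [bound, slack]
    omega
  simp only
  rw [extensions_eq_sortedLists hl hne (by rw [bound]; omega) (by rw [bound]; omega),
    tsum_sortedLists, hs, weight]
  ring

lemma finite_validList (n : ℕ) : {l | ValidList l ∧ l.length = n}.Finite := by
  induction n with
  | zero =>
    refine (Set.finite_singleton []).subset fun l hl ↦ ?_
    simpa using hl.2
  | succ n ih =>
    refine (Set.Finite.image2 List.cons (Set.finite_Icc (-(n + 1 : ℤ)) (n + 1)) ih).subset ?_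
    rintro l ⟨hl, hn⟩
    rcases l with _ | ⟨u, l⟩
    · simp at hn
    · rw [validList_cons] at hl
      simp only [List.length_cons, Nat.add_right_cancel_iff] at hn
      exact ⟨u, ⟨by omega, by omega⟩, l, ⟨hl.1, hn⟩, rfl⟩

/-- The generating function of the ideals of class at most `h` is a finite sum. -/
theorem tsum_ncard_idealLists (h : ℕ) (x : ℝ≥0∞) :
    ∑' n, ((idealLists h n).ncard : ℝ≥0∞) * x ^ n =
      ∑ m ∈ Finset.range (h + 1), layerSum m x 1 1 + layerSum (h + 1) x 0 1 := by
  have h1 (n : ℕ) : ((idealLists h n).ncard : ℝ≥0∞) * x ^ n =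
      ∑' l : idealLists h n, x ^ l.1.length := by
    have hf : (idealLists h n).Finite :=
      (finite_validList n).subset fun l hl ↦ ⟨hl.1, hl.2.2⟩
    have h2 : ∀ l : idealLists h n, x ^ l.1.length = x ^ n := fun l ↦ by rw [l.2.2.2]
    simp only [h2, ENNReal.tsum_set_const]
    congr 1
    rw [← hf.cast_ncard_eq]
    simp
  -- Putting `A = 0` in the layer `h + 1` keeps exactly the lists whose second statistic vanishes.
  have h2 : ∀ l : List ℤ, ∑' n, (idealLists h n).indicator (fun l ↦ x ^ l.length) l =
      ∑ m ∈ Finset.range (h + 1), (layer m).indicator (weight x 1 1) l +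
        (layer (h + 1)).indicator (weight x 0 1) l := by
    intro l
    rw [tsum_eq_single l.length fun n hn ↦ Set.indicator_of_notMem (fun hl ↦ hn hl.2.2.symm) _]
    by_cases hl : ValidList l
    swap
    · rw [Set.indicator_of_notMem (fun h ↦ hl h.1), Set.indicator_of_notMem (fun h ↦ hl h.1),
        Finset.sum_eq_zero fun m _ ↦ Set.indicator_of_notMem (fun h ↦ hl h.1) _, add_zero]
    rcases lt_trichotomy (listStat l).1 (h + 1) with h3 | h3 | h3
    · rw [Set.indicator_of_mem (s := idealLists h _) ⟨hl, Or.inl (by omega), rfl⟩,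
        Set.indicator_of_notMem (fun h ↦ h3.ne h.2),
        Finset.sum_eq_single_of_mem (listStat l).1 (by simpa using h3)
          fun m _ hm ↦ Set.indicator_of_notMem (fun h ↦ hm h.2.symm) _,
        Set.indicator_of_mem (s := layer _) ⟨hl, rfl⟩]
      simp [weight]
    · rw [Set.indicator_of_mem (s := layer (h + 1)) ⟨hl, h3⟩, Finset.sum_eq_zero fun m hm ↦
        Set.indicator_of_notMem (fun h ↦ by rw [← h.2, h3] at hm; simp at hm) _, zero_add]
      by_cases hc : (listStat l).2 = 0
      · rw [Set.indicator_of_mem (s := idealLists h _) ⟨hl, Or.inr ⟨h3, hc⟩, rfl⟩, weight, hc]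
        simp
      · rw [Set.indicator_of_notMem (fun h' ↦ by have := h'.2.1; omega), weight, zero_pow hc]
        simp
    · rw [Set.indicator_of_notMem (fun h ↦ by have := h.2.1; omega),
        Set.indicator_of_notMem (fun h ↦ h3.ne' h.2), Finset.sum_eq_zero fun m hm ↦
        Set.indicator_of_notMem (fun h ↦ by rw [← h.2, Finset.mem_range] at hm; omega) _, zero_add]
  simp only [h1, layerSum]
  simp only [tsum_subtype _ (fun l : List ℤ ↦ x ^ l.length), tsum_subtype _ (weight x _ _)]
  rw [ENNReal.tsum_comm]
  simp only [h2]
  rw [ENNReal.tsum_add, Summable.tsum_finsetSum fun _ _ ↦ ENNReal.summable]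

end Sums

/-! ### Closed forms by linearising a Möbius map -/

section ClosedForms

open scoped ENNReal

/-- The parametrisation of `x` that makes the Chebyshev polynomials explicit. -/
noncomputable def paramX (q : ℝ) : ℝ := q / (1 + q) ^ 2

/-- The parametrisation of the other variables. -/
noncomputable def paramA (q α : ℝ) : ℝ := (1 + q) * (1 - α) / (1 - q * α)

variable {q α β : ℝ}

lemma one_sub_mul_pos (hq : 0 < q) (hq1 : q < 1) (h1 : α ≤ 1) : 0 < 1 - q * α := by
  nlinarith

lemma one_sub_mul_sq_pos (hq : 0 < q) (hq1 : q < 1) (h0 : 0 ≤ α) (h1 : α ≤ 1) :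
    0 < 1 - q * α ^ 2 :=
  one_sub_mul_pos hq hq1 (pow_le_one₀ h0 h1)

lemma paramX_pos (hq : 0 < q) : 0 < paramX q := by
  unfold paramX
  positivity

lemma paramA_nonneg (hq : 0 < q) (hq1 : q < 1) (h1 : α ≤ 1) : 0 ≤ paramA q α :=
  div_nonneg (mul_nonneg (by linarith) (by linarith)) (one_sub_mul_pos hq hq1 h1).le

lemma paramA_self (hq : 0 < q) (hq1 : q < 1) : paramA q q = 1 := by
  have h := one_sub_mul_pos hq hq1 hq1.le
  rw [paramA, div_eq_one_iff_eq h.ne']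
  ring

lemma paramA_one (q : ℝ) : paramA q 1 = 0 := by
  simp [paramA]

lemma one_sub_paramX_mul_paramA (hq : 0 < q) (hq1 : q < 1) (h1 : α ≤ 1) :
    1 - paramX q * paramA q α = (1 - q * (q * α)) / ((1 + q) * (1 - q * α)) := by
  have h := (one_sub_mul_pos hq hq1 h1).ne'
  rw [paramX, paramA]
  field_simp
  ring

lemma one_sub_two_mul (hq : 0 < q) (hq1 : q < 1) (h1 : α ≤ 1) :
    1 - 2 * (paramX q * paramA q α) =
      (1 - q) * (1 + q * α) / ((1 + q) * (1 - q * α)) := by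
  have h := (one_sub_mul_pos hq hq1 h1).ne'
  rw [paramX, paramA]
  field_simp
  ring

lemma one_sub_paramX_mul_sq (hq : 0 < q) (hq1 : q < 1) (h1 : α ≤ 1) :
    1 - paramX q * paramA q α ^ 2 = (1 - q) * (1 - q * α ^ 2) / (1 - q * α) ^ 2 := by
  have h := (one_sub_mul_pos hq hq1 h1).ne'
  rw [paramX, paramA]
  field_simp
  ring

lemma inv_one_sub_ofReal {y : ℝ} (h0 : 0 ≤ y) (h1 : y < 1) :
    (1 - ENNReal.ofReal y)⁻¹ = ENNReal.ofReal ((1 - y)⁻¹) := by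
  rw [ENNReal.ofReal_inv_of_pos (by linarith), ENNReal.ofReal_sub _ h0, ENNReal.ofReal_one]

lemma two_mul_lt_one (hq : 0 < q) (hq1 : q < 1) (h0 : 0 ≤ α) (h1 : α ≤ 1) :
    2 * (paramX q * paramA q α) < 1 := by
  have h := one_sub_mul_pos hq hq1 h1
  have h2 : 0 < 1 - 2 * (paramX q * paramA q α) := by
    rw [one_sub_two_mul hq hq1 h1]
    have : 0 < 1 - q := by linarith
    positivity
  linarith

lemma paramX_mul_paramA_nonneg (hq : 0 < q) (hq1 : q < 1) (h1 : α ≤ 1) :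
    0 ≤ paramX q * paramA q α :=
  mul_nonneg (paramX_pos hq).le (paramA_nonneg hq hq1 h1)

/-- The map `A ↦ (1 - x * A)⁻¹` has the fixed points `1 + q` and `(1 + q) / q`. The coordinate `α`
sends them to `0` and infinity, so that the map becomes `α ↦ q * α`. -/
lemma inv_one_sub_mul_paramA (hq : 0 < q) (hq1 : q < 1) (h0 : 0 ≤ α) (h1 : α ≤ 1) :
    (1 - ENNReal.ofReal (paramX q) * ENNReal.ofReal (paramA q α))⁻¹ =
      ENNReal.ofReal (paramA q (q * α)) := by
  have h := one_sub_mul_pos hq hq1 h1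
  have h2 := two_mul_lt_one hq hq1 h0 h1
  have h3 := paramX_mul_paramA_nonneg hq hq1 h1
  rw [← ENNReal.ofReal_mul (paramX_pos hq).le, inv_one_sub_ofReal h3 (by linarith),
    one_sub_paramX_mul_paramA hq hq1 h1, inv_div, paramA]

lemma inv_one_sub_mul_paramA_sq (hq : 0 < q) (hq1 : q < 1) (h0 : 0 ≤ α) (h1 : α ≤ 1) :
    (1 - ENNReal.ofReal (paramX q) * ENNReal.ofReal (paramA q α) ^ 2)⁻¹ =
      ENNReal.ofReal ((1 - q * α) ^ 2 / ((1 - q) * (1 - q * α ^ 2))) := by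
  have h := one_sub_mul_pos hq hq1 h1
  have h2 := one_sub_mul_sq_pos hq hq1 h0 h1
  have h3 := one_sub_paramX_mul_sq hq hq1 h1
  have h4 : 0 < 1 - paramX q * paramA q α ^ 2 := by
    rw [h3]
    have : 0 < 1 - q := by linarith
    positivity
  rw [← ENNReal.ofReal_pow (paramA_nonneg hq hq1 h1), ← ENNReal.ofReal_mul (paramX_pos hq).le,
    inv_one_sub_ofReal (mul_nonneg (paramX_pos hq).le (sq_nonneg _)) (by linarith), h3, inv_div]

lemma inv_one_sub_mul_inv (hq : 0 < q) (hq1 : q < 1) (h0 : 0 ≤ α) (h1 : α ≤ 1) :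
    (1 - ENNReal.ofReal (paramX q) * ENNReal.ofReal (paramA q α) *
      ENNReal.ofReal (paramA q (q * α)))⁻¹ =
      ENNReal.ofReal ((1 - q * (q * α)) / ((1 - q) * (1 + q * α))) := by
  have hq2 : 0 < 1 - q := by linarith
  have h := one_sub_mul_pos hq hq1 h1
  have hα : q * α ≤ 1 := by linarith
  have h' := one_sub_mul_pos hq hq1 hα
  have h3 : 1 - paramX q * paramA q α * paramA q (q * α) =
      (1 - q) * (1 + q * α) / (1 - q * (q * α)) := by
    have h2 : 1 - q ^ 2 * α ≠ 0 := by
      convert h'.ne' using 1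
      ring
    rw [paramX, paramA, paramA]
    field_simp
    ring
  have h4 : 0 < 1 - paramX q * paramA q α * paramA q (q * α) := by
    rw [h3]
    positivity
  have h5 := paramX_mul_paramA_nonneg hq hq1 h1
  have h6 := paramA_nonneg hq hq1 hα
  rw [← ENNReal.ofReal_mul (paramX_pos hq).le, ← ENNReal.ofReal_mul h5,
    inv_one_sub_ofReal (mul_nonneg h5 h6) (by linarith), h3, inv_div]

/-- `layerSum` in terms of the parametrisation. -/
noncomputable def layerParam (m : ℕ) (q α β : ℝ) : ℝ≥0∞ :=
  layerSum m (ENNReal.ofReal (paramX q)) (ENNReal.ofReal (paramA q α))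
    (ENNReal.ofReal (paramA q β))

lemma layerParam_zero (hq : 0 < q) (hq1 : q < 1) (h0 : 0 ≤ α) (h1 : α ≤ 1) :
    layerParam 0 q α β = ENNReal.ofReal ((1 - q * α) ^ 2 / ((1 - q) * (1 - q * α ^ 2))) := by
  rw [layerParam, layerSum_zero, inv_one_sub_mul_paramA_sq hq hq1 h0 h1]

lemma layerParam_add_three (hq : 0 < q) (hq1 : q < 1) (h0 : 0 ≤ α) (h1 : α ≤ 1) (h0' : 0 ≤ β)
    (h1' : β ≤ 1) (m : ℕ) : layerParam (m + 3) q α β =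
      ENNReal.ofReal (q * (1 - q * α) * (1 - q * β) /
        ((1 - q * (q * α)) * (1 - q * (q * β)))) * layerParam (m + 1) q (q * α) (q * β) := by
  have h := one_sub_mul_pos hq hq1 h1
  have h' := one_sub_mul_pos hq hq1 h1'
  have hα : q * α ≤ 1 := by linarith
  have hβ : q * β ≤ 1 := by linarith
  have h2 := one_sub_mul_pos hq hq1 hα
  have h2' := one_sub_mul_pos hq hq1 hβ
  have h3 := paramA_nonneg hq hq1 hα
  rw [layerParam, layerSum_add_three, inv_one_sub_mul_paramA hq hq1 h0 h1,
    inv_one_sub_mul_paramA hq hq1 h0' h1', layerParam, ← ENNReal.ofReal_mul (paramX_pos hq).le,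
    ← ENNReal.ofReal_mul (paramX_mul_paramA_nonneg hq hq1 hα)]
  congr 2
  rw [paramX, paramA, paramA]
  field_simp

lemma layerParam_one (hq : 0 < q) (hq1 : q < 1) (h0 : 0 ≤ α) (h1 : α ≤ 1) (h0' : 0 ≤ β)
    (h1' : β ≤ 1) : layerParam 1 q α β =
      ENNReal.ofReal (q ^ 2 * (1 - α) * (1 - β) * (1 - q * β) /
        ((1 + q) * (1 - q) ^ 2 * (1 - q * β ^ 2) * (1 + q * α))) := by
  have hq2 : 0 < 1 - q := by linarith
  have h := one_sub_mul_pos hq hq1 h1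
  have h' := one_sub_mul_pos hq hq1 h1'
  have hs := one_sub_mul_sq_pos hq hq1 h0' h1'
  have hα : q * α ≤ 1 := by linarith
  have h2 := one_sub_mul_pos hq hq1 hα
  have h3 := paramA_nonneg hq hq1 hα
  have h4 := paramX_mul_paramA_nonneg hq hq1 h1
  have h5 := paramX_mul_paramA_nonneg hq hq1 h1'
  rw [layerParam, layerSum_one, inv_one_sub_mul_paramA hq hq1 h0 h1,
    inv_one_sub_mul_paramA_sq hq hq1 h0' h1', inv_one_sub_mul_inv hq hq1 h0 h1]
  rw [← ENNReal.ofReal_mul (paramX_pos hq).le, ← ENNReal.ofReal_mul (paramX_pos hq).le,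
    ← ENNReal.ofReal_mul h5, ← ENNReal.ofReal_mul h4, ← ENNReal.ofReal_mul (mul_nonneg h4 h3),
    ← ENNReal.ofReal_mul (mul_nonneg h5 (by positivity))]
  congr 1
  have h2' : 1 - q ^ 2 * α ≠ 0 := by
    convert h2.ne' using 1
    ring
  rw [paramX, paramA, paramA, paramA]
  have hp : 0 < 1 + q * α := by positivity
  field_simp

lemma layerParam_two (hq : 0 < q) (hq1 : q < 1) (h0 : 0 ≤ α) (h1 : α ≤ 1) (h0' : 0 ≤ β)
    (h1' : β ≤ 1) : layerParam 2 q α β =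
      ENNReal.ofReal (q * (1 - q * α) * (1 - q * (q * α)) * (1 - q * (q * β)) /
        ((1 + q) * (1 - q) ^ 2 * (1 - q * (q * α) ^ 2) * (1 + q * β))) := by
  have hq2 : 0 < 1 - q := by linarith
  have hα0 : 0 ≤ q * α := by positivity
  have h := one_sub_mul_pos hq hq1 h1
  have h' := one_sub_mul_pos hq hq1 h1'
  have hα : q * α ≤ 1 := by linarith
  have hβ : q * β ≤ 1 := by linarith
  have h2 := one_sub_mul_pos hq hq1 hα
  have h2' := one_sub_mul_pos hq hq1 hβ
  have hs := one_sub_mul_sq_pos hq hq1 hα0 hα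
  have h4 := paramX_mul_paramA_nonneg hq hq1 hα
  rw [layerParam, layerSum_two, inv_one_sub_mul_paramA hq hq1 h0 h1,
    inv_one_sub_mul_paramA_sq hq hq1 hα0 hα, inv_one_sub_mul_paramA hq hq1 h0' h1',
    inv_one_sub_mul_inv hq hq1 h0' h1', ← ENNReal.ofReal_mul (paramX_pos hq).le,
    ← ENNReal.ofReal_mul h4, ← ENNReal.ofReal_mul (mul_nonneg h4 (by positivity))]
  congr 1
  rw [paramX, paramA]
  have hp : 0 < 1 + q * β := by positivity
  field_simp

/-- The factors of `layerParam_add_three` telescope along `α, q * α, q ^ 2 * α, …`. The factor `1 +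
q * α` in the initial case is completed to `1 - q ^ 2 * α ^ 2` to obtain a uniform shape. -/
lemma layerParam_odd (hq : 0 < q) (hq1 : q < 1) (r : ℕ) : ∀ {α β : ℝ}, 0 ≤ α → α ≤ 1 → 0 ≤ β →
    β ≤ 1 → layerParam (2 * r + 1) q α β =
      ENNReal.ofReal (q ^ (r + 2) * (1 - q * α) * (1 - q * β) * (1 - q ^ r * α) * (1 - q ^ r * β) /
        ((1 + q) * (1 - q) ^ 2 * (1 - q ^ (2 * r + 2) * α ^ 2) *
          (1 - q ^ (2 * r + 1) * β ^ 2))) := by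
  induction r with
  | zero =>
    intro α β h0 h1 h0' h1'
    rw [layerParam_one hq hq1 h0 h1 h0' h1']
    congr 1
    have hq2 : 0 < 1 - q := by linarith
    have h := one_sub_mul_pos hq hq1 h1
    have hs := one_sub_mul_sq_pos hq hq1 h0' h1'
    have hp : 0 < 1 + q * α := by positivity
    have e : 1 - q ^ 2 * α ^ 2 = (1 - q * α) * (1 + q * α) := by ring
    simp only [mul_zero, zero_add, pow_zero, one_mul, pow_one]
    rw [e]
    field_simp
  | succ r ih =>
    intro α β h0 h1 h0' h1'
    have h := one_sub_mul_pos hq hq1 h1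
    have h' := one_sub_mul_pos hq hq1 h1'
    have hα : q * α ≤ 1 := by linarith
    have hβ : q * β ≤ 1 := by linarith
    have h2 := one_sub_mul_pos hq hq1 hα
    have h2' := one_sub_mul_pos hq hq1 hβ
    rw [show 2 * (r + 1) + 1 = 2 * r + 3 by ring, layerParam_add_three hq hq1 h0 h1 h0' h1',
      ih (by positivity) hα (by positivity) hβ, ← ENNReal.ofReal_mul (by positivity)]
    congr 1
    have e : 1 - q ^ (2 * r + 2) * (q * α) ^ 2 = 1 - q ^ (2 * (r + 1) + 2) * α ^ 2 := by ring
    have e' : 1 - q ^ (2 * r + 1) * (q * β) ^ 2 = 1 - q ^ (2 * (r + 1) + 1) * β ^ 2 := by ring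
    rw [e, e', div_mul_div_comm]
    conv_rhs => rw [← mul_div_mul_left _ _ (mul_pos h2 h2').ne']
    congr 1
    ring

lemma layerParam_even (hq : 0 < q) (hq1 : q < 1) (r : ℕ) : ∀ {α β : ℝ}, 0 ≤ α → α ≤ 1 → 0 ≤ β →
    β ≤ 1 → layerParam (2 * r + 2) q α β =
      ENNReal.ofReal (q ^ (r + 1) * (1 - q * α) * (1 - q * β) * (1 - q ^ (r + 2) * α) *
          (1 - q ^ (r + 2) * β) /
        ((1 + q) * (1 - q) ^ 2 * (1 - q ^ (2 * r + 3) * α ^ 2) *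
          (1 - q ^ (2 * r + 2) * β ^ 2))) := by
  induction r with
  | zero =>
    intro α β h0 h1 h0' h1'
    rw [layerParam_two hq hq1 h0 h1 h0' h1']
    congr 1
    have hq2 : 0 < 1 - q := by linarith
    have h := one_sub_mul_pos hq hq1 h1'
    have hα : q * α ≤ 1 := by have := one_sub_mul_pos hq hq1 h1; linarith
    have hs := one_sub_mul_sq_pos hq hq1 (by positivity) hα
    have hp : 0 < 1 + q * β := by positivity
    have e : 1 - q ^ 2 * β ^ 2 = (1 - q * β) * (1 + q * β) := by ring
    have e' : 1 - q ^ 3 * α ^ 2 = 1 - q * (q * α) ^ 2 := by ring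
    simp only [mul_zero, zero_add, pow_one]
    rw [e, e']
    conv_lhs => rw [← mul_div_mul_left _ _ h.ne']
    congr 1 <;> ring
  | succ r ih =>
    intro α β h0 h1 h0' h1'
    have h := one_sub_mul_pos hq hq1 h1
    have h' := one_sub_mul_pos hq hq1 h1'
    have hα : q * α ≤ 1 := by linarith
    have hβ : q * β ≤ 1 := by linarith
    have h2 := one_sub_mul_pos hq hq1 hα
    have h2' := one_sub_mul_pos hq hq1 hβ
    rw [show 2 * (r + 1) + 2 = (2 * r + 1) + 3 by ring, layerParam_add_three hq hq1 h0 h1 h0' h1',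
      ih (by positivity) hα (by positivity) hβ, ← ENNReal.ofReal_mul (by positivity)]
    congr 1
    have e : 1 - q ^ (2 * r + 3) * (q * α) ^ 2 = 1 - q ^ (2 * (r + 1) + 3) * α ^ 2 := by ring
    have e' : 1 - q ^ (2 * r + 2) * (q * β) ^ 2 = 1 - q ^ (2 * r + 1 + 3) * β ^ 2 := by ring
    rw [e, e', div_mul_div_comm]
    conv_rhs => rw [← mul_div_mul_left _ _ (mul_pos h2 h2').ne']
    congr 1
    ring

end ClosedForms

/-! ### Summation over the layers -/

section Totals

open scoped ENNReal

/-- The closed form of `(1 - q) ^ 2 * evenSum q r`, in terms of `Q = q ^ r`. -/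
noncomputable def evenNum (q Q r : ℝ) : ℝ :=
  2 * Q * q ^ 2 * (Q * q - (r + 1) * q + r) + (1 - q) * Q * q ^ 2 * (1 - Q)
    - Q ^ 2 * q ^ 2 * (2 * (q - (r + 1) * Q * q + r * Q * q ^ 2) + (1 - q) * (q - Q * q))
    + (1 - q) ^ 2 * (2 * r + 1) * (Q * q - Q ^ 3 * q ^ 3)
    + 2 * (q - (r + 1) * Q * q + r * Q * q ^ 2) - 2 * Q ^ 3 * q ^ 4 * (Q * q - (r + 1) * q + r)

/-- The closed form of `(1 - q) ^ 2 * oddSum q r`, in terms of `Q = q ^ r`. -/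
noncomputable def oddNum (q Q r : ℝ) : ℝ :=
  2 * Q * q ^ 3 * (Q * q - (r + 1) * q + r) + (1 - q) * Q * q ^ 3 * (1 - Q)
    - Q ^ 2 * q ^ 3 * (2 * (q - (r + 1) * Q * q + r * Q * q ^ 2) + (1 - q) * (q - Q * q))
    + (1 - q) ^ 2 * (2 * r + 2) * (Q * q ^ 2 - Q ^ 3 * q ^ 4)
    + 2 * (q - (r + 2) * Q * q ^ 2 + (r + 1) * Q * q ^ 3)
    - 2 * Q ^ 3 * q ^ 5 * (Q * q ^ 2 - (r + 2) * q + (r + 1))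

/-- Induction step from class `2r` to `2r + 1`, with `Q = q ^ r`: the subtracted terms are the
layers at `A = 0`, the added one is the full layer `2r + 1`. -/
lemma evenNum_add_oddLayer {q Q : ℝ} (r : ℝ) (h1 : 1 - q ≠ 0) (h2 : 1 - Q ^ 2 * q ^ 2 ≠ 0)
    (h3 : 1 - Q ^ 2 * q ^ 3 ≠ 0) (h4 : 1 - Q ^ 2 * q ^ 4 ≠ 0) :
    1 + evenNum q Q r / ((1 - q) * ((1 - Q ^ 2 * q ^ 2) * (1 - Q ^ 2 * q ^ 3)))
        - Q * q ^ 2 * (1 - Q) * (1 - Q * q) / ((1 - Q ^ 2 * q ^ 2) * (1 - Q ^ 2 * q ^ 3))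
        + (1 + q) * Q * q ^ 2 * (1 - Q * q) ^ 2 / ((1 - Q ^ 2 * q ^ 3) * (1 - Q ^ 2 * q ^ 4)) =
      1 + oddNum q Q r / ((1 - q) * ((1 - Q ^ 2 * q ^ 3) * (1 - Q ^ 2 * q ^ 4)))
        - Q * q * (1 - Q * q ^ 2) * (1 - Q * q ^ 3) /
          ((1 - Q ^ 2 * q ^ 3) * (1 - Q ^ 2 * q ^ 4)) := by
  rw [evenNum, oddNum]
  -- The denominators become atoms, so that clearing them does not expand anything; they are
  -- restored for the polynomial identity.
  generalize hA : 1 - Q ^ 2 * q ^ 2 = A at *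
  generalize hB : 1 - Q ^ 2 * q ^ 3 = B at *
  generalize hC : 1 - Q ^ 2 * q ^ 4 = C at *
  generalize hD : 1 - q = D at *
  field_simp
  rw [← hA, ← hB, ← hC, ← hD]
  ring

lemma oddNum_add_evenLayer {q Q : ℝ} (r : ℝ) (h1 : 1 - q ≠ 0) (h2 : 1 - Q ^ 2 * q ^ 3 ≠ 0)
    (h3 : 1 - Q ^ 2 * q ^ 4 ≠ 0) (h4 : 1 - Q ^ 2 * q ^ 5 ≠ 0) :
    1 + oddNum q Q r / ((1 - q) * ((1 - Q ^ 2 * q ^ 3) * (1 - Q ^ 2 * q ^ 4)))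
        - Q * q * (1 - Q * q ^ 2) * (1 - Q * q ^ 3) / ((1 - Q ^ 2 * q ^ 3) * (1 - Q ^ 2 * q ^ 4))
        + (1 + q) * Q * q * (1 - Q * q ^ 3) ^ 2 / ((1 - Q ^ 2 * q ^ 4) * (1 - Q ^ 2 * q ^ 5)) =
      1 + evenNum q (Q * q) (r + 1) / ((1 - q) * ((1 - Q ^ 2 * q ^ 4) * (1 - Q ^ 2 * q ^ 5)))
        - Q * q ^ 3 * (1 - Q * q) * (1 - Q * q ^ 2) /
          ((1 - Q ^ 2 * q ^ 4) * (1 - Q ^ 2 * q ^ 5)) := by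
  rw [evenNum, oddNum]
  generalize hA : 1 - Q ^ 2 * q ^ 3 = A at *
  generalize hB : 1 - Q ^ 2 * q ^ 4 = B at *
  generalize hC : 1 - Q ^ 2 * q ^ 5 = C at *
  generalize hD : 1 - q = D at *
  field_simp
  rw [← hA, ← hB, ← hC, ← hD]
  ring

lemma sum_mul_pow (q : ℝ) (r : ℕ) : (1 - q) ^ 2 * ∑ i ∈ Finset.Icc 1 r, (i : ℝ) * q ^ i =
    q - (r + 1) * q ^ (r + 1) + r * q ^ (r + 2) := by
  induction r with
  | zero => simp
  | succ r ih =>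
    rw [Finset.sum_Icc_succ_top (by omega), mul_add, ih]
    push_cast
    ring

lemma sum_pow (q : ℝ) (r : ℕ) : (1 - q) * ∑ i ∈ Finset.Icc 1 r, q ^ i = q - q ^ (r + 1) := by
  induction r with
  | zero => simp
  | succ r ih =>
    rw [Finset.sum_Icc_succ_top (by omega), mul_add, ih]
    ring

lemma sum_mul_pow_sub (q : ℝ) (r : ℕ) : ∀ s, (1 - q) ^ 2 *
    ∑ i ∈ Finset.Icc 1 r, (i : ℝ) * q ^ (s + r - i) = q ^ s * (q ^ (r + 1) - (r + 1) * q + r) := by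
  induction r with
  | zero => simp
  | succ r ih =>
    intro s
    rw [Finset.sum_Icc_succ_top (by omega), mul_add, ← add_assoc, add_right_comm, ih,
      show s + 1 + r - (r + 1) = s by omega]
    push_cast
    ring

lemma sum_pow_sub (q : ℝ) (r : ℕ) : ∀ s, (1 - q) *
    ∑ i ∈ Finset.Icc 1 r, q ^ (s + r - i) = q ^ s * (1 - q ^ r) := by
  induction r with
  | zero => simp
  | succ r ih =>
    intro s
    rw [Finset.sum_Icc_succ_top (by omega), mul_add, ← add_assoc, add_right_comm, ih,
      show s + 1 + r - (r + 1) = s by omega]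
    ring

/-- The numerator of the generating function for class at most `2r`, as a function of `q`. -/
noncomputable def evenSum (q : ℝ) (r : ℕ) : ℝ :=
  ∑ i ∈ Finset.Icc 1 r, (2 * (i : ℝ) + 1) * (q ^ (2 * r + 2 - i) - q ^ (2 * r + 2 + i))
    + (2 * r + 1) * (q ^ (r + 1) - q ^ (3 * r + 3))
    + ∑ i ∈ Finset.Icc 1 r, 2 * (i : ℝ) * (q ^ i - q ^ (4 * r + 4 - i))

/-- The numerator of the generating function for class at most `2r+1`, as a function of `q`. -/
noncomputable def oddSum (q : ℝ) (r : ℕ) : ℝ :=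
  ∑ i ∈ Finset.Icc 1 r, (2 * (i : ℝ) + 1) * (q ^ (2 * r + 3 - i) - q ^ (2 * r + 3 + i))
    + (2 * r + 2) * (q ^ (r + 2) - q ^ (3 * r + 4))
    + ∑ i ∈ Finset.Icc 1 (r + 1), 2 * (i : ℝ) * (q ^ i - q ^ (4 * r + 6 - i))

lemma sum_odd_coeff (q : ℝ) (r s : ℕ) :
    (1 - q) ^ 2 * ∑ i ∈ Finset.Icc 1 r, (2 * (i : ℝ) + 1) * (q ^ (s + r - i) - q ^ (s + r + i)) =
      2 * (q ^ s * (q ^ (r + 1) - (r + 1) * q + r)) + (1 - q) * (q ^ s * (1 - q ^ r)) -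
        q ^ (s + r) * (2 * (q - (r + 1) * q ^ (r + 1) + r * q ^ (r + 2)) +
          (1 - q) * (q - q ^ (r + 1))) := by
  rw [← sum_mul_pow_sub, ← sum_pow_sub, ← sum_mul_pow, ← sum_pow]
  simp only [Finset.mul_sum, ← Finset.sum_add_distrib, ← Finset.sum_sub_distrib]
  exact Finset.sum_congr rfl fun i _ ↦ by ring

lemma sum_even_coeff (q : ℝ) (r s : ℕ) :
    (1 - q) ^ 2 * ∑ i ∈ Finset.Icc 1 r, 2 * (i : ℝ) * (q ^ i - q ^ (s + r - i)) =
      2 * (q - (r + 1) * q ^ (r + 1) + r * q ^ (r + 2)) -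
        2 * (q ^ s * (q ^ (r + 1) - (r + 1) * q + r)) := by
  rw [← sum_mul_pow_sub, ← sum_mul_pow]
  simp only [Finset.mul_sum, ← Finset.sum_sub_distrib]
  exact Finset.sum_congr rfl fun i _ ↦ by ring

lemma mul_evenSum (q : ℝ) (r : ℕ) : (1 - q) ^ 2 * evenSum q r = evenNum q (q ^ r) r := by
  have h1 := sum_odd_coeff q r (r + 2)
  have h2 := sum_even_coeff q r (3 * r + 4)
  rw [show r + 2 + r = 2 * r + 2 by ring] at h1
  rw [show 3 * r + 4 + r = 4 * r + 4 by ring] at h2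
  rw [evenSum, mul_add, mul_add, h1, h2, evenNum]
  ring

lemma mul_oddSum (q : ℝ) (r : ℕ) : (1 - q) ^ 2 * oddSum q r = oddNum q (q ^ r) r := by
  have h1 := sum_odd_coeff q r (r + 3)
  have h2 := sum_even_coeff q (r + 1) (3 * r + 5)
  rw [show r + 3 + r = 2 * r + 3 by ring] at h1
  rw [show 3 * r + 5 + (r + 1) = 4 * r + 6 by ring] at h2
  rw [oddSum, mul_add, mul_add, h1, h2, oddNum]
  push_cast
  ring

variable {q : ℝ}

lemma one_sub_pow_pos (hq : 0 < q) (hq1 : q < 1) {k : ℕ} (hk : k ≠ 0) : 0 < 1 - q ^ k := by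
  linarith [pow_lt_one₀ hq.le hq1 hk]

lemma layerParam_self_zero (hq : 0 < q) (hq1 : q < 1) :
    layerParam 0 q q q = ENNReal.ofReal ((1 - q ^ 2) ^ 2 / ((1 - q) * (1 - q ^ 3))) := by
  rw [layerParam_zero hq hq1 hq.le hq1.le]
  congr 1
  congr 1 <;> ring

lemma layerParam_self_odd (hq : 0 < q) (hq1 : q < 1) (r : ℕ) :
    layerParam (2 * r + 1) q q q = ENNReal.ofReal ((1 + q) * q ^ (r + 2) * (1 - q ^ (r + 1)) ^ 2 /
      ((1 - q ^ (2 * r + 3)) * (1 - q ^ (2 * r + 4)))) := by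
  rw [layerParam_odd hq hq1 r hq.le hq1.le hq.le hq1.le]
  congr 1
  have h : (1 + q) * (1 - q) ^ 2 ≠ 0 := by
    have : 0 < 1 - q := by linarith
    positivity
  conv_rhs => rw [← mul_div_mul_left _ _ h]
  congr 1 <;> ring

lemma layerParam_self_even (hq : 0 < q) (hq1 : q < 1) (r : ℕ) :
    layerParam (2 * r + 2) q q q = ENNReal.ofReal ((1 + q) * q ^ (r + 1) * (1 - q ^ (r + 3)) ^ 2 /
      ((1 - q ^ (2 * r + 4)) * (1 - q ^ (2 * r + 5)))) := by
  rw [layerParam_even hq hq1 r hq.le hq1.le hq.le hq1.le]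
  congr 1
  have h : (1 + q) * (1 - q) ^ 2 ≠ 0 := by
    have : 0 < 1 - q := by linarith
    positivity
  conv_rhs => rw [← mul_div_mul_left _ _ h]
  congr 1 <;> ring

lemma layerParam_one_odd (hq : 0 < q) (hq1 : q < 1) (r : ℕ) :
    layerParam (2 * r + 1) q 1 q = ENNReal.ofReal (q ^ (r + 2) * (1 - q ^ r) * (1 - q ^ (r + 1)) /
      ((1 - q ^ (2 * r + 2)) * (1 - q ^ (2 * r + 3)))) := by
  rw [layerParam_odd hq hq1 r zero_le_one le_rfl hq.le hq1.le]
  congr 1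
  have h : (1 + q) * (1 - q) ^ 2 ≠ 0 := by
    have : 0 < 1 - q := by linarith
    positivity
  conv_rhs => rw [← mul_div_mul_left _ _ h]
  congr 1 <;> ring

lemma layerParam_one_even (hq : 0 < q) (hq1 : q < 1) (r : ℕ) :
    layerParam (2 * r + 2) q 1 q =
      ENNReal.ofReal (q ^ (r + 1) * (1 - q ^ (r + 2)) * (1 - q ^ (r + 3)) /
        ((1 - q ^ (2 * r + 3)) * (1 - q ^ (2 * r + 4)))) := by
  rw [layerParam_even hq hq1 r zero_le_one le_rfl hq.le hq1.le]
  congr 1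
  have h : (1 + q) * (1 - q) ^ 2 ≠ 0 := by
    have : 0 < 1 - q := by linarith
    positivity
  conv_rhs => rw [← mul_div_mul_left _ _ h]
  congr 1 <;> ring

lemma layerParam_self_ne_top (hq : 0 < q) (hq1 : q < 1) (m : ℕ) : layerParam m q q q ≠ ⊤ := by
  rcases Nat.even_or_odd' m with ⟨r, rfl | rfl⟩
  · rcases r with _ | r
    · rw [mul_zero, layerParam_self_zero hq hq1]
      exact ENNReal.ofReal_ne_top
    · rw [mul_add, mul_one, layerParam_self_even hq hq1]
      exact ENNReal.ofReal_ne_top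
  · rw [layerParam_self_odd hq hq1]
    exact ENNReal.ofReal_ne_top

lemma one_sub_pow_nonneg (hq : 0 < q) (hq1 : q < 1) (k : ℕ) : 0 ≤ 1 - q ^ k := by
  linarith [pow_le_one₀ hq.le hq1.le (n := k)]

lemma one_sub_sq_mul_pow_ne_zero (hq : 0 < q) (hq1 : q < 1) (r : ℕ) {k : ℕ} (hk : k ≠ 0) :
    1 - (q ^ r) ^ 2 * q ^ k ≠ 0 := by
  rw [← pow_mul, ← pow_add]
  exact (one_sub_pow_pos hq hq1 (by omega)).ne'

lemma sum_layerParam_odd_of_even (hq : 0 < q) (hq1 : q < 1) {r : ℕ}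
    (h : ∑ m ∈ Finset.range (2 * r + 1), (layerParam m q q q).toReal =
      1 + evenNum q (q ^ r) r / ((1 - q) * ((1 - q ^ (2 * r + 2)) * (1 - q ^ (2 * r + 3))))
        - (layerParam (2 * r + 1) q 1 q).toReal) :
    ∑ m ∈ Finset.range (2 * r + 2), (layerParam m q q q).toReal =
      1 + oddNum q (q ^ r) r / ((1 - q) * ((1 - q ^ (2 * r + 3)) * (1 - q ^ (2 * r + 4))))
        - (layerParam (2 * r + 2) q 1 q).toReal := by
  have hq2 : 0 < 1 - q := by linarith
  have e (k : ℕ) : q ^ (2 * r + k) = (q ^ r) ^ 2 * q ^ k := by ring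
  have hle := one_sub_pow_nonneg hq hq1
  rw [Finset.sum_range_succ, h, layerParam_one_odd hq hq1, layerParam_self_odd hq hq1,
    layerParam_one_even hq hq1, ENNReal.toReal_ofReal, ENNReal.toReal_ofReal,
    ENNReal.toReal_ofReal]
  · simp only [e]
    have hne {k : ℕ} (hk : k ≠ 0) := one_sub_sq_mul_pow_ne_zero hq hq1 r hk
    convert evenNum_add_oddLayer r hq2.ne' (hne two_ne_zero) (hne three_ne_zero)
      (hne four_ne_zero) using 3 <;> ring
  all_goals
    have h1 := hle r
    have h2 := hle (r + 1)
    have h3 := hle (r + 2)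
    have h4 := hle (r + 3)
    have h5 := hle (2 * r + 2)
    have h6 := hle (2 * r + 3)
    have h7 := hle (2 * r + 4)
    positivity

lemma sum_layerParam_even_of_odd (hq : 0 < q) (hq1 : q < 1) {r : ℕ}
    (h : ∑ m ∈ Finset.range (2 * r + 2), (layerParam m q q q).toReal =
      1 + oddNum q (q ^ r) r / ((1 - q) * ((1 - q ^ (2 * r + 3)) * (1 - q ^ (2 * r + 4))))
        - (layerParam (2 * r + 2) q 1 q).toReal) :
    ∑ m ∈ Finset.range (2 * r + 3), (layerParam m q q q).toReal =
      1 + evenNum q (q ^ (r + 1)) (r + 1) /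
          ((1 - q) * ((1 - q ^ (2 * r + 4)) * (1 - q ^ (2 * r + 5))))
        - (layerParam (2 * r + 3) q 1 q).toReal := by
  have hq2 : 0 < 1 - q := by linarith
  have e (k : ℕ) : q ^ (2 * r + k) = (q ^ r) ^ 2 * q ^ k := by ring
  have hle := one_sub_pow_nonneg hq hq1
  rw [Finset.sum_range_succ, h, layerParam_one_even hq hq1, layerParam_self_even hq hq1,
    show 2 * r + 3 = 2 * (r + 1) + 1 by ring, layerParam_one_odd hq hq1, ENNReal.toReal_ofReal,
    ENNReal.toReal_ofReal, ENNReal.toReal_ofReal, show 2 * (r + 1) + 1 = 2 * r + 3 by ring,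
    show 2 * (r + 1) + 2 = 2 * r + 4 by ring, show 2 * (r + 1) + 3 = 2 * r + 5 by ring]
  · simp only [e, pow_succ q r]
    have hne {k : ℕ} (hk : k ≠ 0) := one_sub_sq_mul_pow_ne_zero hq hq1 r hk
    convert oddNum_add_evenLayer r hq2.ne' (hne three_ne_zero) (hne four_ne_zero)
      (hne (by norm_num : 5 ≠ 0)) using 3 <;> ring
  all_goals
    have h1 := hle (r + 1)
    have h2 := hle (r + 1 + 1)
    have h3 := hle (r + 2)
    have h4 := hle (r + 3)
    have h5 := hle (2 * r + 3)
    have h6 := hle (2 * r + 4)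
    have h7 := hle (2 * r + 5)
    have h8 := hle (2 * (r + 1) + 2)
    have h9 := hle (2 * (r + 1) + 3)
    positivity

lemma sum_layerParam_even (hq : 0 < q) (hq1 : q < 1) (r : ℕ) :
    ∑ m ∈ Finset.range (2 * r + 1), (layerParam m q q q).toReal =
      1 + evenNum q (q ^ r) r / ((1 - q) * ((1 - q ^ (2 * r + 2)) * (1 - q ^ (2 * r + 3))))
        - (layerParam (2 * r + 1) q 1 q).toReal := by
  induction r with
  | zero =>
    have h1 := one_sub_pow_pos hq hq1 one_ne_zero
    have h2 := one_sub_pow_pos hq hq1 two_ne_zero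
    have h3 := one_sub_pow_pos hq hq1 three_ne_zero
    rw [pow_one] at h1
    rw [mul_zero, zero_add, Finset.sum_range_one, layerParam_self_zero hq hq1,
      show 1 = 2 * 0 + 1 by rfl, layerParam_one_odd hq hq1, ENNReal.toReal_ofReal (by positivity)]
    simp only [mul_zero, zero_add, pow_zero, sub_self, zero_mul, zero_div, ENNReal.ofReal_zero,
      ENNReal.toReal_zero, sub_zero, Nat.cast_zero, evenNum]
    field_simp
    ring
  | succ r ih =>
    rw [Nat.cast_succ]
    exact sum_layerParam_even_of_odd hq hq1 (sum_layerParam_odd_of_even hq hq1 ih)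

/-- The generating function of the ideals of class at most `h`. -/
theorem hasSum_of_toReal (hq : 0 < q) (hq1 : q < 1) {h : ℕ} {V : ℝ}
    (hV : ∑ m ∈ Finset.range (h + 1), (layerParam m q q q).toReal =
      V - (layerParam (h + 1) q 1 q).toReal) :
    HasSum (fun n ↦ ((idealLists h n).ncard : ℝ) * paramX q ^ n) V := by
  have h1 := tsum_ncard_idealLists h (ENNReal.ofReal (paramX q))
  have hF (m : ℕ) : layerSum m (ENNReal.ofReal (paramX q)) 1 1 = layerParam m q q q := by
    rw [layerParam, paramA_self hq hq1, ENNReal.ofReal_one]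
  have hE (m : ℕ) : layerSum m (ENNReal.ofReal (paramX q)) 0 1 = layerParam m q 1 q := by
    rw [layerParam, paramA_self hq hq1, paramA_one, ENNReal.ofReal_one, ENNReal.ofReal_zero]
  have hEtop (m : ℕ) : layerParam (m + 1) q 1 q ≠ ⊤ := by
    rcases Nat.even_or_odd' m with ⟨r, rfl | rfl⟩
    · rw [layerParam_one_odd hq hq1]
      exact ENNReal.ofReal_ne_top
    · rw [layerParam_one_even hq hq1]
      exact ENNReal.ofReal_ne_top
  simp only [hF, hE] at h1
  have hF' : ∀ m ∈ Finset.range (h + 1), layerParam m q q q ≠ ⊤ :=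
    fun m _ ↦ layerParam_self_ne_top hq hq1 m
  have hFtop := ENNReal.sum_ne_top.mpr hF'
  have h2 := ENNReal.hasSum_toReal (h1 ▸ ENNReal.add_ne_top.mpr ⟨hFtop, hEtop h⟩)
  rw [← ENNReal.tsum_toReal_eq fun n ↦ ?_, h1, ENNReal.toReal_add hFtop (hEtop h),
    ENNReal.toReal_sum hF', hV, sub_add_cancel] at h2
  · convert h2 using 2 with n
    rw [ENNReal.toReal_mul, ENNReal.toReal_natCast, ENNReal.toReal_pow,
      ENNReal.toReal_ofReal (paramX_pos hq).le]
  · exact ENNReal.mul_ne_top (ENNReal.natCast_ne_top _) (ENNReal.pow_ne_top ENNReal.ofReal_ne_top)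

/-- The summand `1` is the contribution of `n = 0`, that is, of the empty list. -/
theorem hasSum_even (hq : 0 < q) (hq1 : q < 1) (r : ℕ) :
    HasSum (fun n ↦ ((idealLists (2 * r) n).ncard : ℝ) * paramX q ^ n)
      (1 + (1 - q) * evenSum q r / ((1 - q ^ (2 * r + 2)) * (1 - q ^ (2 * r + 3)))) := by
  refine hasSum_of_toReal hq hq1 ?_
  have h : 1 - q ≠ 0 := by linarith
  rw [sum_layerParam_even hq hq1, ← mul_evenSum]
  congr 2
  rw [← mul_div_mul_left ((1 - q) * evenSum q r) _ h]
  ring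

theorem hasSum_odd (hq : 0 < q) (hq1 : q < 1) (r : ℕ) :
    HasSum (fun n ↦ ((idealLists (2 * r + 1) n).ncard : ℝ) * paramX q ^ n)
      (1 + (1 - q) * oddSum q r / ((1 - q ^ (2 * r + 3)) * (1 - q ^ (2 * r + 4)))) := by
  refine hasSum_of_toReal hq hq1 ?_
  have h : 1 - q ≠ 0 := by linarith
  rw [sum_layerParam_odd_of_even hq hq1 (sum_layerParam_even hq hq1 r), ← mul_oddSum]
  congr 2
  rw [← mul_div_mul_left ((1 - q) * oddSum q r) _ h]
  ring

end Totals

/-! ### From values at real points to power series -/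

section Series

open PowerSeries

/-- The power series `f` sums to `s` at `x`. -/
def SumsTo (x : ℝ) (f : ℚ⟦X⟧) (s : ℝ) : Prop := HasSum (fun n ↦ ((coeff n f : ℚ) : ℝ) * x ^ n) s

variable {x s t : ℝ} {f g : ℚ⟦X⟧}

lemma SumsTo.add (hf : SumsTo x f s) (hg : SumsTo x g t) : SumsTo x (f + g) (s + t) := by
  unfold SumsTo
  convert HasSum.add hf hg using 2 with n
  rw [map_add]
  push_cast
  ring

lemma SumsTo.sub (hf : SumsTo x f s) (hg : SumsTo x g t) : SumsTo x (f - g) (s - t) := by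
  have h : (fun n ↦ ((coeff n (f - g) : ℚ) : ℝ) * x ^ n) =
      fun n ↦ ((coeff n f : ℚ) : ℝ) * x ^ n - ((coeff n g : ℚ) : ℝ) * x ^ n := by
    funext n
    rw [map_sub]
    push_cast
    ring
  rw [SumsTo, h]
  exact HasSum.sub hf hg

lemma SumsTo.mul (hf : SumsTo x f s) (hg : SumsTo x g t) : SumsTo x (f * g) (s * t) := by
  have hf' := hf.summable.norm
  have hg' := hg.summable.norm
  have h1 := tsum_mul_tsum_eq_tsum_sum_antidiagonal_of_summable_norm hf' hg'
  have h2 := (summable_norm_sum_mul_antidiagonal_of_summable_norm hf' hg').of_norm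
  rw [hf.tsum_eq, hg.tsum_eq] at h1
  have h : (fun n ↦ ((coeff n (f * g) : ℚ) : ℝ) * x ^ n) = fun n ↦
      ∑ p ∈ Finset.HasAntidiagonal.antidiagonal n,
        ((coeff p.1 f : ℚ) : ℝ) * x ^ p.1 * (((coeff p.2 g : ℚ) : ℝ) * x ^ p.2) := by
    funext n
    rw [coeff_mul]
    push_cast
    rw [Finset.sum_mul]
    refine Finset.sum_congr rfl fun p hp ↦ ?_
    rw [← Finset.HasAntidiagonal.mem_antidiagonal.mp hp]
    ring
  rw [h1, SumsTo, h]
  exact h2.hasSum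

lemma sumsTo_monomial (x : ℝ) (k : ℕ) (c : ℚ) : SumsTo x (monomial k c) (c * x ^ k) := by
  have := hasSum_single (f := fun n ↦ ((coeff n (monomial k c) : ℚ) : ℝ) * x ^ n) k fun n hn ↦ by
    rw [coeff_monomial, if_neg hn]
    simp
  simpa [SumsTo] using this

lemma sumsTo_natCast (x : ℝ) (c : ℕ) : SumsTo x (c : ℚ⟦X⟧) c := by
  have h := sumsTo_monomial x 0 c
  rw [monomial_zero_eq_C_apply, map_natCast] at h
  simpa using h

lemma sumsTo_one (x : ℝ) : SumsTo x 1 1 := by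
  simpa using sumsTo_natCast x 1

lemma sumsTo_zero (x : ℝ) : SumsTo x 0 0 := by
  simpa using sumsTo_natCast x 0

lemma sumsTo_X_pow (x : ℝ) (k : ℕ) : SumsTo x (X ^ k) (x ^ k) := by
  have h := sumsTo_monomial x k 1
  rwa [← X_pow_eq, Rat.cast_one, one_mul] at h

lemma SumsTo.sum {ι : Type*} {I : Finset ι} {F : ι → ℚ⟦X⟧} {S : ι → ℝ}
    (h : ∀ i ∈ I, SumsTo x (F i) (S i)) : SumsTo x (∑ i ∈ I, F i) (∑ i ∈ I, S i) := by
  classical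
  induction I using Finset.induction_on with
  | empty => simpa using sumsTo_zero x
  | insert a I ha ih =>
    rw [Finset.sum_insert ha, Finset.sum_insert ha]
    exact (h a (by simp)).add (ih fun i hi ↦ h i (by simp [hi]))

/-- A power series that sums to zero at points tending to zero is zero. -/
lemma eq_zero_of_sumsTo (h : ∃ᶠ y in nhdsWithin 0 {0}ᶜ, SumsTo y f 0) : f = 0 := by
  set p := FormalMultilinearSeries.ofScalars ℝ (fun n ↦ ((coeff n f : ℚ) : ℝ)) with hp
  -- Convergence at a single nonzero point gives a positive radius; the identity theorem then
  -- applies to the zeros accumulating at the origin.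
  have hr : 0 < p.radius := by
    obtain ⟨y, hy, hy0⟩ := (h.and_eventually self_mem_nhdsWithin).exists
    have h1 : ((‖y‖₊ : NNReal) : ENNReal) ≤ p.radius := by
      refine p.le_radius_of_summable_norm (hy.summable.norm.congr fun n ↦ ?_)
      rw [hp, FormalMultilinearSeries.ofScalars_norm, norm_mul, norm_pow, coe_nnnorm]
    refine lt_of_lt_of_le ?_ h1
    simpa using hy0
  have hball := p.hasFPowerSeriesOnBall hr
  have h0 : p.sum =ᶠ[nhds 0] 0 := by
    refine hball.analyticAt.frequently_zero_iff_eventually_zero.mp (h.mono fun y hy ↦ ?_)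
    have h1 : p.sum y = _ := FormalMultilinearSeries.ofScalars_sum_eq _ y
    rw [h1]
    exact hy.tsum_eq
  have hp0 := hball.hasFPowerSeriesAt.eq_zero_of_eventually h0
  rw [hp, FormalMultilinearSeries.ofScalars_series_eq_zero] at hp0
  ext n
  simpa using congrFun hp0 n

lemma eq_zero_of_sumsTo_paramX (h : ∀ q : ℝ, 0 < q → q < 1 → SumsTo (paramX q) f 0) : f = 0 := by
  refine eq_zero_of_sumsTo (Filter.Tendsto.frequently (f := paramX)
    (l₁ := nhdsWithin 0 (Set.Ioi 0)) ?_ (Filter.Eventually.frequently ?_))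
  · refine tendsto_nhdsWithin_iff.mpr ⟨?_, ?_⟩
    · have h1 : ContinuousAt paramX 0 := by
        unfold paramX
        exact continuousAt_id.div (by fun_prop) (by norm_num)
      have h2 := h1.tendsto
      rw [show paramX 0 = 0 by simp [paramX]] at h2
      exact h2.mono_left nhdsWithin_le_nhds
    · filter_upwards [self_mem_nhdsWithin] with q hq
      exact (paramX_pos hq).ne'
  · filter_upwards [Ioo_mem_nhdsGT one_pos] with q hq
    exact h q hq.1 hq.2

/-- The power series `x ^ ((k-1)/2) U_{k-1} (1 / (2 √x))`. -/
noncomputable def cheb : ℕ → ℚ⟦X⟧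
  | 0 => 0
  | 1 => 1
  | k + 2 => cheb (k + 1) - X * cheb k

lemma constantCoeff_cheb (k : ℕ) : constantCoeff (cheb (k + 1)) = 1 := by
  induction k with
  | zero => simp [cheb]
  | succ k ih => rw [cheb, map_sub, ih, map_mul, constantCoeff_X, zero_mul, sub_zero]

lemma cheb_ne_zero (k : ℕ) : cheb (k + 1) ≠ 0 := fun h ↦ by
  have := constantCoeff_cheb k
  simp [h] at this

/-- Formally, `q = exp (2it)` gives `1 / √x = 2 cos t`, and the value is `x ^ ((k-1)/2) * sin (k t)
/ sin t`. -/
lemma sumsTo_cheb {q : ℝ} (hq : 0 < q) (hq1 : q < 1) (k : ℕ) :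
    SumsTo (paramX q) (cheb k) ((1 - q ^ k) * (1 + q) / ((1 - q) * (1 + q) ^ k)) := by
  have hq2 : 1 - q ≠ 0 := by linarith
  have hq3 : 1 + q ≠ 0 := by linarith
  induction k using Nat.twoStepInduction with
  | zero => simpa [cheb] using sumsTo_zero _
  | one =>
    rw [cheb, pow_one, pow_one, div_self (mul_ne_zero hq2 hq3)]
    exact sumsTo_one _
  | more k ih1 ih2 =>
    have h := ih2.sub ((sumsTo_X_pow (paramX q) 1).mul ih1)
    rw [pow_one, ← cheb] at h
    convert h using 1
    rw [paramX]
    field_simp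
    ring

/-- The denominator depends only on `2 * a + k`, which is the same for all terms of a numerator. -/
lemma sumsTo_X_pow_mul_cheb {q : ℝ} (hq : 0 < q) (hq1 : q < 1) (a k : ℕ) {m N : ℕ}
    (hm : a + k = m) (hN : 2 * a + k = N + 1) :
    SumsTo (paramX q) (X ^ a * cheb k) ((q ^ a - q ^ m) / ((1 - q) * (1 + q) ^ N)) := by
  have hq2 : 1 - q ≠ 0 := by linarith
  have hq3 : 1 + q ≠ 0 := by linarith
  convert (sumsTo_X_pow (paramX q) a).mul (sumsTo_cheb hq hq1 k) using 1
  have h : (1 + q) ^ (2 * a) * (1 + q) ^ k = (1 + q) * (1 + q) ^ N := by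
    rw [← pow_add, hN, pow_succ']
  rw [paramX, div_pow, ← pow_mul, div_mul_div_comm, div_eq_div_iff (by positivity) (by positivity),
    ← hm]
  linear_combination (q ^ a - q ^ (a + k)) * (1 - q) * h

/-- The power series counting the ideals of class at most `h`. -/
noncomputable def idealSeries (h : ℕ) : ℚ⟦X⟧ := mk fun n ↦ ((idealLists h n).ncard : ℚ)

lemma sumsTo_idealSeries {h : ℕ}
    (hs : HasSum (fun n ↦ ((idealLists h n).ncard : ℝ) * x ^ n) s) :
    SumsTo x (idealSeries h) s := by
  simpa [SumsTo, idealSeries] using hs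

/-- The numerator of the generating function for class at most `2r`, as a power series in `x`. -/
noncomputable def evenSeries (r : ℕ) : ℚ⟦X⟧ :=
  ∑ i ∈ Finset.Icc 1 r, ((2 * i + 1 : ℕ) : ℚ⟦X⟧) * (X ^ (2 * r + 2 - i) * cheb (2 * i))
    + ((2 * r + 1 : ℕ) : ℚ⟦X⟧) * (X ^ (r + 1) * cheb (2 * r + 2))
    + ∑ i ∈ Finset.Icc 1 r, ((2 * i : ℕ) : ℚ⟦X⟧) * (X ^ i * cheb (4 * r + 4 - 2 * i))

/-- The numerator of the generating function for class at most `2r+1`, as a power series. -/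
noncomputable def oddSeries (r : ℕ) : ℚ⟦X⟧ :=
  ∑ i ∈ Finset.Icc 1 r, ((2 * i + 1 : ℕ) : ℚ⟦X⟧) * (X ^ (2 * r + 3 - i) * cheb (2 * i))
    + ((2 * r + 2 : ℕ) : ℚ⟦X⟧) * (X ^ (r + 2) * cheb (2 * r + 2))
    + ∑ i ∈ Finset.Icc 1 (r + 1), ((2 * i : ℕ) : ℚ⟦X⟧) * (X ^ i * cheb (4 * r + 6 - 2 * i))

lemma sumsTo_evenSeries {q : ℝ} (hq : 0 < q) (hq1 : q < 1) (r : ℕ) :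
    SumsTo (paramX q) (evenSeries r) (evenSum q r / ((1 - q) * (1 + q) ^ (4 * r + 3))) := by
  rw [evenSum, add_div, add_div, Finset.sum_div, Finset.sum_div]
  refine ((SumsTo.sum fun i hi ↦ ?_).add ?_).add (SumsTo.sum fun i hi ↦ ?_)
  · rw [Finset.mem_Icc] at hi
    convert (sumsTo_natCast _ _).mul (sumsTo_X_pow_mul_cheb hq hq1 (2 * r + 2 - i) (2 * i)
      (m := 2 * r + 2 + i) (N := 4 * r + 3) (by omega) (by omega)) using 1
    push_cast
    ring
  · convert (sumsTo_natCast _ _).mul (sumsTo_X_pow_mul_cheb hq hq1 (r + 1) (2 * r + 2)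
      (m := 3 * r + 3) (N := 4 * r + 3) (by omega) (by omega)) using 1
    push_cast
    ring
  · rw [Finset.mem_Icc] at hi
    convert (sumsTo_natCast _ _).mul (sumsTo_X_pow_mul_cheb hq hq1 i (4 * r + 4 - 2 * i)
      (m := 4 * r + 4 - i) (N := 4 * r + 3) (by omega) (by omega)) using 1
    push_cast
    ring

lemma sumsTo_oddSeries {q : ℝ} (hq : 0 < q) (hq1 : q < 1) (r : ℕ) :
    SumsTo (paramX q) (oddSeries r) (oddSum q r / ((1 - q) * (1 + q) ^ (4 * r + 5))) := by
  rw [oddSum, add_div, add_div, Finset.sum_div, Finset.sum_div]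
  refine ((SumsTo.sum fun i hi ↦ ?_).add ?_).add (SumsTo.sum fun i hi ↦ ?_)
  · rw [Finset.mem_Icc] at hi
    convert (sumsTo_natCast _ _).mul (sumsTo_X_pow_mul_cheb hq hq1 (2 * r + 3 - i) (2 * i)
      (m := 2 * r + 3 + i) (N := 4 * r + 5) (by omega) (by omega)) using 1
    push_cast
    ring
  · convert (sumsTo_natCast _ _).mul (sumsTo_X_pow_mul_cheb hq hq1 (r + 2) (2 * r + 2)
      (m := 3 * r + 4) (N := 4 * r + 5) (by omega) (by omega)) using 1
    push_cast
    ring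
  · rw [Finset.mem_Icc] at hi
    convert (sumsTo_natCast _ _).mul (sumsTo_X_pow_mul_cheb hq hq1 i (4 * r + 6 - 2 * i)
      (m := 4 * r + 6 - i) (N := 4 * r + 5) (by omega) (by omega)) using 1
    push_cast
    ring

theorem cheb_mul_idealSeries_even (r : ℕ) :
    cheb (2 * r + 2) * cheb (2 * r + 3) * (idealSeries (2 * r) - 1) = evenSeries r := by
  refine sub_eq_zero.mp (eq_zero_of_sumsTo_paramX fun q hq hq1 ↦ ?_)
  have hq2 : 1 - q ≠ 0 := by linarith
  have hq3 : 1 + q ≠ 0 := by linarith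
  have h1 := (one_sub_pow_pos hq hq1 (k := 2 * r + 2) (by omega)).ne'
  have h2 := (one_sub_pow_pos hq hq1 (k := 2 * r + 3) (by omega)).ne'
  convert (((sumsTo_cheb hq hq1 _).mul (sumsTo_cheb hq hq1 _)).mul
    ((sumsTo_idealSeries (hasSum_even hq hq1 r)).sub (sumsTo_one _))).sub
    (sumsTo_evenSeries hq hq1 r) using 1
  rw [add_sub_cancel_left, show 4 * r + 3 = 2 * r + 2 + (2 * r + 1) by ring,
    show 2 * r + 3 = 2 * r + 1 + 2 by ring] at *
  rw [pow_add (1 + q), pow_add (1 + q) (2 * r + 1)]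
  field_simp
  ring

theorem cheb_mul_idealSeries_odd (r : ℕ) :
    cheb (2 * r + 3) * cheb (2 * r + 4) * (idealSeries (2 * r + 1) - 1) = oddSeries r := by
  refine sub_eq_zero.mp (eq_zero_of_sumsTo_paramX fun q hq hq1 ↦ ?_)
  have hq2 : 1 - q ≠ 0 := by linarith
  have hq3 : 1 + q ≠ 0 := by linarith
  have h1 := (one_sub_pow_pos hq hq1 (k := 2 * r + 3) (by omega)).ne'
  have h2 := (one_sub_pow_pos hq hq1 (k := 2 * r + 4) (by omega)).ne'
  convert (((sumsTo_cheb hq hq1 _).mul (sumsTo_cheb hq hq1 _)).mul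
    ((sumsTo_idealSeries (hasSum_odd hq hq1 r)).sub (sumsTo_one _))).sub
    (sumsTo_oddSeries hq hq1 r) using 1
  rw [add_sub_cancel_left, show 4 * r + 5 = 2 * r + 3 + (2 * r + 2) by ring,
    show 2 * r + 4 = 2 * r + 2 + 2 by ring] at *
  rw [pow_add (1 + q), pow_add (1 + q) (2 * r + 2)]
  field_simp
  ring

end Series

/-! ### Chebyshev polynomials in the field containing the square root -/

section Hahn

open PowerSeries (X mk)

lemma sqrtX_ne_zero : sqrtX ≠ 0 := HahnSeries.single_ne_zero one_ne_zero

lemma sqrtX_sq : sqrtX ^ 2 = HahnSeries.ofPowerSeries ℚ ℚ X := by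
  rw [sqrtX, pow_two, HahnSeries.single_mul_single, HahnSeries.ofPowerSeries_X]
  norm_num

lemma series_two_ne_zero : (2 : Series) ≠ 0 := by
  rw [← map_ofNat (HahnSeries.C : ℚ →+* Series) 2]
  exact HahnSeries.C_ne_zero two_ne_zero

lemma Utilde_add_two (k : ℤ) : Utilde (k + 2) = sqrtX⁻¹ * Utilde (k + 1) - Utilde k := by
  rw [Utilde, Polynomial.Chebyshev.U_add_two, map_sub, map_mul, map_mul, Polynomial.aeval_X]
  have h := sqrtX_ne_zero
  have h2 := series_two_ne_zero
  have h3 : (Polynomial.aeval (1 / (2 * sqrtX))) (2 : Polynomial ℚ) * (1 / (2 * sqrtX)) =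
      sqrtX⁻¹ := by
    rw [map_ofNat]
    field_simp
  rw [h3]
  rfl

lemma sqrtX_pow_mul_Utilde (k : ℕ) :
    sqrtX ^ k * Utilde k = HahnSeries.ofPowerSeries ℚ ℚ (cheb (k + 1)) := by
  have h := sqrtX_ne_zero
  induction k using Nat.twoStepInduction with
  | zero => simp [Utilde, cheb]
  | one =>
    have h2 := series_two_ne_zero
    simp only [Utilde, cheb, Nat.cast_one, Polynomial.Chebyshev.U_one, map_mul, map_ofNat,
      Polynomial.aeval_X]
    rw [mul_zero, sub_zero, map_one]
    field_simp
  | more k ih1 ih2 =>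
    rw [cheb, map_sub, map_mul, ← ih1, ← ih2, ← sqrtX_sq]
    push_cast
    rw [Utilde_add_two]
    field_simp
    ring

lemma sqrtX_pow_mul_Utilde_eq {a k N : ℕ} (h : N = 2 * a + k) :
    sqrtX ^ N * Utilde k = HahnSeries.ofPowerSeries ℚ ℚ (X ^ a * cheb (k + 1)) := by
  rw [map_mul, map_pow, ← sqrtX_pow_mul_Utilde, ← sqrtX_sq, h]
  ring

lemma Utilde_ne_zero (k : ℕ) : Utilde k ≠ 0 := fun h ↦ by
  have h1 := sqrtX_pow_mul_Utilde k
  rw [h, mul_zero, ← map_zero (HahnSeries.ofPowerSeries ℚ ℚ)] at h1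
  exact cheb_ne_zero k (HahnSeries.ofPowerSeries_injective h1).symm

lemma idealLists_zero (h : ℕ) : idealLists h 0 = {[]} := by
  ext l
  constructor
  · rintro ⟨-, -, h⟩
    exact List.eq_nil_of_length_eq_zero h
  · rintro rfl
    refine ⟨trivial, Or.inl ?_, rfl⟩
    rw [listStat_of_headD_eq (by simp)]
    exact Nat.zero_le _

lemma X_mul_mk_eq {a : ℕ → ℕ} {h : ℕ} (ha : ∀ n, a n = (idealLists h (n + 1)).ncard) :
    X * mk (fun n ↦ (a n : ℚ)) = idealSeries h - 1 := by
  ext n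
  rcases n with _ | n
  · simp [idealSeries, idealLists_zero]
  · simp [idealSeries, ha, PowerSeries.coeff_succ_X_mul, PowerSeries.coeff_one]

/-- The factor `√x ^ (2h + 3)` splits as `√x ^ (h + 1) * √x ^ (h + 2)`, which turns both Chebyshev
values of the denominator into power series. -/
lemma genFun_eq_div {a : ℕ → ℕ} {h : ℕ} (ha : ∀ n, a n = (idealLists h (n + 1)).ncard)
    {Q : PowerSeries ℚ} (hQ : cheb (h + 2) * cheb (h + 3) * (idealSeries h - 1) = Q)
    {R : Series} (hR : sqrtX ^ (2 * h + 3) * R = HahnSeries.ofPowerSeries ℚ ℚ Q) :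
    genFun a = R / (Utilde (h + 1) * Utilde (h + 2)) := by
  have h1 : Utilde ((h : ℤ) + 1) ≠ 0 := Utilde_ne_zero (h + 1)
  have h2 : Utilde ((h : ℤ) + 2) ≠ 0 := Utilde_ne_zero (h + 2)
  rw [eq_div_iff (mul_ne_zero h1 h2)]
  refine mul_left_cancel₀ (pow_ne_zero (2 * h + 3) sqrtX_ne_zero) ?_
  have h3 : sqrtX ^ (h + 1) * Utilde ((h : ℤ) + 1) = _ := sqrtX_pow_mul_Utilde (h + 1)
  have h4 : sqrtX ^ (h + 2) * Utilde ((h : ℤ) + 2) = _ := sqrtX_pow_mul_Utilde (h + 2)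
  rw [hR, ← hQ, map_mul, map_mul, ← h3, ← h4, ← X_mul_mk_eq ha, ← genFun]
  ring

lemma sqrtX_pow_mul_even (r : ℕ) :
    sqrtX ^ (2 * (2 * r) + 3) *
      (∑ i ∈ Finset.Icc 1 r, (2 * (i : Series) + 1) * Utilde (2 * (i : ℤ) - 1)
          + (((2 * r : ℕ) : Series) + 1) * Utilde ((2 * r : ℕ) + 1)
          + ∑ i ∈ Finset.Icc 1 r,
              2 * (i : Series) * Utilde (2 * ((2 * r : ℕ) : ℤ) + 3 - 2 * (i : ℤ))) =
      HahnSeries.ofPowerSeries ℚ ℚ (evenSeries r) := by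
  rw [evenSeries, map_add, map_add, map_sum, map_sum, mul_add, mul_add, Finset.mul_sum,
    Finset.mul_sum]
  congr 1
  · congr 1
    · refine Finset.sum_congr rfl fun i hi ↦ ?_
      rw [Finset.mem_Icc] at hi
      obtain ⟨j, rfl⟩ : ∃ j, i = j + 1 := ⟨i - 1, by omega⟩
      -- The exponent `a` is what remains of `√x ^ (2h + 3)`, in powers of `x`, after `√x ^ k` has
      -- been absorbed by `Utilde k`.
      have h := sqrtX_pow_mul_Utilde_eq (a := 2 * r + 2 - (j + 1)) (k := 2 * j + 1)
        (N := 2 * (2 * r) + 3) (by omega)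
      rw [map_mul, map_natCast, show 2 * (j + 1) = 2 * j + 1 + 1 by ring, ← h,
        show 2 * ((j + 1 : ℕ) : ℤ) - 1 = (2 * j + 1 : ℕ) by push_cast; ring]
      push_cast
      ring
    · have h := sqrtX_pow_mul_Utilde_eq (a := r + 1) (k := 2 * r + 1)
        (N := 2 * (2 * r) + 3) (by omega)
      rw [map_mul, map_natCast, ← h]
      push_cast
      ring
  · refine Finset.sum_congr rfl fun i hi ↦ ?_
    rw [Finset.mem_Icc] at hi
    have h := sqrtX_pow_mul_Utilde_eq (a := i) (k := 4 * r + 3 - 2 * i)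
      (N := 2 * (2 * r) + 3) (by omega)
    rw [map_mul, map_natCast, show 4 * r + 4 - 2 * i = 4 * r + 3 - 2 * i + 1 by omega, ← h,
      show 2 * ((2 * r : ℕ) : ℤ) + 3 - 2 * (i : ℤ) = (4 * r + 3 - 2 * i : ℕ) by omega]
    push_cast
    ring

lemma sqrtX_pow_mul_odd (r : ℕ) :
    sqrtX ^ (2 * (2 * r + 1) + 3) *
      (∑ i ∈ Finset.Icc 1 r, (2 * (i : Series) + 1) * Utilde (2 * (i : ℤ) - 1)
          + (((2 * r + 1 : ℕ) : Series) + 1) * Utilde (2 * r + 1 : ℕ)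
          + ∑ i ∈ Finset.Icc 1 (r + 1),
              2 * (i : Series) * Utilde (2 * ((2 * r + 1 : ℕ) : ℤ) + 3 - 2 * (i : ℤ))) =
      HahnSeries.ofPowerSeries ℚ ℚ (oddSeries r) := by
  rw [oddSeries, map_add, map_add, map_sum, map_sum, mul_add, mul_add, Finset.mul_sum,
    Finset.mul_sum]
  congr 1
  · congr 1
    · refine Finset.sum_congr rfl fun i hi ↦ ?_
      rw [Finset.mem_Icc] at hi
      obtain ⟨j, rfl⟩ : ∃ j, i = j + 1 := ⟨i - 1, by omega⟩
      have h := sqrtX_pow_mul_Utilde_eq (a := 2 * r + 3 - (j + 1)) (k := 2 * j + 1)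
        (N := 2 * (2 * r + 1) + 3) (by omega)
      rw [map_mul, map_natCast, show 2 * (j + 1) = 2 * j + 1 + 1 by ring, ← h,
        show 2 * ((j + 1 : ℕ) : ℤ) - 1 = (2 * j + 1 : ℕ) by push_cast; ring]
      push_cast
      ring
    · have h := sqrtX_pow_mul_Utilde_eq (a := r + 2) (k := 2 * r + 1)
        (N := 2 * (2 * r + 1) + 3) (by omega)
      rw [map_mul, map_natCast, ← h]
      push_cast
      ring
  · refine Finset.sum_congr rfl fun i hi ↦ ?_
    rw [Finset.mem_Icc] at hi
    have h := sqrtX_pow_mul_Utilde_eq (a := i) (k := 4 * r + 5 - 2 * i)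
      (N := 2 * (2 * r + 1) + 3) (by omega)
    rw [map_mul, map_natCast, show 4 * r + 6 - 2 * i = 4 * r + 5 - 2 * i + 1 by omega, ← h,
      show 2 * ((2 * r + 1 : ℕ) : ℤ) + 3 - 2 * (i : ℤ) = (4 * r + 5 - 2 * i : ℕ) by omega]
    push_cast
    ring

end Hahn

end TypeBIdeals

/-! ### The generating function in type B -/

open TypeBIdeals in
theorem corollaryB2 {g : ℕ → Type*} [∀ n, LieRing (g n)] [∀ n, LieAlgebra ℂ (g n)]
    [∀ n, FiniteDimensional ℂ (g n)] [∀ n, LieAlgebra.IsSimple ℂ (g n)]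
    (H : ∀ n, LieSubalgebra ℂ (g n)) [∀ n, (H n).IsCartanSubalgebra]
    (b : ∀ n, (LieAlgebra.IsKilling.rootSystem (H n)).Base)
    (hB : ∀ n, IsTypeB (n + 1) (b n)) (h : ℕ) :
    Utilde (h + 1) * Utilde (h + 2) ≠ 0 ∧
    (Even h →
      genFun (fun n ↦ numIdeals (b n) h) =
        (∑ i ∈ Finset.Icc 1 (h / 2), (2 * (i : Series) + 1) * Utilde (2 * (i : ℤ) - 1)
          + ((h : Series) + 1) * Utilde (h + 1)
          + ∑ i ∈ Finset.Icc 1 (h / 2), 2 * (i : Series) * Utilde (2 * (h : ℤ) + 3 - 2 * (i : ℤ)))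
        / (Utilde (h + 1) * Utilde (h + 2))) ∧
    (Odd h →
      genFun (fun n ↦ numIdeals (b n) h) =
        (∑ i ∈ Finset.Icc 1 ((h - 1) / 2), (2 * (i : Series) + 1) * Utilde (2 * (i : ℤ) - 1)
          + ((h : Series) + 1) * Utilde h
          + ∑ i ∈ Finset.Icc 1 ((h + 1) / 2),
              2 * (i : Series) * Utilde (2 * (h : ℤ) + 3 - 2 * (i : ℤ)))
        / (Utilde (h + 1) * Utilde (h + 2))) := by
  have ha (n : ℕ) : numIdeals (b n) h = (idealLists h (n + 1)).ncard := by
    rw [numIdeals_eq_ncard_isUpperLabels (hB n), ncard_isUpperLabels_eq (by omega)]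
  refine ⟨mul_ne_zero (Utilde_ne_zero (h + 1)) (Utilde_ne_zero (h + 2)), ?_, ?_⟩
  · rintro ⟨r, rfl⟩
    rw [← two_mul] at *
    refine genFun_eq_div ha (cheb_mul_idealSeries_even r) ?_
    rw [show 2 * r / 2 = r by omega]
    exact sqrtX_pow_mul_even r
  · rintro ⟨r, rfl⟩
    refine genFun_eq_div ha (cheb_mul_idealSeries_odd r) ?_
    rw [show (2 * r + 1 - 1) / 2 = r by omega, show (2 * r + 1 + 1) / 2 = r + 1 by omega]
    exact sqrtX_pow_mul_odd r
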